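/- Fix a finite alphabet $\Sigma$ and an infinite set $V$ of variables. A span $[i,j\rangle$ with $1\le i\le j$ is a span of $w\in\Sigma^*$ if $j\le |w|+1$; its value $w[i,j\rangle$ is the factor of $w$ from position $i$ to position $j-1$. A (schemaless) spanner over a finite $\mathcal X\subseteq V$ maps every $w\in\Sigma^*$ to a set of partial functions $t$ from $\mathcal X$ to the spans of $w$; a spanner is a spanner over some finite $\mathcal X\subseteq V$, and two spanners are equal if they agree on every word. A subword-marked word is a word over $\Sigma\cup\{\vdash_x,\dashv_x : x\in V\}$ such that, for every $x$, erasing all symbols other than $\vdash_x,\dashv_x$ leaves $\varepsilon$ or $\vdash_x\dashv_x$. Such a word $v$ yields the word $w$ obtained by erasing all markers, and a span-tuple $t$: if $v=v_1\vdash_x v_2\dashv_x v_3$, then $t(x)=[i,j\rangle$, where $i-1$ and $j-1$ are the numbers of $\Sigma$-letters in $v_1$ and in $v_1v_2$; if $\vdash_x$ does not occur in $v$, then $t(x)$ is undefined. The spanner described by a language $L$ of marked words using finitely many variables maps $w$ to the set of the span-tuples of all subword-marked $v\in L$ that yield $w$ (words of $L$ that are not subword-marked are ignored). A vset-automaton is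 a nondeterministic finite automaton with $\varepsilon$-transitions over $\Sigma$ and the markers of finitely many variables; a regex-formula is built from $\emptyset$, $\varepsilon$ and letters $a\in\Sigma$ by alternation, concatenation, Kleene star and variable capture $x\{\gamma\}$, the language of $x\{\gamma\}$ being $\vdash_x L(\gamma)\dashv_x$. Let $\mathfrak R$ be the class of the spanners described by vset-automata (the regular spanners), and $[\![\mathsf{RGX}]\!]$ the class of the spanners described by regex-formulas. The operations on spanners are: - union $\cup$, taken word by word; - natural join: $(S_1\bowtie S_2)(w)$ consists of all $t_1\cup t_2$ with $t_i\in S_i(w)$ such that $t_1$ and $t_2$ agree on $\mathrm{Dom}(t_1)\cap\mathrm{Dom}(t_2)$; - projection $\pi_{\mathcal Y}$ for finite $\mathcal Y \subseteq V$, which restricts every tuple to $\mathcal Y$; - string-equality selection $\varsigma^=_{\mathcal Y}$ for finite $\mathcal Y \subseteq V$, which keeps those $t\in S(w)$ for which $t(x)$ and $t(y)$ have the same value in $w$ for all $x,y\in\mathcal Y\cap\mathrm{Dom}(t)$; - span-fusion $\biguplus_{\lambda\to x}$, defined for a spanner over $\mathcal X$, $\lambda\subseteq\mathcal X$ and $x\notin\mathcal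 X\setminus\lambda$: every tuple $t$ is replaced by the tuple that is undefined on $\lambda\setminus\{x\}$, equals $t$ on $\mathcal X\setminus\lambda$, and maps $x$ to $[\min_k i_k,\max_k j_k\rangle$, where $[i_k,j_k\rangle$ ranges over the defined spans $t(y)$, $y\in\lambda$ (and is undefined on $x$ if there are none). For a class $\mathfrak S$ of spanners and a set $P$ of operations, $\mathfrak S^P$ denotes the closure of $\mathfrak S$ under the operations from $P$. The class of core spanners is $\mathfrak C=[\![\mathsf{RGX}]\!]^{\{\cup,\pi,\bowtie,\varsigma^=\}}$. Then $$\mathfrak R=[\![\mathsf{RGX}]\!]^{\{\cup,\bowtie,\pi\}}=[\![\mathsf{RGX}]\!]^{\{\biguplus,\pi\}}\qquad\text{and}\qquad \mathfrak C=[\![\mathsf{RGX}]\!]^{\{\cup,\bowtie,\pi,\varsigma^=\}}=[\![\mathsf{RGX}]\!]^{\{\biguplus,\pi,\varsigma^=\}}.$$ -/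

import Mathlib

namespace DocSpanner

/-! ### Spans, span-tuples and spanners -/

/-- A span `[left, right⟩` with `1 ≤ left ≤ right`. It is a span of the word `w` if moreover
`right ≤ |w| + 1`. -/
@[ext]
structure Span where
  left : ℕ
  right : ℕ
  one_le_left : 1 ≤ left
  left_le_right : left ≤ right

instance : DecidableEq Span := fun s s' =>
  decidable_of_iff (s.left = s'.left ∧ s.right = s'.right) Span.ext_iff.symm

/-- The value `w[i, j⟩` of a span: the factor of `w` from (1-based) position `i` to `j - 1`. -/
def Span.value {A : Type*} (s : Span) (w : List A) : List A :=
  (w.drop (s.left - 1)).take (s.right - s.left)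

/-- A span-tuple: a partial function from variables to spans (`none` means undefined). -/
abbrev SpanTuple (V : Type*) := V → Option Span

/-- `t` is an `(X, w)`-tuple: its domain is contained in `X` and its values are spans of `w`. -/
def IsTuple {A V : Type*} (X : Finset V) (w : List A) (t : SpanTuple V) : Prop :=
  ∀ x s, t x = some s → x ∈ X ∧ s.right ≤ w.length + 1

/-- A (schemaless) spanner over the terminal alphabet `A`, with variables from `V`: a function
that maps every word `w` to an `(X, w)`-relation, for some finite set `X` of variables. -/
@[ext]
structure Spanner (A V : Type*) where
  rel : List A → Set (SpanTuple V)
  exists_vars : ∃ X : Finset V, ∀ w, ∀ t ∈ rel w, IsTuple X w t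

/-- `S` is a spanner over the finite set `X` of variables. -/
def Spanner.IsOver {A V : Type*} (S : Spanner A V) (X : Finset V) : Prop :=
  ∀ w, ∀ t ∈ S.rel w, IsTuple X w t

/-! ### Operations on spanners -/

section Operations

variable {A V : Type*} [DecidableEq V]

/-- The union of two spanners. -/
def Spanner.union (S₁ S₂ : Spanner A V) : Spanner A V where
  rel w := S₁.rel w ∪ S₂.rel w
  exists_vars := by
    obtain ⟨X₁, h₁⟩ := S₁.exists_vars
    obtain ⟨X₂, h₂⟩ := S₂.exists_vars
    refine ⟨X₁ ∪ X₂, fun w t ht x s hs => ?_⟩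
    rcases ht with ht | ht
    · exact ⟨Finset.mem_union_left _ (h₁ w t ht x s hs).1, (h₁ w t ht x s hs).2⟩
    · exact ⟨Finset.mem_union_right _ (h₂ w t ht x s hs).1, (h₂ w t ht x s hs).2⟩

/-- Two span-tuples are compatible if they agree wherever both are defined. -/
def Compatible (t₁ t₂ : SpanTuple V) : Prop :=
  ∀ x s₁ s₂, t₁ x = some s₁ → t₂ x = some s₂ → s₁ = s₂

/-- The join of two (compatible) span-tuples: it is `t₁ x` if that is defined, else `t₂ x`. -/
def joinTuple (t₁ t₂ : SpanTuple V) : SpanTuple V := fun x => (t₁ x).or (t₂ x)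

/-- The natural join of two spanners. -/
def Spanner.join (S₁ S₂ : Spanner A V) : Spanner A V where
  rel w := {t | ∃ t₁ ∈ S₁.rel w, ∃ t₂ ∈ S₂.rel w, Compatible t₁ t₂ ∧ t = joinTuple t₁ t₂}
  exists_vars := by
    obtain ⟨X₁, h₁⟩ := S₁.exists_vars
    obtain ⟨X₂, h₂⟩ := S₂.exists_vars
    refine ⟨X₁ ∪ X₂, ?_⟩
    rintro w _ ⟨t₁, ht₁, t₂, ht₂, -, rfl⟩ x s hs
    rcases Option.or_eq_some_iff.1 hs with hs | ⟨-, hs⟩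
    · exact ⟨Finset.mem_union_left _ (h₁ w t₁ ht₁ x s hs).1, (h₁ w t₁ ht₁ x s hs).2⟩
    · exact ⟨Finset.mem_union_right _ (h₂ w t₂ ht₂ x s hs).1, (h₂ w t₂ ht₂ x s hs).2⟩

/-- The restriction of a span-tuple to a set of variables. -/
def restrictTuple (Y : Finset V) (t : SpanTuple V) : SpanTuple V :=
  fun x => if x ∈ Y then t x else none

/-- The projection of a spanner to a set of variables. -/
def Spanner.proj (Y : Finset V) (S : Spanner A V) : Spanner A V where
  rel w := restrictTuple Y '' S.rel w
  exists_vars := by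
    obtain ⟨X, h⟩ := S.exists_vars
    refine ⟨X, ?_⟩
    rintro w _ ⟨t, ht, rfl⟩ x s hs
    by_cases hx : x ∈ Y
    · exact h w t ht x s (by simpa [restrictTuple, hx] using hs)
    · simp [restrictTuple, hx] at hs

/-- The string-equality selection: keep the tuples all of whose *defined* variables from `Y`
have the same value. -/
def Spanner.strEq (Y : Finset V) (S : Spanner A V) : Spanner A V where
  rel w := {t | t ∈ S.rel w ∧ ∀ x ∈ Y, ∀ y ∈ Y, ∀ s s', t x = some s → t y = some s' →
    s.value w = s'.value w}
  exists_vars := by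
    obtain ⟨X, h⟩ := S.exists_vars
    exact ⟨X, fun w t ht => h w t ht.1⟩

/-- The span-fusion of two spans: `[min i i', max j j'⟩`. -/
def Span.fuse (s s' : Span) : Span where
  left := min s.left s'.left
  right := max s.right s'.right
  one_le_left := le_min s.one_le_left s'.one_le_left
  left_le_right := (min_le_left _ _).trans (s.left_le_right.trans (le_max_left _ _))

/-- The span-fusion of two possibly undefined spans; the undefined span is neutral. -/
def optFuse : Option Span → Option Span → Option Span
  | some s, some s' => some (s.fuse s')
  | some s, none => some s
  | none, o => o

instance : Std.Commutative optFuse where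
  comm a b := by
    cases a <;> cases b <;> simp [optFuse, Span.fuse, min_comm, max_comm]

instance : Std.Associative optFuse where
  assoc a b c := by
    cases a <;> cases b <;> cases c <;> simp [optFuse, Span.fuse, min_assoc, max_assoc]

/-- The span-fusion of a finite set of (possibly undefined) spans; undefined if there is none. -/
def bigFuse (K : Finset (Option Span)) : Option Span := K.fold optFuse none id

/-- The tuple obtained from `t` by replacing the variables from `lam` by the single variable `x`,
which gets the span-fusion of all the spans `t y` with `y ∈ lam`. -/
def fuseTuple (lam : Finset V) (x : V) (t : SpanTuple V) : SpanTuple V :=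
  fun z => if z = x then bigFuse (lam.image t) else if z ∈ lam then none else t z

theorem bigFuse_right_le (n : ℕ) (K : Finset (Option Span))
    (hK : ∀ s, some s ∈ K → s.right ≤ n) (s : Span) (hs : bigFuse K = some s) : s.right ≤ n := by
  induction K using Finset.induction_on generalizing s with
  | empty => simp [bigFuse] at hs
  | insert o K ho ih =>
    have hK' := ih fun s hs => hK s (Finset.mem_insert_of_mem hs)
    have ho' : ∀ s, o = some s → s.right ≤ n := fun s hs => hK s (by simp [hs])
    rw [bigFuse, Finset.fold_insert ho, ← bigFuse, id] at hs
    cases o with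
    | none => exact hK' s hs
    | some a =>
      cases hb : bigFuse K with
      | none =>
        rw [hb] at hs
        exact ho' s hs
      | some b =>
        rw [hb] at hs
        obtain rfl : a.fuse b = s := Option.some.inj hs
        exact max_le (ho' a rfl) (hK' b hb)

/-- The span-fusion operation `lam → x` on spanners. -/
def Spanner.fusion (lam : Finset V) (x : V) (S : Spanner A V) : Spanner A V where
  rel w := fuseTuple lam x '' S.rel w
  exists_vars := by
    obtain ⟨X, h⟩ := S.exists_vars
    refine ⟨insert x X, ?_⟩
    rintro w _ ⟨t, ht, rfl⟩ z s hs
    by_cases hz : z = x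
    · refine ⟨by simp [hz], bigFuse_right_le _ (lam.image t) ?_ s (by simpa [fuseTuple, hz] using hs)⟩
      intro s' hs'
      obtain ⟨y, -, hy⟩ := Finset.mem_image.1 hs'
      exact (h w t ht y s' hy).2
    · by_cases hl : z ∈ lam
      · simp [fuseTuple, hz, hl] at hs
      · have := h w t ht z s (by simpa [fuseTuple, hz, hl] using hs)
        exact ⟨Finset.mem_insert_of_mem this.1, this.2⟩

/-- The names of the spanner operations. -/
inductive SpannerOp where
  | union
  | join
  | proj
  | strEq
  | fusion

/-- Membership in the closure of the class `C` of spanners under the operations from `P`.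
Since a spanner over `X` is also a spanner over every finite superset of `X`, union and join apply
to any two spanners, and projection and string-equality selection apply to any finite set `Y`.
The span-fusion `lam → x` applies to a spanner over `X` if `lam ⊆ X` and `x ∉ X \ lam`. -/
inductive InClosure (C : Set (Spanner A V)) (P : Set SpannerOp) : Spanner A V → Prop
  | base {S : Spanner A V} : S ∈ C → InClosure C P S
  | union {S₁ S₂ : Spanner A V} : SpannerOp.union ∈ P →
      InClosure C P S₁ → InClosure C P S₂ → InClosure C P (S₁.union S₂)
  | join {S₁ S₂ : Spanner A V} : SpannerOp.join ∈ P →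
      InClosure C P S₁ → InClosure C P S₂ → InClosure C P (S₁.join S₂)
  | proj {S : Spanner A V} (Y : Finset V) : SpannerOp.proj ∈ P →
      InClosure C P S → InClosure C P (S.proj Y)
  | strEq {S : Spanner A V} (Y : Finset V) : SpannerOp.strEq ∈ P →
      InClosure C P S → InClosure C P (S.strEq Y)
  | fusion {S : Spanner A V} (X lam : Finset V) (x : V) : SpannerOp.fusion ∈ P →
      S.IsOver X → lam ⊆ X → x ∉ X \ lam →
      InClosure C P S → InClosure C P (S.fusion lam x)

/-- The closure of a class of spanners under the operations from `P`. -/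
def closureUnder (C : Set (Spanner A V)) (P : Set SpannerOp) : Set (Spanner A V) :=
  {S | InClosure C P S}

end Operations

/-! ### Subword-marked words and the spanner described by a language of marked words -/

/-- The symbols of marked words: terminal letters and, for every variable `x`, the opening and
the closing marker of `x`. -/
inductive MarkedSym (A V : Type*) where
  | letter (a : A)
  | opn (x : V)
  | cls (x : V)

/-- The letter represented by a symbol, if any. -/
def MarkedSym.letter? {A V : Type*} : MarkedSym A V → Option A
  | .letter a => some a
  | .opn _ => none
  | .cls _ => none

/-- Whether a symbol is one of the two markers of `x`. -/
def MarkedSym.isMarkerOf {A V : Type*} [DecidableEq V] (x : V) : MarkedSym A V → Bool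
  | .letter _ => false
  | .opn y => decide (y = x)
  | .cls y => decide (y = x)

/-- The word over the terminal alphabet obtained by erasing all markers. -/
def plainWord {A V : Type*} (v : List (MarkedSym A V)) : List A :=
  v.filterMap MarkedSym.letter?

/-- Subword-marked words: erasing everything but the markers of a variable `x` leaves either the
empty word or the opening marker of `x` followed by the closing marker of `x`. -/
def IsSubwordMarked {A V : Type*} [DecidableEq V] (v : List (MarkedSym A V)) : Prop :=
  ∀ x : V, v.filter (MarkedSym.isMarkerOf x) = [] ∨
    v.filter (MarkedSym.isMarkerOf x) = [.opn x, .cls x]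

/-- `t` is the span-tuple of the subword-marked word `v`: it maps `x` to `[i, j⟩` if and only if
`v = v₁ (open x) v₂ (close x) v₃`, where `v₁` has `i - 1` letters and `v₁ v₂` has `j - 1`. -/
def IsSpanTupleOf {A V : Type*} (v : List (MarkedSym A V)) (t : SpanTuple V) : Prop :=
  ∀ x s, t x = some s ↔ ∃ v₁ v₂ v₃ : List (MarkedSym A V),
    v = v₁ ++ .opn x :: (v₂ ++ .cls x :: v₃) ∧
    s.left = (plainWord v₁).length + 1 ∧ s.right = (plainWord (v₁ ++ v₂)).length + 1

/-- All markers that occur in the words of `L` are markers of variables from `X`. -/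
def VarsIn {A V : Type*} (X : Finset V) (L : Language (MarkedSym A V)) : Prop :=
  ∀ v ∈ L, ∀ x, (.opn x ∈ v ∨ .cls x ∈ v) → x ∈ X

/-- The spanner described by a language of marked words with finitely many variables: it maps `w`
to the set of the span-tuples of all those subword-marked words `v` in `L` that yield `w` when
their markers are erased. Words in `L` that are not subword-marked are ignored. -/
def Spanner.ofLanguage {A V : Type*} [DecidableEq V] (L : Language (MarkedSym A V))
    (hL : ∃ X : Finset V, VarsIn X L) : Spanner A V where
  rel w := {t | ∃ v ∈ L, IsSubwordMarked v ∧ plainWord v = w ∧ IsSpanTupleOf v t}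
  exists_vars := by
    obtain ⟨X, hX⟩ := hL
    refine ⟨X, ?_⟩
    rintro w t ⟨v, hv, -, rfl, ht⟩ x s hs
    obtain ⟨v₁, v₂, v₃, rfl, -, hr⟩ := (ht x s).1 hs
    refine ⟨hX _ hv x (Or.inl (by simp)), ?_⟩
    rw [hr]
    simp only [plainWord, List.filterMap_append, List.length_append, List.filterMap_cons,
      MarkedSym.letter?]
    omega

/-! ### Regex-formulas -/

/-- Regex-formulas: regular expressions extended by variable captures `x{γ}`. -/
inductive RegexFormula (A V : Type*) where
  | empty
  | epsilon
  | char (a : A)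
  | alt (γ₁ γ₂ : RegexFormula A V)
  | concat (γ₁ γ₂ : RegexFormula A V)
  | star (γ : RegexFormula A V)
  | capture (x : V) (γ : RegexFormula A V)

namespace RegexFormula

variable {A V : Type*}

/-- The language of marked words of a regex-formula; `x{γ}` puts the markers of `x` around the
words of `γ`. -/
def lang : RegexFormula A V → Language (MarkedSym A V)
  | empty => 0
  | epsilon => 1
  | char a => {[.letter a]}
  | alt γ₁ γ₂ => γ₁.lang + γ₂.lang
  | concat γ₁ γ₂ => γ₁.lang * γ₂.lang
  | star γ => KStar.kstar γ.lang
  | capture x γ => {[.opn x]} * γ.lang * {[.cls x]}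

variable [DecidableEq V]

/-- The variables that occur in a regex-formula. -/
def vars : RegexFormula A V → Finset V
  | empty => ∅
  | epsilon => ∅
  | char _ => ∅
  | alt γ₁ γ₂ => γ₁.vars ∪ γ₂.vars
  | concat γ₁ γ₂ => γ₁.vars ∪ γ₂.vars
  | star γ => γ.vars
  | capture x γ => insert x γ.vars

theorem varsIn_lang (γ : RegexFormula A V) : VarsIn γ.vars γ.lang := by
  induction γ with
  | empty => intro v hv; exact absurd hv (Language.notMem_zero v)
  | epsilon =>
    intro v hv x hx
    rw [lang, Language.mem_one] at hv
    simp [hv] at hx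
  | char a =>
    intro v hv x hx
    obtain rfl : v = [.letter a] := hv
    simp at hx
  | alt γ₁ γ₂ h₁ h₂ =>
    intro v hv x hx
    rw [lang, Language.mem_add] at hv
    rcases hv with hv | hv
    · exact Finset.mem_union_left _ (h₁ v hv x hx)
    · exact Finset.mem_union_right _ (h₂ v hv x hx)
  | concat γ₁ γ₂ h₁ h₂ =>
    intro v hv x hx
    rw [lang, Language.mem_mul] at hv
    obtain ⟨u₁, hu₁, u₂, hu₂, rfl⟩ := hv
    simp only [List.mem_append] at hx
    have := h₁ u₁ hu₁ x
    have := h₂ u₂ hu₂ x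
    simp only [vars, Finset.mem_union]
    tauto
  | star γ h =>
    intro v hv x hx
    rw [lang, Language.mem_kstar] at hv
    obtain ⟨us, rfl, hus⟩ := hv
    simp only [List.mem_flatten] at hx
    rcases hx with ⟨u, hu, hx⟩ | ⟨u, hu, hx⟩
    · exact h u (hus u hu) x (Or.inl hx)
    · exact h u (hus u hu) x (Or.inr hx)
  | capture y γ h =>
    intro v hv x hx
    rw [lang, Language.mem_mul] at hv
    obtain ⟨u₁, hu₁, u₂, hu₂, rfl⟩ := hv
    rw [Language.mem_mul] at hu₁
    obtain ⟨u₃, hu₃, u₄, hu₄, rfl⟩ := hu₁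
    obtain rfl : u₃ = [.opn y] := hu₃
    obtain rfl : u₂ = [.cls y] := hu₂
    have := h u₄ hu₄ x
    simp only [List.mem_append, List.mem_singleton, MarkedSym.opn.injEq, MarkedSym.cls.injEq,
      reduceCtorEq, or_false, false_or] at hx
    simp only [vars, Finset.mem_insert]
    tauto

/-- The (schemaless) spanner of a regex-formula. -/
def spanner (γ : RegexFormula A V) : Spanner A V :=
  Spanner.ofLanguage γ.lang ⟨γ.vars, γ.varsIn_lang⟩

end RegexFormula

/-- The class of spanners represented by regex-formulas. -/
def regexSpanners (A V : Type*) [DecidableEq V] : Set (Spanner A V) :=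
  {S | ∃ γ : RegexFormula A V, S = γ.spanner}

/-! ### Variable-set automata -/

/-- A vset-automaton: a finite automaton with `ε`-transitions, whose other transitions read a
letter or open or close a variable from a finite set of variables. -/
structure VSetAutomaton (A V : Type*) where
  State : Type
  finite_state : Finite State
  aut : εNFA (MarkedSym A V) State
  vars : Finset V
  opn_mem : ∀ p q x, q ∈ aut.step p (some (.opn x)) → x ∈ vars
  cls_mem : ∀ p q x, q ∈ aut.step p (some (.cls x)) → x ∈ vars

namespace VSetAutomaton

variable {A V : Type*}

theorem varsIn_accepts (M : VSetAutomaton A V) : VarsIn M.vars M.aut.accepts := by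
  intro v hv x hx
  rw [εNFA.mem_accepts_iff_exists_path] at hv
  obtain ⟨p, q, v', -, -, rfl, hpath⟩ := hv
  have key : ∀ {p q : M.State} {u : List (Option (MarkedSym A V))}, M.aut.IsPath p q u →
      ∀ x, (some (.opn x) ∈ u ∨ some (.cls x) ∈ u) → x ∈ M.vars := by
    intro p q u hu x hx
    induction hu with
    | nil => simp at hx
    | cons t s u a l hst _ ih =>
      simp only [List.mem_cons] at hx
      rcases hx with (rfl | hx) | (rfl | hx)
      · exact M.opn_mem _ _ x hst
      · exact ih (Or.inl hx)
      · exact M.cls_mem _ _ x hst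
      · exact ih (Or.inr hx)
  refine key hpath x ?_
  simpa [List.reduceOption_mem_iff] using hx

/-- The (schemaless) spanner of a vset-automaton: a run contributes if it opens and closes every
variable properly and at most once, i.e. if it is labelled by a subword-marked word. -/
def spanner [DecidableEq V] (M : VSetAutomaton A V) : Spanner A V :=
  Spanner.ofLanguage M.aut.accepts ⟨M.vars, M.varsIn_accepts⟩

end VSetAutomaton

/-- The class of regular spanners: the spanners represented by vset-automata. -/
def regularSpanners (A V : Type*) [DecidableEq V] : Set (Spanner A V) :=
  {S | ∃ M : VSetAutomaton A V, S = M.spanner}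

/-- The class of core spanners: the closure of the class of regex-formula spanners under union,
projection, natural join and string-equality selection. -/
def coreSpanners (A V : Type*) [DecidableEq V] : Set (Spanner A V) :=
  closureUnder (regexSpanners A V)
    {SpannerOp.union, SpannerOp.proj, SpannerOp.join, SpannerOp.strEq}

end DocSpanner

/-!
# Regular and core spanners by regex-formulas and span-fusion

The whole argument rests on a description of regular spanners that does not depend on the order of
the markers between two letters. A span-tuple `t` on a word `w` is encoded by annotating each of the
`|w| + 1` gaps of `w` with the set of the markers of `t` in that gap (`tupleMarks`). A spanner is
recognizable (`IsRec`) if a finite automaton that reads annotated words decides whether `t ∈ S(w)`.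
The regular spanners are the recognizable ones (`isRec_of_mem_regularSpanners` and
`IsRec.mem_regularSpanners`). Recognizable properties of annotated words (`Recog`) admit Boolean
combinations and projection, so that automata can guess a second tuple or a domain; hence the
regular spanners are closed under union, join, projection and span-fusion
(`closureUnder_subset_regularSpanners`).

Conversely, a regular spanner over `X` is described by a regular language of subword-marked words,
in which an opening marker need not be matched within a subexpression. Replacing `⊢x` and `⊣x` by
empty captures of fresh variables `f x` and `g x` makes it the language of a regex-formula, by
Kleene's theorem (`exists_lang_eq_flatMap`, `exists_regex_isSplitOf`). The variables are then
recovered from their end points one at a time (`mem_of_recover_step`):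
* with span-fusion, `{f x, g x}` is fused to `x`, which needs no other operation
  (`regularSpanners_subset_closureUnder_fusion`);
* with joins, the spanner of `Σ* x{f x{ε} Σ* g x{ε}} Σ*` is joined, and `f x`, `g x` are projected
  away. This is correct only on tuples that are defined on `x`, so the spanner is first written as
  the union of its subspanners with a given domain (`regularSpanners_subset_closureUnder_join`).

For core spanners, every spanner in the closure under all five operations has the normal form
`π_F ς⁼_{Y₁} ⋯ ς⁼_{Yₙ} R` with `R` regular (`HasNormalForm`). To push the other operations through
the selections, these are kept on hidden variables, disjoint from `F`, on which the other operations
do not act: a selection on visible variables becomes one on hidden copies of them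
(`HasNormalForm.strEq`). As `R` belongs to both closures of the regex-formulas without selection, a
spanner in normal form belongs to both closures with it.
-/

namespace DocSpanner

/-! ### Regular languages -/

section RegularLanguages

variable {α : Type*}

/-- A language that belongs to a finite family closed under quotients by single letters is
regular. -/
theorem isRegular_of_mem_finite {L : Language α} {F : Set (Language α)} (hF : F.Finite)
    (hL : L ∈ F) (h : ∀ K ∈ F, ∀ a, K.leftQuotient [a] ∈ F) : L.IsRegular := by
  refine Language.IsRegular.of_finite_range_leftQuotient (hF.subset ?_)
  rintro _ ⟨u, rfl⟩
  induction u using List.reverseRecOn with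
  | nil => exact hL
  | append_singleton u a ih =>
    rw [Language.leftQuotient_append]
    exact h _ ih a

theorem leftQuotient_singleton_mem_range {L N : Language α} (hN : N ∈ Set.range L.leftQuotient)
    (a : α) : N.leftQuotient [a] ∈ Set.range L.leftQuotient := by
  obtain ⟨u, rfl⟩ := hN
  exact ⟨u ++ [a], Language.leftQuotient_append L u [a]⟩

theorem cons_mem_mul {L K : Language α} {a : α} {v : List α} :
    a :: v ∈ L * K ↔ v ∈ L.leftQuotient [a] * K ∨ [] ∈ L ∧ v ∈ K.leftQuotient [a] := by
  simp only [Language.mem_mul, Language.mem_leftQuotient]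
  constructor
  · rintro ⟨u, hu, v', hv', h⟩
    cases u with
    | nil =>
      obtain rfl : v' = a :: v := h
      exact Or.inr ⟨hu, hv'⟩
    | cons b u =>
      obtain ⟨rfl, rfl⟩ := List.cons.inj h
      exact Or.inl ⟨u, hu, v', hv', rfl⟩
  · rintro (⟨u, hu, v', hv', rfl⟩ | ⟨h, hv⟩)
    · exact ⟨a :: u, hu, v', hv', rfl⟩
    · exact ⟨[], h, a :: v, hv, rfl⟩

theorem cons_mem_kstar {L : Language α} {a : α} {v : List α} :
    a :: v ∈ KStar.kstar L ↔ v ∈ L.leftQuotient [a] * KStar.kstar L := by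
  constructor
  · rw [Language.mem_kstar]
    rintro ⟨us, h, hus⟩
    induction us with
    | nil => simp at h
    | cons u us ih =>
      cases u with
      | nil => exact ih (by simpa using h) fun y hy => hus y (List.mem_cons_of_mem _ hy)
      | cons b u =>
        obtain ⟨rfl, rfl⟩ := List.cons.inj h
        exact Language.append_mem_mul (hus (a :: u) List.mem_cons_self)
          (Language.join_mem_kstar fun y hy => hus y (List.mem_cons_of_mem _ hy))
  · intro h
    obtain ⟨u, hu, v', hv', rfl⟩ := Language.mem_mul.1 h
    rw [← Language.one_add_self_mul_kstar_eq_kstar, Language.mem_add]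
    exact Or.inr (Language.append_mem_mul (a := a :: u) hu hv')

/-- The quotients of `L * K` are the languages `P * K ∪ ⋃ T`, where `P` is a quotient of `L` and
`T` a set of quotients of `K`. -/
theorem isRegular_mul {L K : Language α} (hL : L.IsRegular) (hK : K.IsRegular) :
    (L * K).IsRegular := by
  let f : Language α → Set (Language α) → Language α := fun P T => P * K + sSup T
  have key : ∀ (T : Set (Language α)) v, v ∈ sSup T ↔ ∃ N ∈ T, v ∈ N := fun T v => by
    rw [sSup_eq_iSup', Language.mem_iSup]
    simp
  refine isRegular_of_mem_finite (F := Set.image2 f (Set.range L.leftQuotient)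
    (𝒫 (Set.range K.leftQuotient))) (hL.finite_range_leftQuotient.image2 _
    hK.finite_range_leftQuotient.finite_subsets) ⟨L, ⟨[], rfl⟩, ∅, by simp, ?_⟩ ?_
  · ext v
    simp [f, Language.mem_add, key, -sSup_empty]
  · rintro _ ⟨P, hP, T, hT, rfl⟩ a
    refine ⟨P.leftQuotient [a], leftQuotient_singleton_mem_range hP a,
      ({N | [] ∈ P ∧ N = K.leftQuotient [a]} ∪ (fun N => N.leftQuotient [a]) '' T), ?_, ?_⟩
    · rintro N (⟨-, rfl⟩ | ⟨N, hN, rfl⟩)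
      · exact ⟨[a], rfl⟩
      · exact leftQuotient_singleton_mem_range (hT hN) a
    · ext v
      simp only [f, Language.mem_add, Language.mem_leftQuotient, List.singleton_append,
        cons_mem_mul, key]
      constructor
      · rintro (h | ⟨N, ⟨h, rfl⟩ | ⟨N, hN, rfl⟩, hv⟩)
        · exact Or.inl (Or.inl h)
        · exact Or.inl (Or.inr ⟨h, hv⟩)
        · exact Or.inr ⟨N, hN, hv⟩
      · rintro ((h | ⟨h, hv⟩) | ⟨N, hN, hv⟩)
        · exact Or.inl h
        · exact Or.inr ⟨_, Or.inl ⟨h, rfl⟩, hv⟩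
        · exact Or.inr ⟨_, Or.inr ⟨N, hN, rfl⟩, hv⟩

/-- The quotients of `L∗` other than `L∗` itself are of the form `(⋃ T) * L∗`, where `T` is a set of
quotients of `L`. -/
theorem isRegular_kstar {L : Language α} (hL : L.IsRegular) : (KStar.kstar L).IsRegular := by
  let f : Set (Language α) → Language α := fun T => ⨆ N : T, (N : Language α) * KStar.kstar L
  have key : ∀ (T : Set (Language α)) v, v ∈ f T ↔ ∃ N ∈ T, v ∈ N * KStar.kstar L :=
    fun T v => by simp [f, Language.mem_iSup]
  refine isRegular_of_mem_finite (F := insert (KStar.kstar L)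
    (f '' 𝒫 (Set.range L.leftQuotient))) ((hL.finite_range_leftQuotient.finite_subsets.image
    f).insert _) (Set.mem_insert _ _) ?_
  rintro _ (rfl | ⟨T, hT, rfl⟩) a
  · refine Set.mem_insert_of_mem _ ⟨{L.leftQuotient [a]}, ?_, ?_⟩
    · rintro N rfl
      exact ⟨[a], rfl⟩
    · ext v
      rw [key, Language.mem_leftQuotient, List.singleton_append, cons_mem_kstar]
      simp
  · refine Set.mem_insert_of_mem _
      ⟨({N | (∃ P ∈ T, [] ∈ P) ∧ N = L.leftQuotient [a]} ∪ (fun N => N.leftQuotient [a]) '' T),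
        ?_, ?_⟩
    · rintro N (⟨-, rfl⟩ | ⟨N, hN, rfl⟩)
      · exact ⟨[a], rfl⟩
      · exact leftQuotient_singleton_mem_range (hT hN) a
    · ext v
      simp only [key, Language.mem_leftQuotient, List.singleton_append, cons_mem_mul,
        cons_mem_kstar]
      constructor
      · rintro ⟨N, ⟨⟨P, hP, h⟩, rfl⟩ | ⟨N, hN, rfl⟩, hv⟩
        · exact ⟨P, hP, Or.inr ⟨h, hv⟩⟩
        · exact ⟨N, hN, Or.inl hv⟩
      · rintro ⟨P, hP, hv | ⟨h, hv⟩⟩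
        · exact ⟨_, Or.inr ⟨P, hP, rfl⟩, hv⟩
        · exact ⟨_, Or.inl ⟨⟨P, hP, h⟩, rfl⟩, hv⟩

theorem isRegular_zero : (0 : Language α).IsRegular :=
  isRegular_of_mem_finite (Set.finite_singleton 0) rfl (by
    rintro _ rfl a
    ext v
    simp [Language.notMem_zero])

theorem isRegular_one : (1 : Language α).IsRegular :=
  isRegular_of_mem_finite (F := {1, 0}) (Set.toFinite _) (by simp) (by
    rintro _ (rfl | rfl) a <;> right <;> ext v <;>
      simp [Language.notMem_zero, Language.mem_one])

theorem isRegular_singleton (a : α) : ({[a]} : Language α).IsRegular := by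
  classical
  have hmem : ∀ v, v ∈ ({[a]} : Language α) ↔ v = [a] := fun v => Iff.rfl
  refine isRegular_of_mem_finite (F := {{[a]}, 1, 0}) (Set.toFinite _) (by simp) ?_
  rintro _ (rfl | rfl | rfl) b
  · by_cases h : b = a
    · subst h
      right; left
      ext v
      simp [hmem, Language.mem_one]
    · right; right
      ext v
      simp [hmem, Language.notMem_zero, h]
  · right; right
    ext v
    simp [Language.notMem_zero, Language.mem_one]
  · right; right
    ext v
    simp [Language.notMem_zero]

/-- A nondeterministic automaton with finitely many states accepts a regular language. -/
theorem isRegular_accepts_NFA {σ : Type*} [Finite σ] (M : NFA α σ) : M.accepts.IsRegular :=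
  Language.isRegular_iff.2 ⟨Set σ, Fintype.ofFinite _, M.toDFA, M.toDFA_correct⟩

/-- The words whose projection to the letters satisfying `p` belongs to `F`. -/
def filterLanguage (p : α → Bool) (F : Set (List α)) : Language α := {v | v.filter p ∈ F}

theorem mem_filterLanguage {p : α → Bool} {F : Set (List α)} {v : List α} :
    v ∈ filterLanguage p F ↔ v.filter p ∈ F := Iff.rfl

/-- The quotients of `filterLanguage p F` are of the form `filterLanguage p E`, where `E` consists
of suffixes of words from `F`. -/
theorem isRegular_filterLanguage (p : α → Bool) {F : Set (List α)} (hF : F.Finite) :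
    (filterLanguage p F).IsRegular := by
  let G : Set (List α) := ⋃ u ∈ F, {v | v ∈ u.tails}
  have hG : G.Finite := hF.biUnion fun u _ => List.finite_toSet _
  have hmem : ∀ v, v ∈ G ↔ ∃ u ∈ F, v <:+ u := by simp [G]
  refine isRegular_of_mem_finite (F := filterLanguage p '' 𝒫 G)
    (hG.finite_subsets.image _) ⟨F, fun u hu => (hmem u).2 ⟨u, hu, List.suffix_rfl⟩, rfl⟩ ?_
  rintro _ ⟨E, hE, rfl⟩ a
  by_cases h : p a
  · refine ⟨{v | a :: v ∈ E}, fun v hv => ?_, ?_⟩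
    · obtain ⟨u, hu, hv⟩ := (hmem _).1 (hE hv)
      exact (hmem v).2 ⟨u, hu, (List.suffix_cons a v).trans hv⟩
    · ext v
      simp [mem_filterLanguage, h]
  · refine ⟨E, hE, ?_⟩
    ext v
    simp [mem_filterLanguage, h]

end RegularLanguages

/-! ### Kleene's theorem for regex-formulas -/

section Kleene

variable {A V : Type*}

theorem isRegular_lang (γ : RegexFormula A V) : γ.lang.IsRegular := by
  induction γ with
  | empty => exact isRegular_zero
  | epsilon => exact isRegular_one
  | char a => exact isRegular_singleton _
  | alt γ₁ γ₂ h₁ h₂ => exact h₁.add h₂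
  | concat γ₁ γ₂ h₁ h₂ => exact isRegular_mul h₁ h₂
  | star γ h => exact isRegular_kstar h
  | capture x γ h =>
    exact isRegular_mul (isRegular_mul (isRegular_singleton _) h) (isRegular_singleton _)

/-- A finite alternation of regex-formulas. -/
theorem exists_lang_biUnion {ι : Type*} (s : Finset ι) (γ : ι → RegexFormula A V) :
    ∃ γ' : RegexFormula A V, ∀ u, u ∈ γ'.lang ↔ ∃ i ∈ s, u ∈ (γ i).lang := by
  classical
  induction s using Finset.induction_on with
  | empty => exact ⟨.empty, fun u => by simp [RegexFormula.lang, Language.notMem_zero]⟩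
  | insert i s _ ih =>
    obtain ⟨γ', h⟩ := ih
    exact ⟨.alt (γ i) γ', fun u => by simp [RegexFormula.lang, Language.mem_add, h]⟩

/-- The labels of the nonempty paths from `p` to `q` whose inner vertices belong to `K`, in a graph
whose edges are labelled by languages `E p q`. -/
inductive EdgePath {α σ : Type*} (E : σ → σ → Language α) (K : Set σ) :
    σ → σ → List α → Prop
  | edge {p q u} : u ∈ E p q → EdgePath E K p q u
  | cons {p r q u v} : u ∈ E p r → r ∈ K → EdgePath E K r q v → EdgePath E K p q (u ++ v)

namespace EdgePath

variable {α σ : Type*} {E : σ → σ → Language α} {K K' : Set σ} {p q r : σ} {u v : List α}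

theorem mono (hK : K ⊆ K') (h : EdgePath E K p q u) : EdgePath E K' p q u := by
  induction h with
  | edge h => exact .edge h
  | cons h hr _ ih => exact .cons h (hK hr) ih

theorem append (h₁ : EdgePath E K p r u) (hr : r ∈ K) (h₂ : EdgePath E K r q v) :
    EdgePath E K p q (u ++ v) := by
  induction h₁ with
  | edge h => exact .cons h hr h₂
  | cons h hs _ ih => rw [List.append_assoc]; exact .cons h hs (ih hr h₂)

/-- The language of the labels of the paths from `p` to `q` with inner vertices in `K`. -/
def lang (E : σ → σ → Language α) (K : Set σ) (p q : σ) : Language α := {u | EdgePath E K p q u}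

theorem mem_lang : u ∈ lang E K p q ↔ EdgePath E K p q u := Iff.rfl

theorem of_mem_kstar (hr : r ∈ K) (hu : u ∈ KStar.kstar (lang E K r r))
    (hv : EdgePath E K r q v) : EdgePath E K r q (u ++ v) := by
  rw [Language.mem_kstar] at hu
  obtain ⟨us, rfl, hus⟩ := hu
  induction us with
  | nil => exact hv
  | cons u us ih =>
    rw [List.flatten_cons, List.append_assoc]
    exact (hus u List.mem_cons_self).append hr
      (ih fun y hy => hus y (List.mem_cons_of_mem _ hy))

/-- A path either avoids the inner vertex `r`, or is cut at the visits of `r`. -/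
theorem lang_insert : lang E (insert r K) p q =
    lang E K p q + lang E K p r * KStar.kstar (lang E K r r) * lang E K r q := by
  ext u
  rw [Language.mem_add, mem_lang, mem_lang]
  constructor
  · intro h
    induction h with
    | edge h => exact Or.inl (.edge h)
    | @cons p s q u v h hs _ ih =>
      rcases hs with rfl | hs
      · right
        rcases ih with ih | ih
        · refine Language.append_mem_mul ?_ ih
          rw [← List.append_nil u]
          exact Language.append_mem_mul (EdgePath.edge h) (Language.nil_mem_kstar _)
        · rw [mul_assoc]
          refine Language.append_mem_mul (EdgePath.edge h) ?_
          have hle : lang E K s s * KStar.kstar (lang E K s s) ≤ KStar.kstar (lang E K s s) :=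
            mul_kstar_le_kstar
          obtain ⟨v₁, hv₁, v₂, hv₂, rfl⟩ := Language.mem_mul.1 ih
          exact Language.append_mem_mul (hle hv₁) hv₂
      · rcases ih with ih | ih
        · exact Or.inl (.cons h hs ih)
        · right
          rw [mul_assoc] at ih ⊢
          obtain ⟨v₁, hv₁, v₂, hv₂, rfl⟩ := Language.mem_mul.1 ih
          rw [← List.append_assoc]
          exact Language.append_mem_mul (EdgePath.cons h hs hv₁) hv₂
  · rintro (h | h)
    · exact h.mono (Set.subset_insert _ _)
    · obtain ⟨u, hu, v₂, hv₂, rfl⟩ := Language.mem_mul.1 h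
      obtain ⟨v₁, hv₁, u', hu', rfl⟩ := Language.mem_mul.1 hu
      have hle : lang E K r r ≤ lang E (insert r K) r r :=
        fun u hu => EdgePath.mono (Set.subset_insert _ _) hu
      rw [List.append_assoc]
      exact (EdgePath.mono (Set.subset_insert _ _) hv₁).append (Set.mem_insert _ _)
        (of_mem_kstar (Set.mem_insert _ _) (kstar_mono hle hu')
          (EdgePath.mono (Set.subset_insert _ _) hv₂))

theorem lang_empty : lang E ∅ p q = E p q := by
  ext u
  refine ⟨fun h => ?_, .edge⟩
  cases h with
  | edge h => exact h
  | cons _ h _ => exact h.elim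

end EdgePath

/-- Kleene's theorem for graphs whose edges are labelled by languages of regex-formulas. -/
theorem exists_lang_eq_edgePath {σ : Type*} [Finite σ]
    {E : σ → σ → Language (MarkedSym A V)} (hE : ∀ p q, ∃ γ : RegexFormula A V, γ.lang = E p q)
    (p q : σ) : ∃ γ : RegexFormula A V, γ.lang = EdgePath.lang E Set.univ p q := by
  have key : ∀ K : Set σ, K.Finite → ∀ p q, ∃ γ : RegexFormula A V,
      γ.lang = EdgePath.lang E K p q := by
    intro K hK
    induction K, hK using Set.Finite.induction_on with
    | empty => simpa only [EdgePath.lang_empty] using hE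
    | @insert r K _ _ ih =>
      intro p q
      obtain ⟨γ₁, h₁⟩ := ih p q
      obtain ⟨γ₂, h₂⟩ := ih p r
      obtain ⟨γ₃, h₃⟩ := ih r r
      obtain ⟨γ₄, h₄⟩ := ih r q
      exact ⟨.alt γ₁ (.concat (.concat γ₂ (.star γ₃)) γ₄), by
        simp only [RegexFormula.lang, h₁, h₂, h₃, h₄, EdgePath.lang_insert]⟩
  exact key _ Set.finite_univ p q

/-- The image of a regular language over a finite alphabet `Γ` under a substitution of words is
described by a regex-formula, if the words that are substituted for the letters of `Γ` are. -/
theorem exists_lang_eq_flatMap {α : Type*} {L : Language α} (hL : L.IsRegular) (Γ : Finset α)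
    (hΓ : ∀ v ∈ L, ∀ s ∈ v, s ∈ Γ) (h : α → List (MarkedSym A V))
    (hh : ∀ s ∈ Γ, ∃ γ : RegexFormula A V, ∀ u, u ∈ γ.lang ↔ u = h s) :
    ∃ γ : RegexFormula A V, ∀ u, u ∈ γ.lang ↔ ∃ v ∈ L, u = v.flatMap h := by
  classical
  obtain ⟨σ, _, M, rfl⟩ := hL
  have hlang : ∀ s, ∃ γ : RegexFormula A V, s ∈ Γ → ∀ u, u ∈ γ.lang ↔ u = h s := fun s =>
    if hs : s ∈ Γ then (hh s hs).imp fun γ hγ _ => hγ else ⟨.empty, fun h => (hs h).elim⟩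
  choose γ hγ using hlang
  let E : σ → σ → Language (MarkedSym A V) := fun p q => {u | ∃ s ∈ Γ, M.step p s = q ∧ u = h s}
  have hmem : ∀ p q u, u ∈ E p q ↔ ∃ s ∈ Γ, M.step p s = q ∧ u = h s := fun p q u => Iff.rfl
  have hE : ∀ p q, ∃ γ : RegexFormula A V, γ.lang = E p q := by
    intro p q
    obtain ⟨γ', h'⟩ := exists_lang_biUnion (Γ.filter fun s => M.step p s = q) γ
    refine ⟨γ', ?_⟩
    ext u
    rw [h', hmem]
    constructor
    · rintro ⟨s, hs, hu⟩
      rw [Finset.mem_filter] at hs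
      exact ⟨s, hs.1, hs.2, (hγ s hs.1 u).1 hu⟩
    · rintro ⟨s, hs, hq, hu⟩
      exact ⟨s, Finset.mem_filter.2 ⟨hs, hq⟩, (hγ s hs u).2 hu⟩
  have hpath : ∀ p q u, EdgePath E Set.univ p q u ↔
      ∃ v, v ≠ [] ∧ (∀ s ∈ v, s ∈ Γ) ∧ M.evalFrom p v = q ∧ u = v.flatMap h := by
    intro p q u
    constructor
    · intro hu
      induction hu with
      | edge hu =>
        obtain ⟨s, hs, rfl, rfl⟩ := hu
        exact ⟨[s], by simp, by simpa using hs, by simp, by simp⟩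
      | cons hu _ _ ih =>
        obtain ⟨s, hs, rfl, rfl⟩ := hu
        obtain ⟨v, -, hv, rfl, rfl⟩ := ih
        exact ⟨s :: v, by simp, by simpa using ⟨hs, hv⟩, by simp [DFA.evalFrom_cons], by simp⟩
    · rintro ⟨v, hne, hv, rfl, rfl⟩
      induction v generalizing p with
      | nil => exact (hne rfl).elim
      | cons s v ih =>
        have hs := hv s List.mem_cons_self
        by_cases hv0 : v = []
        · subst hv0
          exact .edge ⟨s, hs, by simp, by simp⟩
        · rw [List.flatMap_cons, DFA.evalFrom_cons]
          exact .cons ⟨s, hs, rfl, rfl⟩ trivial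
            (ih _ hv0 fun s hs => hv s (List.mem_cons_of_mem _ hs))
  choose ρ hρ using exists_lang_eq_edgePath hE M.start
  obtain ⟨γ₁, h₁⟩ := exists_lang_biUnion (Finset.univ.filter fun q => q ∈ M.accept) ρ
  obtain ⟨γ₀, h₀⟩ : ∃ γ : RegexFormula A V, ∀ u, u ∈ γ.lang ↔ M.start ∈ M.accept ∧ u = [] := by
    by_cases hM : M.start ∈ M.accept
    · exact ⟨.epsilon, by simp [RegexFormula.lang, Language.mem_one, hM]⟩
    · exact ⟨.empty, by simp [RegexFormula.lang, Language.notMem_zero, hM]⟩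
  refine ⟨.alt γ₀ γ₁, fun u => ?_⟩
  rw [RegexFormula.lang, Language.mem_add, h₀, h₁]
  constructor
  · rintro (⟨hM, rfl⟩ | ⟨q, hq, hu⟩)
    · exact ⟨[], hM, rfl⟩
    · rw [hρ, EdgePath.mem_lang, hpath] at hu
      obtain ⟨v, -, -, rfl, rfl⟩ := hu
      exact ⟨v, (Finset.mem_filter.1 hq).2, rfl⟩
  · rintro ⟨v, hv, rfl⟩
    by_cases hv0 : v = []
    · subst hv0
      exact Or.inl ⟨hv, rfl⟩
    · refine Or.inr ⟨M.evalFrom M.start v, Finset.mem_filter.2 ⟨Finset.mem_univ _, hv⟩, ?_⟩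
      rw [hρ, EdgePath.mem_lang, hpath]
      exact ⟨v, hv0, hΓ v hv, rfl, rfl⟩

/-- The language `Σ*` is described by a regex-formula, as the alphabet is finite. -/
theorem exists_lang_letters [Finite A] : ∃ γ : RegexFormula A V, ∀ u, u ∈ γ.lang ↔
    ∃ w : List A, u = w.map .letter := by
  have := Fintype.ofFinite A
  have hreg := isRegular_filterLanguage (fun _ : A => false) (F := {[]}) (Set.finite_singleton _)
  obtain ⟨γ, hγ⟩ := exists_lang_eq_flatMap (V := V) hreg Finset.univ
    (fun _ _ _ _ => Finset.mem_univ _)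
    (fun a => [.letter a]) fun a _ => ⟨.char a, fun u => Iff.rfl⟩
  refine ⟨γ, fun u => (hγ u).trans (exists_congr fun w => ?_)⟩
  have : w.flatMap (fun a => [(.letter a : MarkedSym A V)]) = w.map .letter := by
    induction w <;> simp [*]
  rw [this, mem_filterLanguage]
  simp

end Kleene

/-! ### Regular languages of marked words -/

section RegularSpanners

variable {A V : Type*}

/-- A regular language of marked words with finitely many variables is accepted by a
vset-automaton: the transitions of a finite automaton for it that read markers of other variables
can be deleted. -/
theorem exists_accepts_eq {L : Language (MarkedSym A V)} (hL : L.IsRegular) {X : Finset V}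
    (hX : VarsIn X L) : ∃ M : VSetAutomaton A V, M.aut.accepts = L := by
  obtain ⟨σ, _, D, rfl⟩ := hL
  let ok : MarkedSym A V → Prop := fun s => ∀ x, s = .opn x ∨ s = .cls x → x ∈ X
  let N : NFA (MarkedSym A V) σ :=
    { step := fun p s => {q | ok s ∧ q = D.step p s}, start := {D.start}, accept := D.accept }
  have hstep : ∀ p q s, q ∈ N.step p s ↔ ok s ∧ q = D.step p s := fun p q s => Iff.rfl
  refine ⟨⟨σ, inferInstance, N.toεNFA, X, ?_, ?_⟩, ?_⟩
  · intro p q x h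
    exact ((hstep p q _).1 h).1 x (Or.inl rfl)
  · intro p q x h
    exact ((hstep p q _).1 h).1 x (Or.inr rfl)
  · change N.toεNFA.accepts = _
    rw [NFA.toεNFA_correct]
    have key : ∀ v p, v ∈ N.acceptsFrom {p} ↔ (∀ s ∈ v, ok s) ∧ v ∈ D.acceptsFrom p := by
      intro v
      induction v with
      | nil => intro p; simp [NFA.nil_mem_acceptsFrom, DFA.mem_acceptsFrom, N]
      | cons s v ih =>
        intro p
        rw [NFA.cons_mem_acceptsFrom, NFA.stepSet_singleton]
        by_cases hs : ok s
        · have : N.step p s = {D.step p s} := by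
            ext q
            simp [hstep, hs]
          rw [this, ih]
          simp [hs, DFA.mem_acceptsFrom, DFA.evalFrom_cons]
        · have : N.step p s = ∅ := by
            ext q
            simp [hstep, hs]
          rw [this]
          have hempty : ∀ v, N.evalFrom ∅ v = ∅ := fun v => by
            induction v <;> simp_all [NFA.evalFrom_cons]
          simp [hs, NFA.mem_acceptsFrom, hempty]
    ext v
    refine (key v D.start).trans ⟨fun h => h.2, fun h => ⟨?_, h⟩⟩
    rintro s hs x (rfl | rfl)
    · exact hX v h x (Or.inl hs)
    · exact hX v h x (Or.inr hs)

theorem isRegular_accepts_VSetAutomaton (M : VSetAutomaton A V) : M.aut.accepts.IsRegular := by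
  have := M.finite_state
  rw [← εNFA.toNFA_correct]
  exact isRegular_accepts_NFA _

theorem mem_regularSpanners_iff [DecidableEq V] {S : Spanner A V} : S ∈ regularSpanners A V ↔
    ∃ (L : Language (MarkedSym A V)) (hL : ∃ X : Finset V, VarsIn X L), L.IsRegular ∧
      S = Spanner.ofLanguage L hL := by
  constructor
  · rintro ⟨M, rfl⟩
    exact ⟨M.aut.accepts, ⟨M.vars, M.varsIn_accepts⟩, isRegular_accepts_VSetAutomaton M, rfl⟩
  · rintro ⟨L, ⟨X, hX⟩, hL, rfl⟩
    obtain ⟨M, rfl⟩ := exists_accepts_eq hL hX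
    exact ⟨M, rfl⟩

theorem regexSpanners_subset_regularSpanners [DecidableEq V] :
    regexSpanners A V ⊆ regularSpanners A V := by
  rintro _ ⟨γ, rfl⟩
  exact mem_regularSpanners_iff.2 ⟨γ.lang, ⟨γ.vars, γ.varsIn_lang⟩, isRegular_lang γ, rfl⟩

end RegularSpanners

/-! ### Markers of marked words and of span-tuples, position by position -/

section Marks

variable {A V : Type*}

/-- The markers that a span-tuple puts at the position after `i` letters. -/
def tupleMarks (A : Type*) {V : Type*} (t : SpanTuple V) (i : ℕ) : Set (MarkedSym A V) :=
  {s | match s with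
    | .letter _ => False
    | .opn x => ∃ r, t x = some r ∧ r.left = i + 1
    | .cls x => ∃ r, t x = some r ∧ r.right = i + 1}

@[simp] theorem letter_mem_tupleMarks {t : SpanTuple V} {i : ℕ} {a : A} :
    .letter a ∈ tupleMarks A t i ↔ False := Iff.rfl

@[simp] theorem opn_mem_tupleMarks {t : SpanTuple V} {i : ℕ} {x : V} :
    .opn x ∈ tupleMarks A t i ↔ ∃ r, t x = some r ∧ r.left = i + 1 := Iff.rfl

@[simp] theorem cls_mem_tupleMarks {t : SpanTuple V} {i : ℕ} {x : V} :
    .cls x ∈ tupleMarks A t i ↔ ∃ r, t x = some r ∧ r.right = i + 1 := Iff.rfl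

/-- The markers of a marked word that occur after exactly `i` letters. -/
def marksAt : List (MarkedSym A V) → ℕ → Set (MarkedSym A V)
  | [], _ => ∅
  | .letter _ :: _, 0 => ∅
  | .letter _ :: v, i + 1 => marksAt v i
  | .opn x :: v, 0 => insert (.opn x) (marksAt v 0)
  | .opn _ :: v, i + 1 => marksAt v (i + 1)
  | .cls x :: v, 0 => insert (.cls x) (marksAt v 0)
  | .cls _ :: v, i + 1 => marksAt v (i + 1)

@[simp] theorem plainWord_nil : plainWord ([] : List (MarkedSym A V)) = [] := rfl

@[simp] theorem plainWord_letter (a : A) (v : List (MarkedSym A V)) :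
    plainWord (.letter a :: v) = a :: plainWord v := rfl

@[simp] theorem plainWord_opn (x : V) (v : List (MarkedSym A V)) :
    plainWord (.opn x :: v) = plainWord v := rfl

@[simp] theorem plainWord_cls (x : V) (v : List (MarkedSym A V)) :
    plainWord (.cls x :: v) = plainWord v := rfl

@[simp] theorem plainWord_append (u v : List (MarkedSym A V)) :
    plainWord (u ++ v) = plainWord u ++ plainWord v := List.filterMap_append

theorem mem_marksAt_iff {s : MarkedSym A V} (hs : s.letter? = none) {v : List (MarkedSym A V)}
    {i : ℕ} : s ∈ marksAt v i ↔ ∃ v₁ v₂, v = v₁ ++ s :: v₂ ∧ (plainWord v₁).length = i := by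
  have hcons : ∀ (r : MarkedSym A V) v (i : ℕ),
      (∃ v₁ v₂, r :: v = v₁ ++ s :: v₂ ∧ (plainWord v₁).length = i) ↔ (r = s ∧ i = 0) ∨
        ∃ v₁ v₂, v = v₁ ++ s :: v₂ ∧ (plainWord (r :: v₁)).length = i := by
    intro r v i
    constructor
    · rintro ⟨v₁, v₂, h, hi⟩
      cases v₁ with
      | nil =>
        obtain ⟨rfl, rfl⟩ := List.cons.inj h
        exact Or.inl ⟨rfl, hi.symm⟩
      | cons r' v₁ =>
        obtain ⟨rfl, rfl⟩ := List.cons.inj h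
        exact Or.inr ⟨v₁, v₂, rfl, hi⟩
    · rintro (⟨rfl, rfl⟩ | ⟨v₁, v₂, rfl, hi⟩)
      · exact ⟨[], v, rfl, rfl⟩
      · exact ⟨r :: v₁, v₂, rfl, hi⟩
  induction v generalizing i with
  | nil => simp [marksAt]
  | cons r v ih =>
    rw [hcons]
    cases r with
    | letter a =>
      have : MarkedSym.letter a ≠ s := by
        rintro rfl
        simp [MarkedSym.letter?] at hs
      cases i <;> simp [marksAt, this, ih]
    | opn x => cases i <;> simp [marksAt, ih, eq_comm]
    | cls x => cases i <;> simp [marksAt, ih, eq_comm]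

theorem opn_mem_marksAt_of_eq {x : V} {v v₁ v₂ v₃ : List (MarkedSym A V)}
    (h : v = v₁ ++ .opn x :: (v₂ ++ .cls x :: v₃)) : .opn x ∈ marksAt v (plainWord v₁).length :=
  (mem_marksAt_iff rfl).2 ⟨v₁, _, h, rfl⟩

theorem cls_mem_marksAt_of_eq {x : V} {v v₁ v₂ v₃ : List (MarkedSym A V)}
    (h : v = v₁ ++ .opn x :: (v₂ ++ .cls x :: v₃)) :
    .cls x ∈ marksAt v (plainWord (v₁ ++ v₂)).length :=
  (mem_marksAt_iff rfl).2 ⟨v₁ ++ .opn x :: v₂, v₃, by simpa using h, by simp⟩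

theorem letter_notMem_marksAt {a : A} {v : List (MarkedSym A V)} {i : ℕ} :
    .letter a ∉ marksAt v i := by
  induction v generalizing i with
  | nil => simp [marksAt]
  | cons r v ih => cases r <;> cases i <;> simp [marksAt, ih]

theorem mem_of_mem_marksAt {s : MarkedSym A V} {v : List (MarkedSym A V)} {i : ℕ}
    (h : s ∈ marksAt v i) : s ∈ v := by
  induction v generalizing i with
  | nil => simp [marksAt] at h
  | cons r v ih => cases r <;> cases i <;> simp [marksAt] at h <;> grind

theorem marksAt_letters_append (w : List A) (v : List (MarkedSym A V)) (i : ℕ) :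
    marksAt (w.map .letter ++ v) i = if i < w.length then ∅ else marksAt v (i - w.length) := by
  induction w generalizing i with
  | nil => simp
  | cons a w ih => cases i <;> simp [marksAt, ih]

theorem plainWord_map_letter (w : List A) :
    plainWord (w.map (.letter : A → MarkedSym A V)) = w := by
  induction w <;> simp [*]

/-- The value of a variable is determined by the positions of its markers. -/
theorem eq_of_forall_marks {t t' : SpanTuple V} {x x' : V}
    (h : ∀ i, (.opn x ∈ tupleMarks A t i ↔ .opn x' ∈ tupleMarks A t' i) ∧
      (.cls x ∈ tupleMarks A t i ↔ .cls x' ∈ tupleMarks A t' i)) : t x = t' x' := by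
  have key : ∀ {t t' : SpanTuple V} {x x' : V},
      (∀ i, (.opn x ∈ tupleMarks A t i ↔ .opn x' ∈ tupleMarks A t' i) ∧
      (.cls x ∈ tupleMarks A t i ↔ .cls x' ∈ tupleMarks A t' i)) →
      ∀ s, t x = some s → t' x' = some s := by
    intro t t' x x' h s hs
    have h₁ := s.one_le_left
    have h₂ := s.left_le_right
    obtain ⟨r, hr, hl⟩ := (h (s.left - 1)).1.1 ⟨s, hs, by omega⟩
    obtain ⟨r', hr', hl'⟩ := (h (s.right - 1)).2.1 ⟨s, hs, by omega⟩
    obtain rfl : r = r' := Option.some.inj (hr.symm.trans hr')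
    rw [hr]
    exact congrArg some (Span.ext (by omega) (by omega))
  exact Option.ext fun s => ⟨key h s, key (fun i => ⟨(h i).1.symm, (h i).2.symm⟩) s⟩

theorem tupleMarks_injective : Function.Injective (tupleMarks A (V := V)) :=
  fun _ _ h => funext fun _ => eq_of_forall_marks (A := A) fun i => by simp only [h, and_self]

end Marks

section SubwordMarked

variable {A V : Type*} [DecidableEq V]

@[simp] theorem isMarkerOf_letter (x : V) (a : A) :
    MarkedSym.isMarkerOf x (.letter a : MarkedSym A V) = false := rfl

@[simp] theorem isMarkerOf_opn (x y : V) :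
    MarkedSym.isMarkerOf x (.opn y : MarkedSym A V) = decide (y = x) := rfl

@[simp] theorem isMarkerOf_cls (x y : V) :
    MarkedSym.isMarkerOf x (.cls y : MarkedSym A V) = decide (y = x) := rfl

theorem IsSubwordMarked.eq_of_opn {v : List (MarkedSym A V)} (hv : IsSubwordMarked v) {x : V}
    {v₁ v₂ : List (MarkedSym A V)} (h : v = v₁ ++ .opn x :: v₂) :
    v₁.filter (MarkedSym.isMarkerOf x) = [] ∧ v₂.filter (MarkedSym.isMarkerOf x) = [.cls x] := by
  have := hv x
  rw [h] at this
  cases h₁ : v₁.filter (MarkedSym.isMarkerOf x) with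
  | nil => simpa [h₁] using this
  | cons s u =>
    cases u <;> simp [h₁] at this

theorem IsSubwordMarked.eq_of_cls {v : List (MarkedSym A V)} (hv : IsSubwordMarked v) {x : V}
    {v₁ v₂ : List (MarkedSym A V)} (h : v = v₁ ++ .cls x :: v₂) :
    v₁.filter (MarkedSym.isMarkerOf x) = [.opn x] ∧ v₂.filter (MarkedSym.isMarkerOf x) = [] := by
  have := hv x
  rw [h] at this
  cases h₁ : v₁.filter (MarkedSym.isMarkerOf x) with
  | nil => simp [h₁] at this
  | cons s u =>
    cases u with
    | nil => simpa [h₁] using this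
    | cons s' u => simp [h₁] at this

theorem IsSubwordMarked.exists_of_opn_mem {v : List (MarkedSym A V)} (hv : IsSubwordMarked v)
    {x : V} {i : ℕ} (h : .opn x ∈ marksAt v i) :
    ∃ v₁ v₂ v₃, v = v₁ ++ .opn x :: (v₂ ++ .cls x :: v₃) ∧ (plainWord v₁).length = i := by
  obtain ⟨v₁, v₂, rfl, hi⟩ := (mem_marksAt_iff rfl).1 h
  have h₂ := (hv.eq_of_opn rfl).2
  have : .cls x ∈ v₂ := List.mem_of_mem_filter (h₂ ▸ List.mem_singleton_self _)
  obtain ⟨v₂, v₃, rfl⟩ := List.append_of_mem this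
  exact ⟨v₁, v₂, v₃, rfl, hi⟩

theorem IsSubwordMarked.exists_of_cls_mem {v : List (MarkedSym A V)} (hv : IsSubwordMarked v)
    {x : V} {i : ℕ} (h : .cls x ∈ marksAt v i) :
    ∃ v₁ v₂ v₃, v = v₁ ++ .opn x :: (v₂ ++ .cls x :: v₃) ∧ (plainWord (v₁ ++ v₂)).length = i := by
  obtain ⟨v₁, v₃, rfl, hi⟩ := (mem_marksAt_iff rfl).1 h
  have h₁ := (hv.eq_of_cls rfl).1
  have : .opn x ∈ v₁ := List.mem_of_mem_filter (h₁ ▸ List.mem_singleton_self _)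
  obtain ⟨v₁, v₂, rfl⟩ := List.append_of_mem this
  exact ⟨v₁, v₂, v₃, by simp, by simpa using hi⟩

/-- The span-tuple of a subword-marked word is determined by where the markers are; the order of
the markers between two consecutive letters is irrelevant. -/
theorem IsSubwordMarked.isSpanTupleOf_iff {v : List (MarkedSym A V)} (hv : IsSubwordMarked v)
    {t : SpanTuple V} : IsSpanTupleOf v t ↔ marksAt v = tupleMarks A t := by
  constructor
  · intro h
    funext i
    ext s
    cases s with
    | letter a => simp [letter_notMem_marksAt]
    | opn x =>
      rw [opn_mem_tupleMarks]
      constructor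
      · intro hx
        obtain ⟨v₁, v₂, v₃, rfl, rfl⟩ := hv.exists_of_opn_mem hx
        exact ⟨⟨(plainWord v₁).length + 1, (plainWord (v₁ ++ v₂)).length + 1, by simp, by simp⟩,
          (h x _).2 ⟨v₁, v₂, v₃, rfl, rfl, rfl⟩, rfl⟩
      · rintro ⟨r, hr, hi⟩
        obtain ⟨v₁, v₂, v₃, hv, hl, -⟩ := (h x r).1 hr
        obtain rfl : (plainWord v₁).length = i := by omega
        exact opn_mem_marksAt_of_eq hv
    | cls x =>
      rw [cls_mem_tupleMarks]
      constructor
      · intro hx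
        obtain ⟨v₁, v₂, v₃, rfl, rfl⟩ := hv.exists_of_cls_mem hx
        exact ⟨⟨(plainWord v₁).length + 1, (plainWord (v₁ ++ v₂)).length + 1, by simp, by simp⟩,
          (h x _).2 ⟨v₁, v₂, v₃, rfl, rfl, rfl⟩, rfl⟩
      · rintro ⟨r, hr, hi⟩
        obtain ⟨v₁, v₂, v₃, hv, -, hl⟩ := (h x r).1 hr
        obtain rfl : (plainWord (v₁ ++ v₂)).length = i := by omega
        exact cls_mem_marksAt_of_eq hv
  · intro h x s
    constructor
    · intro hs
      have h₁ : .opn x ∈ marksAt v (s.left - 1) := by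
        rw [h]
        exact ⟨s, hs, (Nat.sub_add_cancel s.one_le_left).symm⟩
      obtain ⟨v₁, v₂, v₃, hv', hl⟩ := hv.exists_of_opn_mem h₁
      have h₂ := cls_mem_marksAt_of_eq hv'
      rw [h] at h₂
      obtain ⟨r, hr, hr'⟩ := h₂
      obtain rfl : r = s := Option.some.inj (hr.symm.trans hs)
      exact ⟨v₁, v₂, v₃, hv', by have := r.one_le_left; omega, hr'⟩
    · rintro ⟨v₁, v₂, v₃, hv', hl, hr⟩
      have h₁ := opn_mem_marksAt_of_eq hv'
      have h₂ := cls_mem_marksAt_of_eq hv'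
      rw [h] at h₁ h₂
      obtain ⟨r, hr₁, hr₂⟩ := h₁
      obtain ⟨r', hr₁', hr₂'⟩ := h₂
      obtain rfl : r = r' := Option.some.inj (hr₁.symm.trans hr₁')
      rw [hr₁]
      exact congrArg some (Span.ext (hr₂.trans hl.symm) (hr₂'.trans hr.symm))

/-- Every subword-marked word describes a span-tuple: a marker occurs at most once, so the
factorization of the word around the markers of a variable is unique. -/
theorem IsSubwordMarked.exists_isSpanTupleOf {v : List (MarkedSym A V)}
    (hv : IsSubwordMarked v) : ∃ t, IsSpanTupleOf v t := by
  classical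
  let P : V → Span → Prop := fun x s => ∃ v₁ v₂ v₃ : List (MarkedSym A V),
    v = v₁ ++ .opn x :: (v₂ ++ .cls x :: v₃) ∧
    s.left = (plainWord v₁).length + 1 ∧ s.right = (plainWord (v₁ ++ v₂)).length + 1
  have huniq : ∀ x s s', P x s → P x s' → s = s' := by
    rintro x s s' ⟨v₁, v₂, v₃, h, hl, hr⟩ ⟨v₁', v₂', v₃', h', hl', hr'⟩
    have hno : ∀ {u u' : List (MarkedSym A V)} {r}, MarkedSym.isMarkerOf x r = true →
        u.filter (MarkedSym.isMarkerOf x) = u' → r ∉ u' → r ∉ u := fun hr hu hmem h =>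
      hmem (hu ▸ List.mem_filter.2 ⟨h, hr⟩)
    have hx₁ : MarkedSym.isMarkerOf x (.opn x : MarkedSym A V) = true := by simp
    have hx₂ : MarkedSym.isMarkerOf x (.cls x : MarkedSym A V) = true := by simp
    obtain ⟨e₁, e₂⟩ := hv.eq_of_opn h
    have e₃ : v₂.filter (MarkedSym.isMarkerOf x) = [] ∧
        v₃.filter (MarkedSym.isMarkerOf x) = [] := by
      rw [List.filter_append, List.filter_cons_of_pos hx₂] at e₂
      cases h : v₂.filter (MarkedSym.isMarkerOf x) with
      | nil => simpa [h] using e₂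
      | cons r u => simp [h] at e₂
    obtain ⟨rfl, -, h₂⟩ := (List.append_cons_inj_of_notMem (hno hx₁ e₁ (by simp))
      (hno hx₁ e₂ (by simp))).1 (h.symm.trans h')
    obtain ⟨rfl, -, -⟩ := (List.append_cons_inj_of_notMem (hno hx₂ e₃.1 (by simp))
      (hno hx₂ e₃.2 (by simp))).1 h₂
    exact Span.ext (hl.trans hl'.symm) (hr.trans hr'.symm)
  refine ⟨fun x => if h : ∃ s, P x s then some h.choose else none, fun x s => ?_⟩
  change _ ↔ P x s
  by_cases h : ∃ s, P x s
  · simp only [h, dite_true, Option.some.injEq]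
    exact ⟨fun hs => hs ▸ h.choose_spec, fun hs => huniq x _ _ h.choose_spec hs⟩
  · simp only [h, dite_false, reduceCtorEq, false_iff]
    exact fun hs => h ⟨s, hs⟩

end SubwordMarked

/-! ### Decomposition of marked words into blocks of markers -/

section Blocks

variable {A V : Type*}

theorem marksAt_markers_append {u : List (MarkedSym A V)} (hu : ∀ s ∈ u, s.letter? = none)
    (v : List (MarkedSym A V)) : marksAt (u ++ v) 0 = {s | s ∈ u} ∪ marksAt v 0 ∧
      ∀ i, marksAt (u ++ v) (i + 1) = marksAt v (i + 1) := by
  induction u with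
  | nil => simp
  | cons s u ih =>
    have ih := ih fun s hs => hu s (List.mem_cons_of_mem _ hs)
    cases s with
    | letter a => simpa [MarkedSym.letter?] using hu (.letter a) List.mem_cons_self
    | opn x =>
      refine ⟨?_, fun i => by simpa [marksAt] using ih.2 i⟩
      ext s
      simp [marksAt, ih.1, or_assoc]
    | cls x =>
      refine ⟨?_, fun i => by simpa [marksAt] using ih.2 i⟩
      ext s
      simp [marksAt, ih.1, or_assoc]

/-- All spans of `t` are spans of `w`. -/
def Fits (w : List A) (t : SpanTuple V) : Prop :=
  ∀ x s, t x = some s → s.right ≤ w.length + 1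

/-- A tuple of spans of `w` puts no marker behind the end of `w`. -/
theorem tupleMarks_eq_of_fits {w : List A} {t : SpanTuple V} (ht : Fits w t) (i : ℕ) :
    tupleMarks A t i = {s | i ≤ w.length ∧ s ∈ tupleMarks A t i ∧ s.letter? = none} := by
  ext s
  cases s with
  | letter a => simp
  | opn x =>
    simp only [opn_mem_tupleMarks, Set.mem_ofPred_eq, MarkedSym.letter?, and_true]
    constructor
    · rintro ⟨r, hr, hi⟩
      have := r.left_le_right
      have := ht x r hr
      exact ⟨by omega, r, hr, hi⟩
    · exact fun h => h.2
  | cls x =>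
    simp only [cls_mem_tupleMarks, Set.mem_ofPred_eq, MarkedSym.letter?, and_true]
    constructor
    · rintro ⟨r, hr, hi⟩
      have := ht x r hr
      exact ⟨by omega, r, hr, hi⟩
    · exact fun h => h.2

variable [DecidableEq V]

open Classical in
/-- `u` is a word of markers that consists of the markers in `m`, each once, with opening markers
before the closing markers of the same variable. -/
def IsBlock (m : Set (MarkedSym A V)) (u : List (MarkedSym A V)) : Prop :=
  (∀ s ∈ u, s.letter? = none) ∧ ∀ x, u.filter (MarkedSym.isMarkerOf x) =
    (if .opn x ∈ m then [.opn x] else []) ++ (if .cls x ∈ m then [.cls x] else [])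

/-- `Reads μ w v`: the marked word `v` is obtained from `w` by inserting, after `i` letters, a block
of the markers in `μ i`. Only the sets `μ i` with `i ≤ |w|` matter. -/
def Reads (μ : ℕ → Set (MarkedSym A V)) : List A → List (MarkedSym A V) → Prop
  | [], v => IsBlock (μ 0) v
  | a :: w, v => ∃ u v', IsBlock (μ 0) u ∧ v = u ++ .letter a :: v' ∧
      Reads (fun i => μ (i + 1)) w v'

theorem IsBlock.opn_mem {m : Set (MarkedSym A V)} {u : List (MarkedSym A V)} (h : IsBlock m u)
    {x : V} : .opn x ∈ u ↔ .opn x ∈ m := by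
  have : .opn x ∈ u ↔ .opn x ∈ u.filter (MarkedSym.isMarkerOf x) := by simp
  rw [this, h.2 x]
  by_cases h₁ : MarkedSym.opn x ∈ m <;> by_cases h₂ : MarkedSym.cls x ∈ m <;> simp [h₁, h₂]

theorem IsBlock.cls_mem {m : Set (MarkedSym A V)} {u : List (MarkedSym A V)} (h : IsBlock m u)
    {x : V} : .cls x ∈ u ↔ .cls x ∈ m := by
  have : .cls x ∈ u ↔ .cls x ∈ u.filter (MarkedSym.isMarkerOf x) := by simp
  rw [this, h.2 x]
  by_cases h₁ : MarkedSym.opn x ∈ m <;> by_cases h₂ : MarkedSym.cls x ∈ m <;> simp [h₁, h₂]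

theorem IsBlock.plainWord_eq {m : Set (MarkedSym A V)} {u : List (MarkedSym A V)}
    (h : IsBlock m u) : plainWord u = [] :=
  List.filterMap_eq_nil_iff.2 h.1

theorem isBlock_iff_mem {m : Set (MarkedSym A V)} {u : List (MarkedSym A V)} (h : IsBlock m u)
    {s : MarkedSym A V} : s ∈ u ↔ s ∈ m ∧ s.letter? = none := by
  constructor
  · intro hs
    have := h.1 s hs
    cases s with
    | letter a => simp [MarkedSym.letter?] at this
    | opn x => exact ⟨h.opn_mem.1 hs, rfl⟩
    | cls x => exact ⟨h.cls_mem.1 hs, rfl⟩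
  · rintro ⟨hs, h'⟩
    cases s with
    | letter a => simp [MarkedSym.letter?] at h'
    | opn x => exact h.opn_mem.2 hs
    | cls x => exact h.cls_mem.2 hs

theorem Reads.marksAt_eq {w : List A} {μ : ℕ → Set (MarkedSym A V)} {v : List (MarkedSym A V)}
    (h : Reads μ w v) : plainWord v = w ∧
      ∀ i, marksAt v i = {s | i ≤ w.length ∧ s ∈ μ i ∧ s.letter? = none} := by
  induction w generalizing μ v with
  | nil =>
    refine ⟨IsBlock.plainWord_eq h, fun i => ?_⟩
    have := marksAt_markers_append h.1 []
    rw [List.append_nil] at this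
    ext s
    cases i with
    | zero => simp [this.1, marksAt, isBlock_iff_mem h]
    | succ i => simp [this.2, marksAt]
  | cons a w ih =>
    obtain ⟨u, v', hu, rfl, hv'⟩ := h
    obtain ⟨ih₁, ih₂⟩ := ih hv'
    refine ⟨by simp [hu.plainWord_eq, ih₁], fun i => ?_⟩
    have := marksAt_markers_append hu.1 (.letter a :: v')
    ext s
    cases i with
    | zero => simp [this.1, marksAt, isBlock_iff_mem hu]
    | succ i => simp [this.2, marksAt, ih₂]

section Filter

variable {w : List A} {μ : ℕ → Set (MarkedSym A V)} {v : List (MarkedSym A V)} {x : V}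

theorem Reads.filter_eq_nil (h : Reads μ w v) (h₁ : ∀ i ≤ w.length, .opn x ∉ μ i)
    (h₂ : ∀ i ≤ w.length, .cls x ∉ μ i) : v.filter (MarkedSym.isMarkerOf x) = [] := by
  induction w generalizing μ v with
  | nil =>
    rw [h.2 x]
    simp [h₁ 0, h₂ 0]
  | cons a w ih =>
    obtain ⟨u, v', hu, rfl, hv'⟩ := h
    rw [List.filter_append, hu.2 x, List.filter_cons_of_neg (by simp),
      ih hv' (fun i hi => h₁ (i + 1) (by simpa using hi))
        (fun i hi => h₂ (i + 1) (by simpa using hi))]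
    simp [h₁ 0, h₂ 0]

theorem Reads.filter_eq_cls (h : Reads μ w v) {j : ℕ} (hj : j ≤ w.length)
    (h₁ : ∀ i ≤ w.length, .opn x ∉ μ i) (h₂ : ∀ i ≤ w.length, .cls x ∈ μ i ↔ i = j) :
    v.filter (MarkedSym.isMarkerOf x) = [.cls x] := by
  induction w generalizing μ v j with
  | nil =>
    obtain rfl : j = 0 := by simpa using hj
    rw [h.2 x]
    simp [h₁ 0, h₂ 0]
  | cons a w ih =>
    obtain ⟨u, v', hu, rfl, hv'⟩ := h
    rw [List.filter_append, hu.2 x, List.filter_cons_of_neg (by simp)]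
    have h₁' : ∀ i ≤ w.length, .opn x ∉ μ (i + 1) := fun i hi => h₁ (i + 1) (by simpa using hi)
    have h₂' : ∀ i ≤ w.length, .cls x ∈ μ (i + 1) ↔ i + 1 = j :=
      fun i hi => h₂ (i + 1) (by simpa using hi)
    cases j with
    | zero =>
      rw [hv'.filter_eq_nil h₁' fun i hi => by simp [h₂' i hi]]
      simp [h₁ 0, h₂ 0]
    | succ j =>
      rw [ih hv' (by simpa using hj) h₁' fun i hi => by simp [h₂' i hi]]
      simp [h₁ 0, h₂ 0]

theorem Reads.filter_eq_pair (h : Reads μ w v) {k j : ℕ} (hk : k ≤ j) (hj : j ≤ w.length)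
    (h₁ : ∀ i ≤ w.length, .opn x ∈ μ i ↔ i = k) (h₂ : ∀ i ≤ w.length, .cls x ∈ μ i ↔ i = j) :
    v.filter (MarkedSym.isMarkerOf x) = [.opn x, .cls x] := by
  induction w generalizing μ v j k with
  | nil =>
    obtain rfl : j = 0 := by simpa using hj
    obtain rfl : k = 0 := by simpa using hk
    rw [h.2 x]
    simp [h₁ 0, h₂ 0]
  | cons a w ih =>
    obtain ⟨u, v', hu, rfl, hv'⟩ := h
    rw [List.filter_append, hu.2 x, List.filter_cons_of_neg (by simp)]
    have h₁' : ∀ i ≤ w.length, .opn x ∈ μ (i + 1) ↔ i + 1 = k :=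
      fun i hi => h₁ (i + 1) (by simpa using hi)
    have h₂' : ∀ i ≤ w.length, .cls x ∈ μ (i + 1) ↔ i + 1 = j :=
      fun i hi => h₂ (i + 1) (by simpa using hi)
    cases j with
    | zero =>
      obtain rfl : k = 0 := by simpa using hk
      rw [hv'.filter_eq_nil (fun i hi => by simp [h₁' i hi]) fun i hi => by simp [h₂' i hi]]
      simp [h₁ 0, h₂ 0]
    | succ j =>
      cases k with
      | zero =>
        rw [hv'.filter_eq_cls (j := j) (by simpa using hj) (fun i hi => by simp [h₁' i hi])
          fun i hi => by simp [h₂' i hi]]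
        simp [h₁ 0, h₂ 0]
      | succ k =>
        rw [ih hv' (j := j) (k := k) (by simpa using hk) (by simpa using hj)
          (fun i hi => by simp [h₁' i hi]) fun i hi => by simp [h₂' i hi]]
        simp [h₁ 0, h₂ 0]

end Filter

theorem Reads.isSubwordMarked {w : List A} {t : SpanTuple V} {v : List (MarkedSym A V)}
    (ht : Fits w t) (h : Reads (tupleMarks A t) w v) : IsSubwordMarked v := by
  intro x
  cases hx : t x with
  | none =>
    left
    exact h.filter_eq_nil (by simp [hx]) (by simp [hx])
  | some s =>
    right
    have h₁ := s.one_le_left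
    have h₂ := s.left_le_right
    have h₃ := ht x s hx
    refine h.filter_eq_pair (k := s.left - 1) (j := s.right - 1) (by omega) (by omega) ?_ ?_
    · intro i _
      simp only [opn_mem_tupleMarks, hx, Option.some.injEq, exists_eq_left']
      omega
    · intro i _
      simp only [cls_mem_tupleMarks, hx, Option.some.injEq, exists_eq_left']
      omega

theorem IsBlock.empty : IsBlock (∅ : Set (MarkedSym A V)) [] := by simp [IsBlock]

theorem IsBlock.cons_opn {m : Set (MarkedSym A V)} {u : List (MarkedSym A V)} {x : V}
    (h : IsBlock m u) (hx : .opn x ∉ m) : IsBlock (insert (.opn x) m) (.opn x :: u) := by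
  refine ⟨by simpa [MarkedSym.letter?] using h.1, fun y => ?_⟩
  have := h.2 y
  by_cases hy : x = y
  · subst hy
    by_cases h' : MarkedSym.cls x ∈ m <;> simp_all
  · by_cases h₁ : MarkedSym.opn y ∈ m <;> by_cases h₂ : MarkedSym.cls y ∈ m <;>
      simp_all [Ne.symm hy]

theorem IsBlock.cons_cls {m : Set (MarkedSym A V)} {u : List (MarkedSym A V)} {x : V}
    (h : IsBlock m u) (hx : .opn x ∉ m) (hx' : .cls x ∉ m) :
    IsBlock (insert (.cls x) m) (.cls x :: u) := by
  refine ⟨by simpa [MarkedSym.letter?] using h.1, fun y => ?_⟩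
  have := h.2 y
  by_cases hy : x = y
  · subst hy
    simp_all
  · by_cases h₁ : MarkedSym.opn y ∈ m <;> by_cases h₂ : MarkedSym.cls y ∈ m <;>
      simp_all [Ne.symm hy]

theorem Reads.cons {w : List A} {μ μ' : ℕ → Set (MarkedSym A V)} {v : List (MarkedSym A V)}
    {s : MarkedSym A V} (h : Reads μ w v) (h₀ : ∀ u, IsBlock (μ 0) u → IsBlock (μ' 0) (s :: u))
    (h₁ : ∀ i, μ' (i + 1) = μ (i + 1)) : Reads μ' w (s :: v) := by
  cases w with
  | nil => exact h₀ v h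
  | cons a w =>
    obtain ⟨u, v', hu, rfl, hv'⟩ := h
    refine ⟨s :: u, v', h₀ u hu, rfl, ?_⟩
    simpa only [h₁] using hv'

/-- The hypothesis allows suffixes of `⊢x ⊣x`, that is, words from which an opening marker has been
cut off, because only such a property is inherited by the suffixes of a marked word. -/
theorem reads_marksAt {v : List (MarkedSym A V)}
    (hv : ∀ x, v.filter (MarkedSym.isMarkerOf x) <:+ [.opn x, .cls x]) :
    Reads (marksAt v) (plainWord v) v := by
  induction v with
  | nil => exact IsBlock.empty
  | cons s v ih =>
    have hv' : ∀ x, v.filter (MarkedSym.isMarkerOf x) <:+ [.opn x, .cls x] := fun x => by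
      refine List.IsSuffix.trans ?_ (hv x)
      cases h : MarkedSym.isMarkerOf x s <;> simp [h]
    have ih := ih hv'
    cases s with
    | letter a => exact ⟨[], v, IsBlock.empty, rfl, ih⟩
    | opn x =>
      refine ih.cons (fun u hu => hu.cons_opn fun hx => ?_) fun i => rfl
      have hx : .opn x ∈ v.filter (MarkedSym.isMarkerOf x) :=
        List.mem_filter.2 ⟨mem_of_mem_marksAt hx, by simp⟩
      have h := hv x
      simp only [isMarkerOf_opn, decide_true, List.filter_cons_of_pos] at h
      simp only [List.suffix_cons_iff, List.suffix_nil, List.cons.injEq, reduceCtorEq, false_and,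
        or_false, true_and] at h
      simp [h] at hx
    | cls x =>
      have h := hv x
      simp only [isMarkerOf_cls, decide_true, List.filter_cons_of_pos] at h
      simp only [List.suffix_cons_iff, List.suffix_nil] at h
      have h : v.filter (MarkedSym.isMarkerOf x) = [] := by aesop
      have hno : ∀ s, MarkedSym.isMarkerOf x s = true → s ∉ marksAt v 0 := fun s hs hm => by
        have : s ∈ v.filter (MarkedSym.isMarkerOf x) :=
          List.mem_filter.2 ⟨mem_of_mem_marksAt hm, hs⟩
        simp [h] at this
      exact ih.cons (fun u hu => hu.cons_cls (hno _ (by simp)) (hno _ (by simp))) fun i => rfl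

theorem IsSubwordMarked.reads {v : List (MarkedSym A V)} (hv : IsSubwordMarked v) :
    Reads (marksAt v) (plainWord v) v :=
  reads_marksAt fun x => by rcases hv x with h | h <;> simp [h]

/-- The marked words that insert the markers of `t` into `w` are exactly the subword-marked words
that describe `w` and `t`. -/
theorem reads_tupleMarks_iff {w : List A} {t : SpanTuple V} (ht : Fits w t)
    {v : List (MarkedSym A V)} : Reads (tupleMarks A t) w v ↔
      IsSubwordMarked v ∧ plainWord v = w ∧ IsSpanTupleOf v t := by
  constructor
  · intro h
    have hv := h.isSubwordMarked ht
    refine ⟨hv, h.marksAt_eq.1, hv.isSpanTupleOf_iff.2 ?_⟩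
    funext i
    rw [h.marksAt_eq.2, ← tupleMarks_eq_of_fits ht]
  · rintro ⟨hv, rfl, h⟩
    rw [← hv.isSpanTupleOf_iff.1 h]
    exact hv.reads

theorem exists_isBlock {X : Finset V} {m : Set (MarkedSym A V)}
    (hm : ∀ x, .opn x ∈ m ∨ .cls x ∈ m → x ∈ X) : ∃ u, IsBlock m u := by
  classical
  let g : V → List (MarkedSym A V) := fun x =>
    (if .opn x ∈ m then [.opn x] else []) ++ (if .cls x ∈ m then [.cls x] else [])
  have hg : ∀ x y, (g x).filter (MarkedSym.isMarkerOf y) = if x = y then g x else [] := by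
    intro x y
    by_cases hy : x = y <;> by_cases h₁ : MarkedSym.opn x ∈ m <;>
      by_cases h₂ : MarkedSym.cls x ∈ m <;> simp [g, hy, h₁, h₂] <;> simp_all
  have key : ∀ l : List V, l.Nodup → ∀ y, (l.flatMap g).filter (MarkedSym.isMarkerOf y) =
      if y ∈ l then g y else [] := by
    intro l hl y
    induction l with
    | nil => rfl
    | cons x l ih =>
      rw [List.flatMap_cons, List.filter_append, hg, ih hl.of_cons]
      have := (List.nodup_cons.1 hl).1
      by_cases hy : x = y
      · subst hy
        simp [this]
      · simp [hy, Ne.symm hy]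
  refine ⟨X.toList.flatMap g, ?_, fun y => ?_⟩
  · intro s hs
    obtain ⟨x, -, hx⟩ := List.mem_flatMap.1 hs
    by_cases h₁ : MarkedSym.opn x ∈ m <;> by_cases h₂ : MarkedSym.cls x ∈ m <;>
      simp [g, h₁, h₂] at hx <;> aesop
  · rw [key _ X.nodup_toList]
    simp only [Finset.mem_toList]
    split_ifs with hy h₁ h₂ h₂ <;> simp_all [g]

theorem exists_reads {X : Finset V} {μ : ℕ → Set (MarkedSym A V)}
    (hμ : ∀ i x, .opn x ∈ μ i ∨ .cls x ∈ μ i → x ∈ X) (w : List A) : ∃ v, Reads μ w v := by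
  induction w generalizing μ with
  | nil => exact exists_isBlock (hμ 0)
  | cons a w ih =>
    obtain ⟨u, hu⟩ := exists_isBlock (hμ 0)
    obtain ⟨v, hv⟩ := ih fun i => hμ (i + 1)
    exact ⟨_, u, v, hu, rfl, hv⟩

end Blocks

/-! ### Recognizable properties of annotated words -/

section Recog

variable {A B C Q : Type*}

/-- The nondeterministic automaton with initial states `I`, transitions `δ` and final condition `F`
accepts the word `w` whose `i`-th gap (`0 ≤ i ≤ |w|`) is annotated by `μ i`. A transition reads the
annotation of a gap together with the letter behind it; the annotation of the last gap is read by
the final condition. -/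
def Accepts (I : Set Q) (δ : Q → B → A → Q → Prop) (F : Q → B → Prop) (w : List A) (μ : ℕ → B) :
    Prop :=
  ∃ q : ℕ → Q, q 0 ∈ I ∧ (∀ i a, w[i]? = some a → δ (q i) (μ i) a (q (i + 1))) ∧
    F (q w.length) (μ w.length)

/-- A property of annotated words is recognizable if it is decided by an automaton with finitely
many states. The set `B` of annotations may be infinite. -/
def Recog (P : List A → (ℕ → B) → Prop) : Prop :=
  ∃ (Q : Type) (_ : Finite Q) (I : Set Q) (δ : Q → B → A → Q → Prop) (F : Q → B → Prop),
    ∀ w μ, P w μ ↔ Accepts I δ F w μ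

theorem accepts_nil {q : Q} {δ : Q → B → A → Q → Prop} {F : Q → B → Prop} {μ : ℕ → B} :
    Accepts {q} δ F [] μ ↔ F q (μ 0) := by
  constructor
  · rintro ⟨r, rfl, -, h⟩
    exact h
  · exact fun h => ⟨fun _ => q, rfl, by simp, h⟩

theorem accepts_cons {q : Q} {δ : Q → B → A → Q → Prop} {F : Q → B → Prop} {a : A} {w : List A}
    {μ : ℕ → B} : Accepts {q} δ F (a :: w) μ ↔
      ∃ q', δ q (μ 0) a q' ∧ Accepts {q'} δ F w (fun i => μ (i + 1)) := by
  constructor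
  · rintro ⟨r, rfl, hδ, h⟩
    exact ⟨r 1, hδ 0 a (by simp), fun i => r (i + 1), rfl,
      fun i b hb => hδ (i + 1) b (by simpa using hb), h⟩
  · rintro ⟨q', h₀, r, rfl, hδ, h⟩
    refine ⟨fun i => i.casesOn q r, Set.mem_singleton _, fun i b hb => ?_, h⟩
    cases i with
    | zero =>
      obtain rfl : a = b := by simpa using hb
      exact h₀
    | succ i => exact hδ i b (by simpa using hb)

theorem accepts_iff_exists_singleton {I : Set Q} {δ : Q → B → A → Q → Prop} {F : Q → B → Prop}
    {w : List A} {μ : ℕ → B} : Accepts I δ F w μ ↔ ∃ q ∈ I, Accepts {q} δ F w μ :=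
  ⟨fun ⟨r, h₀, h⟩ => ⟨r 0, h₀, r, rfl, h⟩, fun ⟨q, hq, r, h₀, h⟩ => ⟨r, by rwa [h₀], h⟩⟩

theorem lt_of_getElem?_eq {w : List A} {i : ℕ} {a : A} (h : w[i]? = some a) : i < w.length :=
  (List.getElem?_eq_some_iff.1 h).1

namespace Recog

variable {P P' : List A → (ℕ → B) → Prop}

theorem congr (h : Recog P) {w : List A} {μ μ' : ℕ → B} (hμ : ∀ i ≤ w.length, μ i = μ' i) :
    P w μ ↔ P w μ' := by
  obtain ⟨Q, _, I, δ, F, h⟩ := h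
  rw [h, h]
  refine exists_congr fun q => and_congr_right fun _ => and_congr ?_ (by rw [hμ _ le_rfl])
  exact forall_congr' fun i => forall_congr' fun a => forall_congr' fun hi => by
    rw [hμ i (lt_of_getElem?_eq hi).le]

theorem of_iff (h : Recog P) (hP : ∀ w μ, P' w μ ↔ P w μ) : Recog P' := by
  obtain ⟨Q, hQ, I, δ, F, h⟩ := h
  exact ⟨Q, hQ, I, δ, F, fun w μ => (hP w μ).trans (h w μ)⟩

theorem and (h : Recog P) (h' : Recog P') : Recog fun w μ => P w μ ∧ P' w μ := by
  obtain ⟨Q, _, I, δ, F, h⟩ := h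
  obtain ⟨Q', _, I', δ', F', h'⟩ := h'
  refine ⟨Q × Q', inferInstance, I ×ˢ I', fun q b a r => δ q.1 b a r.1 ∧ δ' q.2 b a r.2,
    fun q b => F q.1 b ∧ F' q.2 b, fun w μ => (and_congr (h w μ) (h' w μ)).trans ?_⟩
  constructor
  · rintro ⟨⟨q, h₁, h₂, h₃⟩, q', h₁', h₂', h₃'⟩
    exact ⟨fun i => (q i, q' i), ⟨h₁, h₁'⟩, fun i a ha => ⟨h₂ i a ha, h₂' i a ha⟩, h₃, h₃'⟩
  · rintro ⟨q, h₁, h₂, h₃⟩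
    exact ⟨⟨fun i => (q i).1, h₁.1, fun i a ha => (h₂ i a ha).1, h₃.1⟩,
      fun i => (q i).2, h₁.2, fun i a ha => (h₂ i a ha).2, h₃.2⟩

theorem or (h : Recog P) (h' : Recog P') : Recog fun w μ => P w μ ∨ P' w μ := by
  obtain ⟨Q, _, I, δ, F, h⟩ := h
  obtain ⟨Q', _, I', δ', F', h'⟩ := h'
  let δ₀ : Q ⊕ Q' → B → A → Q ⊕ Q' → Prop := fun q b a r =>
    Sum.LiftRel (fun q r => δ q b a r) (fun q r => δ' q b a r) q r
  let F₀ : Q ⊕ Q' → B → Prop := Sum.elim F F'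
  have hl : ∀ w q μ, Accepts {.inl q} δ₀ F₀ w μ ↔ Accepts {q} δ F w μ := by
    intro w
    induction w with
    | nil => simp [accepts_nil, F₀]
    | cons a w ih => simp [accepts_cons, δ₀, ih]
  have hr : ∀ w q μ, Accepts {.inr q} δ₀ F₀ w μ ↔ Accepts {q} δ' F' w μ := by
    intro w
    induction w with
    | nil => simp [accepts_nil, F₀]
    | cons a w ih => simp [accepts_cons, δ₀, ih]
  refine ⟨Q ⊕ Q', inferInstance, Sum.inl '' I ∪ Sum.inr '' I', δ₀, F₀, fun w μ =>
    (or_congr (h w μ) (h' w μ)).trans ?_⟩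
  rw [accepts_iff_exists_singleton, accepts_iff_exists_singleton (I := I'),
    accepts_iff_exists_singleton (I := _ ∪ _)]
  simp [or_and_right, exists_or, hl, hr]

/-- A property of the annotation that holds in every gap. -/
theorem forall_le (D : B → Prop) : Recog fun (w : List A) μ => ∀ i ≤ w.length, D (μ i) := by
  refine ⟨Unit, inferInstance, Set.univ, fun _ b _ _ => D b, fun _ b => D b, fun w μ => ?_⟩
  constructor
  · exact fun h => ⟨fun _ => (), trivial, fun i a ha => h i (lt_of_getElem?_eq ha).le,
      h _ le_rfl⟩
  · rintro ⟨q, -, h₁, h₂⟩ i hi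
    rcases hi.lt_or_eq with hi | rfl
    · exact h₁ i _ (List.getElem?_eq_getElem hi)
    · exact h₂

/-- A property that relates the annotation of every gap to whether an annotation in `D` occurred
before. -/
theorem history (D : B → Prop) (R : B → Prop → Prop) :
    Recog fun (w : List A) μ => ∀ i ≤ w.length, R (μ i) (∃ j < i, D (μ j)) := by
  refine ⟨Prop, inferInstance, {False}, fun q b _ r => R b q ∧ (r ↔ q ∨ D b), fun q b => R b q,
    fun w μ => ?_⟩
  have hsucc : ∀ i, (∃ j < i + 1, D (μ j)) ↔ (∃ j < i, D (μ j)) ∨ D (μ i) := fun i => by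
    simp only [Nat.lt_succ_iff_lt_or_eq, or_and_right, exists_or, exists_eq_left]
  constructor
  · exact fun h => ⟨fun i => ∃ j < i, D (μ j), by simp, fun i a ha =>
      ⟨h i (lt_of_getElem?_eq ha).le, hsucc i⟩, h _ le_rfl⟩
  · rintro ⟨q, h₀, h₁, h₂⟩
    have hq : ∀ i ≤ w.length, q i = ∃ j < i, D (μ j) := by
      intro i hi
      induction i with
      | zero => simpa using h₀
      | succ i ih =>
        rw [(propext (h₁ i _ (List.getElem?_eq_getElem hi)).2), ih (by omega), hsucc]
    intro i hi
    rw [← hq i hi]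
    rcases hi.lt_or_eq with hi | rfl
    · exact (h₁ i _ (List.getElem?_eq_getElem hi)).1
    · exact h₂

/-- A property that relates the annotation of every gap to whether an annotation in `D` will occur
later. -/
theorem future (D : B → Prop) (R : B → Prop → Prop) : Recog fun (w : List A) μ =>
    ∀ i ≤ w.length, R (μ i) (∃ j, i < j ∧ j ≤ w.length ∧ D (μ j)) := by
  -- The state after `i` letters guesses whether `D` occurs in one of the gaps `i, i + 1, …`.
  refine ⟨Prop, inferInstance, Set.univ, fun q b _ r => R b r ∧ (q ↔ r ∨ D b),
    fun q b => R b False ∧ (q ↔ D b), fun w μ => ?_⟩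
  have hsucc : ∀ i ≤ w.length, (∃ j, i ≤ j ∧ j ≤ w.length ∧ D (μ j)) ↔
      (∃ j, i < j ∧ j ≤ w.length ∧ D (μ j)) ∨ D (μ i) := by
    intro i hi
    constructor
    · rintro ⟨j, hj, h⟩
      rcases hj.lt_or_eq with hj | rfl
      · exact Or.inl ⟨j, hj, h⟩
      · exact Or.inr h.2
    · rintro (⟨j, hj, h⟩ | h)
      · exact ⟨j, hj.le, h⟩
      · exact ⟨i, le_rfl, hi, h⟩
  have hlast : (∃ j, w.length < j ∧ j ≤ w.length ∧ D (μ j)) = False :=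
    eq_false fun ⟨j, hj, hj', _⟩ => by omega
  constructor
  · refine fun h => ⟨fun i => ∃ j, i ≤ j ∧ j ≤ w.length ∧ D (μ j), trivial, fun i a ha =>
      ⟨h i (lt_of_getElem?_eq ha).le, hsucc i (lt_of_getElem?_eq ha).le⟩, ?_, ?_⟩
    · have := h _ le_rfl
      rwa [hlast] at this
    · exact (hsucc _ le_rfl).trans (by rw [hlast, false_or])
  · rintro ⟨q, -, h₁, h₂, h₃⟩
    have hq : ∀ k ≤ w.length, q (w.length - k) =
        ∃ j, w.length - k ≤ j ∧ j ≤ w.length ∧ D (μ j) := by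
      intro k hk
      induction k with
      | zero => rw [Nat.sub_zero, hsucc _ le_rfl, hlast, false_or]; exact propext h₃
      | succ k ih =>
        have hk' : w.length - k = w.length - (k + 1) + 1 := by omega
        have hlt : w.length - (k + 1) < w.length := by omega
        rw [propext (h₁ _ _ (List.getElem?_eq_getElem hlt)).2, ← hk', ih (by omega),
          hsucc _ hlt.le]
        simp only [hk', Nat.succ_le_iff]
    intro i hi
    rcases hi.lt_or_eq with hi | rfl
    · have := (h₁ i _ (List.getElem?_eq_getElem hi)).1
      have h' := hq (w.length - (i + 1)) (by omega)
      rw [show w.length - (w.length - (i + 1)) = i + 1 by omega] at h'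
      rwa [h'] at this
    · rwa [hlast]

/-- The state is a proposition that may hold only if an annotation in `D` has occurred before. -/
theorem exists_le (D : B → Prop) : Recog fun (w : List A) μ => ∃ i ≤ w.length, D (μ i) := by
  refine ⟨Prop, inferInstance, {False}, fun q b _ r => r → q ∨ D b, fun q b => q ∨ D b,
    fun w μ => ?_⟩
  constructor
  · rintro ⟨k, hk, hD⟩
    refine ⟨fun i => k < i, by simp, fun i a ha h => ?_, ?_⟩
    · rcases (Nat.lt_succ_iff.1 h).lt_or_eq with h | rfl
      · exact Or.inl h
      · exact Or.inr hD
    · rcases hk.lt_or_eq with h | rfl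
      · exact Or.inl h
      · exact Or.inr hD
  · rintro ⟨q, h₀, h₁, h₂⟩
    have hq : ∀ i ≤ w.length, q i → ∃ j < i, D (μ j) := by
      intro i hi
      induction i with
      | zero => rw [Set.mem_singleton_iff.1 h₀]; exact False.elim
      | succ i ih =>
        intro h
        rcases h₁ i _ (List.getElem?_eq_getElem hi) h with h | h
        · obtain ⟨j, hj, h⟩ := ih (by omega) h
          exact ⟨j, by omega, h⟩
        · exact ⟨i, by omega, h⟩
    rcases h₂ with h | h
    · obtain ⟨j, hj, h⟩ := hq _ le_rfl h
      exact ⟨j, hj.le, h⟩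
    · exact ⟨_, le_rfl, h⟩

protected theorem true : Recog fun (_ : List A) (_ : ℕ → B) => True :=
  (forall_le fun _ => True).of_iff fun _ _ => by simp

protected theorem false : Recog fun (_ : List A) (_ : ℕ → B) => False :=
  (forall_le fun _ => False).of_iff fun w _ => by simpa using ⟨0, Nat.zero_le _⟩

theorem exists_mem {ι : Type*} (s : Finset ι) {P : ι → List A → (ℕ → B) → Prop}
    (h : ∀ i ∈ s, Recog (P i)) : Recog fun w μ => ∃ i ∈ s, P i w μ := by
  classical
  induction s using Finset.induction_on with
  | empty => exact Recog.false.of_iff fun _ _ => by simp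
  | insert i s _ ih =>
    exact ((h i (Finset.mem_insert_self i s)).or
      (ih fun j hj => h j (Finset.mem_insert_of_mem hj))).of_iff fun _ _ => by simp

theorem forall_mem {ι : Type*} (s : Finset ι) {P : ι → List A → (ℕ → B) → Prop}
    (h : ∀ i ∈ s, Recog (P i)) : Recog fun w μ => ∀ i ∈ s, P i w μ := by
  classical
  induction s using Finset.induction_on with
  | empty => exact Recog.true.of_iff fun _ _ => by simp
  | insert i s _ ih =>
    exact ((h i (Finset.mem_insert_self i s)).and
      (ih fun j hj => h j (Finset.mem_insert_of_mem hj))).of_iff fun _ _ => by simp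

theorem comap (h : Recog P) (G : C → B) :
    Recog fun w (μ : ℕ → C) => P w fun i => G (μ i) := by
  obtain ⟨Q, hQ, I, δ, F, h⟩ := h
  exact ⟨Q, hQ, I, fun q c a r => δ q (G c) a r, fun q c => F q (G c), fun w μ => h w _⟩

/-- Projection: an automaton can guess a second annotation. -/
theorem exists_seq {P : List A → (ℕ → B × C) → Prop} (h : Recog P) :
    Recog fun w (μ : ℕ → B) => ∃ ν : ℕ → C, P w fun i => (μ i, ν i) := by
  obtain ⟨Q, hQ, I, δ, F, h⟩ := h
  refine ⟨Q, hQ, I, fun q b a r => ∃ c, δ q (b, c) a r, fun q b => ∃ c, F q (b, c),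
    fun w μ => (exists_congr fun ν => h w _).trans ?_⟩
  constructor
  · rintro ⟨ν, q, h₀, h₁, h₂⟩
    exact ⟨q, h₀, fun i a ha => ⟨ν i, h₁ i a ha⟩, ν _, h₂⟩
  · rintro ⟨q, h₀, h₁, c, h₂⟩
    have : ∀ i, ∃ c, (∀ a, w[i]? = some a → δ (q i) (μ i, c) a (q (i + 1))) ∧
        (i = w.length → F (q i) (μ i, c)) := by
      intro i
      rcases lt_trichotomy i w.length with hi | rfl | hi
      · obtain ⟨c, hc⟩ := h₁ i _ (List.getElem?_eq_getElem hi)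
        refine ⟨c, fun a ha => ?_, fun h => by omega⟩
        rw [List.getElem?_eq_getElem hi] at ha
        exact Option.some.inj ha ▸ hc
      · exact ⟨c, by simp, fun _ => h₂⟩
      · exact ⟨c, fun a ha => absurd (lt_of_getElem?_eq ha) (by omega), fun h => by omega⟩
    choose ν hν using this
    exact ⟨ν, q, h₀, fun i => (hν i).1, (hν _).2 rfl⟩

end Recog

end Recog

section Valid

variable {A B V : Type*}

/-- It is recognizable whether the gaps with property `O` and the gaps with property `C` are the
left and the right end of a possibly undefined span. -/
theorem recog_span (O C : B → Prop) : Recog fun (w : List A) μ => ∃ o : Option Span,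
    (∀ r, o = some r → r.right ≤ w.length + 1) ∧ ∀ i ≤ w.length,
      (O (μ i) ↔ ∃ r, o = some r ∧ r.left = i + 1) ∧
      (C (μ i) ↔ ∃ r, o = some r ∧ r.right = i + 1) := by
  have hnone : Recog fun (w : List A) μ => ∀ i ≤ w.length, ¬ O (μ i) ∧ ¬ C (μ i) :=
    Recog.forall_le fun b => ¬ O b ∧ ¬ C b
  -- Otherwise there is exactly one gap with property `O` and exactly one with property `C`, and the
  -- latter does not precede the former.
  refine (hnone.or ((((Recog.exists_le O).and (Recog.exists_le C)).and
    (Recog.history O fun b q => O b → ¬ q)).and ((Recog.history C fun b q => C b → ¬ q).and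
    (Recog.history O fun b q => C b → q ∨ O b)))).of_iff fun w μ => ?_
  constructor
  · rintro ⟨_ | r, hr, h⟩
    · exact Or.inl fun i hi => by simpa using h i hi
    · right
      have h₁ := r.one_le_left
      have h₂ := r.left_le_right
      have h₃ := hr r rfl
      have hO : ∀ i ≤ w.length, O (μ i) ↔ i = r.left - 1 := fun i hi => by
        rw [(h i hi).1]
        simp only [Option.some.injEq, exists_eq_left']
        omega
      have hC : ∀ i ≤ w.length, C (μ i) ↔ i = r.right - 1 := fun i hi => by
        rw [(h i hi).2]
        simp only [Option.some.injEq, exists_eq_left']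
        omega
      refine ⟨⟨⟨⟨r.left - 1, by omega, (hO _ (by omega)).2 rfl⟩, r.right - 1, by omega,
        (hC _ (by omega)).2 rfl⟩, ?_⟩, ?_, ?_⟩
      · rintro i hi h ⟨j, hj, h'⟩
        rw [hO i hi] at h
        rw [hO j (by omega)] at h'
        omega
      · rintro i hi h ⟨j, hj, h'⟩
        rw [hC i hi] at h
        rw [hC j (by omega)] at h'
        omega
      · intro i hi h
        rw [hC i hi] at h
        rcases h₂.lt_or_eq with h₂ | h₂
        · exact Or.inl ⟨r.left - 1, by omega, (hO _ (by omega)).2 rfl⟩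
        · exact Or.inr ((hO i hi).2 (by omega))
  · rintro (h | ⟨⟨⟨⟨k, hk, hOk⟩, j, hj, hCj⟩, hO⟩, hC, hOC⟩)
    · exact ⟨none, by simp, fun i hi => by simp [h i hi]⟩
    · have hO' : ∀ i ≤ w.length, O (μ i) → i = k := fun i hi h => by
        rcases lt_trichotomy i k with hlt | rfl | hlt
        · exact (hO k hk hOk ⟨i, hlt, h⟩).elim
        · rfl
        · exact (hO i hi h ⟨k, hlt, hOk⟩).elim
      have hC' : ∀ i ≤ w.length, C (μ i) → i = j := fun i hi h => by
        rcases lt_trichotomy i j with hlt | rfl | hlt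
        · exact (hC j hj hCj ⟨i, hlt, h⟩).elim
        · rfl
        · exact (hC i hi h ⟨j, hlt, hCj⟩).elim
      have hkj : k ≤ j := by
        rcases hOC j hj hCj with ⟨i, hi, h⟩ | h
        · exact hO' i (by omega) h ▸ hi.le
        · exact (hO' j hj h).ge
      refine ⟨some ⟨k + 1, j + 1, by omega, by omega⟩, ?_, fun i hi => ⟨?_, ?_⟩⟩
      · rintro r hr
        obtain rfl := Option.some.inj hr
        simpa using hj
      · simp only [Option.some.injEq, exists_eq_left', Nat.add_right_cancel_iff]
        exact ⟨fun h => (hO' i hi h).symm, fun h => h ▸ hOk⟩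
      · simp only [Option.some.injEq, exists_eq_left', Nat.add_right_cancel_iff]
        exact ⟨fun h => (hC' i hi h).symm, fun h => h ▸ hCj⟩

/-- The markers of the variables from `X`. -/
def markersOf (A : Type*) {V : Type*} (X : Set V) : Set (MarkedSym A V) :=
  {s | ∃ x ∈ X, s = .opn x ∨ s = .cls x}

@[simp] theorem letter_mem_markersOf {X : Set V} {a : A} :
    .letter a ∈ markersOf A X ↔ False := by simp [markersOf]

@[simp] theorem opn_mem_markersOf {X : Set V} {x : V} : .opn x ∈ markersOf A X ↔ x ∈ X := by
  simp [markersOf]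

@[simp] theorem cls_mem_markersOf {X : Set V} {x : V} : .cls x ∈ markersOf A X ↔ x ∈ X := by
  simp [markersOf]

theorem finite_markersOf (X : Finset V) : (markersOf A (X : Set V)).Finite := by
  refine ((X.finite_toSet.image .opn).union (X.finite_toSet.image .cls)).subset ?_
  rintro s ⟨x, hx, rfl | rfl⟩
  · exact Or.inl ⟨x, hx, rfl⟩
  · exact Or.inr ⟨x, hx, rfl⟩

theorem tupleMarks_subset_iff {t : SpanTuple V} {X : Set V} :
    (∀ i, tupleMarks A t i ⊆ markersOf A X) ↔ ∀ x s, t x = some s → x ∈ X := by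
  constructor
  · intro h x s hs
    have : .opn x ∈ tupleMarks A t (s.left - 1) :=
      ⟨s, hs, (Nat.sub_add_cancel s.one_le_left).symm⟩
    simpa using h _ this
  · rintro h i (a | x | x) hx
    · exact hx.elim
    · obtain ⟨s, hs, -⟩ := hx
      simpa using h x s hs
    · obtain ⟨s, hs, -⟩ := hx
      simpa using h x s hs

/-- It is recognizable whether an annotation consists of the markers of a span-tuple over `X`: every
variable can be checked separately, as `X` is finite. -/
theorem recog_isTuple (X : Finset V) : Recog fun (w : List A) (ν : ℕ → Set (MarkedSym A V)) =>
    ∃ t, IsTuple X w t ∧ ∀ i ≤ w.length, ν i = tupleMarks A t i := by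
  classical
  refine ((Recog.forall_mem X fun x _ => recog_span (fun m : Set (MarkedSym A V) => .opn x ∈ m)
    fun m => .cls x ∈ m).and
    (Recog.forall_le fun m => m ⊆ markersOf A (X : Set V))).of_iff fun w ν => ?_
  constructor
  · rintro ⟨t, ht, hν⟩
    refine ⟨fun x _ => ⟨t x, fun r hr => (ht x r hr).2, fun i hi => ?_⟩, fun i hi => ?_⟩
    · rw [hν i hi]
      simp
    · rw [hν i hi]
      exact tupleMarks_subset_iff.2 (fun x s hs => (ht x s hs).1) i
  · rintro ⟨h, hX⟩
    choose! o ho using h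
    refine ⟨fun x => if x ∈ X then o x else none, fun x s hs => ?_, fun i hi => ?_⟩
    · by_cases hx : x ∈ X
      · exact ⟨hx, (ho x hx).1 s (by simpa [hx] using hs)⟩
      · simp [hx] at hs
    · ext s
      cases s with
      | letter a => simpa using fun h => letter_mem_markersOf.1 (hX i hi h)
      | opn x =>
        by_cases hx : x ∈ X
        · simpa [hx] using ((ho x hx).2 i hi).1
        · simpa [hx] using fun h => hx (by simpa using hX i hi h)
      | cls x =>
        by_cases hx : x ∈ X
        · simpa [hx] using ((ho x hx).2 i hi).2
        · simpa [hx] using fun h => hx (by simpa using hX i hi h)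

end Valid

/-! ### Regular spanners are the recognizable spanners -/

section IsRec

variable {A V : Type*}

/-- A spanner is recognizable if a finite automaton decides whether `t` belongs to its value on `w`,
where the annotation of the gaps of `w` is given by the markers of `t`. -/
def IsRec (S : Spanner A V) : Prop :=
  ∃ P : List A → (ℕ → Set (MarkedSym A V)) → Prop, Recog P ∧
    ∀ w t, t ∈ S.rel w ↔ Fits w t ∧ P w (tupleMarks A t)

theorem IsTuple.fits {X : Finset V} {w : List A} {t : SpanTuple V} (h : IsTuple X w t) :
    Fits w t := fun x s hs => (h x s hs).2

theorem Spanner.fits {S : Spanner A V} {w : List A} {t : SpanTuple V} (h : t ∈ S.rel w) :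
    Fits w t := by
  obtain ⟨X, hX⟩ := S.exists_vars
  exact (hX w t h).fits

/-- A finite automaton for marked words, viewed as an automaton that reads a whole block of markers
and the letter behind it in a single step. -/
theorem accepts_iff_exists_reads [DecidableEq V] {σ : Type*} (D : DFA (MarkedSym A V) σ)
    (w : List A) (q : σ) (μ : ℕ → Set (MarkedSym A V)) :
    Accepts {q} (fun q m a r => ∃ u, IsBlock m u ∧ D.evalFrom q (u ++ [.letter a]) = r)
      (fun q m => ∃ u, IsBlock m u ∧ D.evalFrom q u ∈ D.accept) w μ ↔
    ∃ v, Reads μ w v ∧ v ∈ D.acceptsFrom q := by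
  induction w generalizing q μ with
  | nil => exact accepts_nil
  | cons a w ih =>
    rw [accepts_cons]
    simp only [ih]
    constructor
    · rintro ⟨_, ⟨u, hu, rfl⟩, v, hv, h⟩
      refine ⟨_, ⟨u, v, hu, rfl, hv⟩, ?_⟩
      rw [DFA.mem_acceptsFrom] at h ⊢
      rwa [← DFA.evalFrom_of_append, List.append_assoc] at h
    · rintro ⟨_, ⟨u, v, hu, rfl, hv⟩, h⟩
      refine ⟨_, ⟨u, hu, rfl⟩, v, hv, ?_⟩
      rw [DFA.mem_acceptsFrom] at h ⊢
      rwa [← DFA.evalFrom_of_append, List.append_assoc]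

/-- The order of the markers in a gap is not visible in the annotation, so it is guessed by an
automaton whose transitions read a whole block. -/
theorem isRec_of_mem_regularSpanners [DecidableEq V] {S : Spanner A V}
    (hS : S ∈ regularSpanners A V) : IsRec S := by
  obtain ⟨L, hL, ⟨σ, _, D, rfl⟩, rfl⟩ := mem_regularSpanners_iff.1 hS
  refine ⟨fun w μ => ∃ v, Reads μ w v ∧ v ∈ D.accepts, ⟨σ, inferInstance, {D.start}, _, _,
    fun w μ => (accepts_iff_exists_reads D w _ μ).symm⟩, fun w t => ?_⟩
  constructor
  · intro h
    have hfit := Spanner.fits h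
    obtain ⟨v, hv, h₁, h₂, h₃⟩ := h
    exact ⟨hfit, v, (reads_tupleMarks_iff hfit).2 ⟨h₁, h₂, h₃⟩, hv⟩
  · rintro ⟨hfit, v, hr, hv⟩
    exact ⟨v, hv, (reads_tupleMarks_iff hfit).1 hr⟩

/-- The marked words with markers from `Γ` whose annotation is accepted by a given automaton form a
regular language: an automaton for them collects the markers read since the last letter. -/
theorem exists_isRegular_of_recog {Γ : Set (MarkedSym A V)} (hΓ : Γ.Finite)
    {P : List A → (ℕ → Set (MarkedSym A V)) → Prop} (hP : Recog P) :
    ∃ L : Language (MarkedSym A V), L.IsRegular ∧ ∀ v, v ∈ L ↔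
      (∀ s ∈ v, s.letter? = none → s ∈ Γ) ∧ P (plainWord v) (marksAt v) := by
  obtain ⟨Q, _, I, δ, F, hP⟩ := hP
  have : Finite (𝒫 Γ) := hΓ.finite_subsets.to_subtype
  let N : NFA (MarkedSym A V) (Q × 𝒫 Γ) :=
    { step := fun p s => match s with
        | .letter a => {p' | δ p.1 p.2 a p'.1 ∧ (p'.2 : Set (MarkedSym A V)) = ∅}
        | .opn x => {p' | .opn x ∈ Γ ∧ p'.1 = p.1 ∧
            (p'.2 : Set (MarkedSym A V)) = insert (.opn x) p.2.1}
        | .cls x => {p' | .cls x ∈ Γ ∧ p'.1 = p.1 ∧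
            (p'.2 : Set (MarkedSym A V)) = insert (.cls x) p.2.1}
      start := {p | p.1 ∈ I ∧ (p.2 : Set (MarkedSym A V)) = ∅}
      accept := {p | F p.1 p.2} }
  -- In a state `(q, m)`, the markers in `m` have been read since the last letter. So the rest of
  -- the word is to be read with `m` added to the annotation of its first gap.
  let add : Set (MarkedSym A V) → (ℕ → Set (MarkedSym A V)) → ℕ → Set (MarkedSym A V) :=
    fun m μ i => if i = 0 then m ∪ μ 0 else μ i
  have hadd : ∀ m μ, (fun i => add m μ (i + 1)) = fun i => μ (i + 1) := fun m μ => by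
    funext i
    simp [add]
  have hadd₀ : ∀ μ, add ∅ μ = μ := fun μ => by
    funext i
    by_cases hi : i = 0 <;> simp [add, hi]
  have hinsert : ∀ m s (v : List (MarkedSym A V)), s.letter? = none →
      add m (marksAt (s :: v)) = add (insert s m) (marksAt v) := by
    intro m s v hs
    funext i
    cases s with
    | letter a => simp [MarkedSym.letter?] at hs
    | opn x => cases i <;> simp [add, marksAt, Set.insert_union]
    | cls x => cases i <;> simp [add, marksAt, Set.insert_union]
  have hacc : ∀ v p, v ∈ N.acceptsFrom {p} ↔ (∀ s ∈ v, s.letter? = none → s ∈ Γ) ∧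
      Accepts {p.1} δ F (plainWord v) (add p.2 (marksAt v)) := by
    intro v
    have hcons : ∀ p s v, s :: v ∈ N.acceptsFrom {p} ↔
        ∃ p' ∈ N.step p s, v ∈ N.acceptsFrom {p'} := by
      intro p s v
      rw [NFA.cons_mem_acceptsFrom, NFA.stepSet_singleton, NFA.mem_acceptsFrom]
      simp only [NFA.mem_acceptsFrom, NFA.mem_evalFrom_iff_exists (S := N.step p s)]
      grind
    induction v with
    | nil =>
      intro p
      simp [NFA.nil_mem_acceptsFrom, accepts_nil, add, marksAt, N]
    | cons s v ih =>
      intro p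
      rw [hcons]
      simp only [ih]
      cases s with
      | letter a =>
        rw [plainWord_letter, accepts_cons, hadd]
        have h₀ : add p.2 (marksAt (.letter a :: v)) 0 = p.2 := by simp [add, marksAt]
        rw [h₀]
        constructor
        · rintro ⟨p', ⟨h₁, h₂⟩, h₃, h₄⟩
          refine ⟨by simpa [MarkedSym.letter?] using h₃, p'.1, h₁, ?_⟩
          rwa [h₂, hadd₀] at h₄
        · rintro ⟨h₁, q, h₂, h₃⟩
          refine ⟨(q, ⟨∅, Set.empty_subset _⟩), ⟨h₂, rfl⟩,
            fun s hs => h₁ s (List.mem_cons_of_mem _ hs), ?_⟩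
          rwa [hadd₀]
      | opn x =>
        rw [plainWord_opn, hinsert _ _ _ rfl]
        constructor
        · rintro ⟨p', ⟨h₀, h₁, h₂⟩, h₃, h₄⟩
          refine ⟨by simpa [MarkedSym.letter?] using ⟨h₀, h₃⟩, ?_⟩
          rwa [h₁, h₂] at h₄
        · rintro ⟨h₁, h₂⟩
          have hx : .opn x ∈ Γ := h₁ _ List.mem_cons_self rfl
          exact ⟨(p.1, ⟨_, Set.insert_subset hx p.2.2⟩), ⟨hx, rfl, rfl⟩,
            fun s hs => h₁ s (List.mem_cons_of_mem _ hs), h₂⟩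
      | cls x =>
        rw [plainWord_cls, hinsert _ _ _ rfl]
        constructor
        · rintro ⟨p', ⟨h₀, h₁, h₂⟩, h₃, h₄⟩
          refine ⟨by simpa [MarkedSym.letter?] using ⟨h₀, h₃⟩, ?_⟩
          rwa [h₁, h₂] at h₄
        · rintro ⟨h₁, h₂⟩
          have hx : .cls x ∈ Γ := h₁ _ List.mem_cons_self rfl
          exact ⟨(p.1, ⟨_, Set.insert_subset hx p.2.2⟩), ⟨hx, rfl, rfl⟩,
            fun s hs => h₁ s (List.mem_cons_of_mem _ hs), h₂⟩
  refine ⟨N.accepts, isRegular_accepts_NFA N, fun v => ?_⟩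
  have hstart : v ∈ N.accepts ↔ ∃ p ∈ N.start, v ∈ N.acceptsFrom {p} := by
    rw [NFA.accepts_eq_acceptsFrom_start, NFA.mem_acceptsFrom]
    simp only [NFA.mem_acceptsFrom, NFA.mem_evalFrom_iff_exists (S := N.start)]
    grind
  rw [hstart, hP, accepts_iff_exists_singleton]
  simp only [hacc]
  constructor
  · rintro ⟨p, ⟨h₁, h₂⟩, h₃, h₄⟩
    rw [h₂, hadd₀] at h₄
    exact ⟨h₃, p.1, h₁, h₄⟩
  · rintro ⟨h₁, q, h₂, h₃⟩
    refine ⟨(q, ⟨∅, Set.empty_subset _⟩), ⟨h₂, rfl⟩, h₁, ?_⟩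
    rwa [hadd₀]

/-- The regular language used here may contain words that are not subword-marked; the spanner of a
language ignores them. -/
theorem IsRec.mem_regularSpanners [DecidableEq V] {S : Spanner A V} (hS : IsRec S) :
    S ∈ regularSpanners A V := by
  obtain ⟨P, hP, hS⟩ := hS
  obtain ⟨X, hX⟩ := S.exists_vars
  obtain ⟨L, hL, hmem⟩ := exists_isRegular_of_recog (finite_markersOf (A := A) X) hP
  have hLX : VarsIn X L := by
    rintro v hv x (hx | hx)
    · simpa using ((hmem v).1 hv).1 _ hx rfl
    · simpa using ((hmem v).1 hv).1 _ hx rfl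
  refine mem_regularSpanners_iff.2 ⟨L, ⟨X, hLX⟩, hL, ?_⟩
  ext w t
  constructor
  · intro h
    have hfit := S.fits h
    have hsub := (tupleMarks_subset_iff (A := A) (X := (X : Set V))).2
      fun x s hs => (hX w t h x s hs).1
    obtain ⟨v, hv⟩ := exists_reads (A := A) (X := X) (μ := tupleMarks A t) (by
      rintro i x (hx | hx) <;> simpa using hsub i hx) w
    obtain ⟨h₁, h₂, h₃⟩ := (reads_tupleMarks_iff hfit).1 hv
    have hmarks := h₁.isSpanTupleOf_iff.1 h₃
    refine ⟨v, (hmem v).2 ⟨?_, ?_⟩, h₁, h₂, h₃⟩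
    · intro s hs hs'
      obtain ⟨v₁, v₂, rfl⟩ := List.append_of_mem hs
      exact hsub _ (hmarks ▸ (mem_marksAt_iff hs').2 ⟨v₁, v₂, rfl, rfl⟩)
    · rw [h₂, hmarks]
      exact ((hS w t).1 h).2
  · intro h
    have hfit := Spanner.fits h
    obtain ⟨v, hv, h₁, rfl, h₃⟩ := h
    refine (hS _ t).2 ⟨hfit, ?_⟩
    rw [← h₁.isSpanTupleOf_iff.1 h₃]
    exact ((hmem v).1 hv).2

end IsRec

/-! ### Closure properties of recognizable spanners -/

section Tuples

variable {A V : Type*} {w : List A} {t t' : SpanTuple V}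

theorem eq_of_marks (ht : Fits w t) (ht' : Fits w t') {x x' : V}
    (h : ∀ i ≤ w.length, (.opn x ∈ tupleMarks A t i ↔ .opn x' ∈ tupleMarks A t' i) ∧
      (.cls x ∈ tupleMarks A t i ↔ .cls x' ∈ tupleMarks A t' i)) : t x = t' x' := by
  refine eq_of_forall_marks (A := A) fun i => ?_
  by_cases hi : i ≤ w.length
  · exact h i hi
  · rw [tupleMarks_eq_of_fits ht, tupleMarks_eq_of_fits ht']
    simp [hi]

theorem eq_of_tupleMarks_eq (ht : Fits w t) (ht' : Fits w t')
    (h : ∀ i ≤ w.length, tupleMarks A t i = tupleMarks A t' i) : t = t' :=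
  funext fun _ => eq_of_marks ht ht' fun i hi => by simp only [h i hi, and_self]

theorem tupleMarks_subset_iff_of_fits (ht : Fits w t) {X : Set V} :
    (∀ i ≤ w.length, tupleMarks A t i ⊆ markersOf A X) ↔ ∀ x s, t x = some s → x ∈ X := by
  rw [← tupleMarks_subset_iff (A := A)]
  refine ⟨fun h i => ?_, fun h i _ => h i⟩
  by_cases hi : i ≤ w.length
  · exact h i hi
  · rw [tupleMarks_eq_of_fits ht]
    exact fun s hs => (hi hs.1).elim

theorem tupleMarks_restrictTuple [DecidableEq V] (Y : Finset V) (t : SpanTuple V) (i : ℕ) :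
    tupleMarks A (restrictTuple Y t) i = tupleMarks A t i ∩ markersOf A (Y : Set V) := by
  ext s
  cases s with
  | letter a => simp
  | opn x => by_cases hx : x ∈ Y <;> simp [restrictTuple, hx]
  | cls x => by_cases hx : x ∈ Y <;> simp [restrictTuple, hx]

theorem Fits.restrictTuple [DecidableEq V] (ht : Fits w t) (Y : Finset V) :
    Fits w (restrictTuple Y t) := by
  intro x s hs
  by_cases hx : x ∈ Y
  · exact ht x s (by simpa [DocSpanner.restrictTuple, hx] using hs)
  · simp [DocSpanner.restrictTuple, hx] at hs

theorem IsTuple.eq_none {X : Finset V} (ht : IsTuple X w t) {x : V} (hx : x ∉ X) : t x = none :=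
  Option.eq_none_iff_forall_ne_some.2 fun s hs => hx (ht x s hs).1

theorem some_mem_image_iff {lam : Finset V} {t : SpanTuple V} {r : Span} :
    some r ∈ lam.image t ↔ ∃ y ∈ lam, t y = some r := Finset.mem_image

end Tuples

section Fuse

variable {A V : Type*} [DecidableEq V]

theorem bigFuse_insert (o : Option Span) (K : Finset (Option Span)) (ho : o ∉ K) :
    bigFuse (insert o K) = optFuse o (bigFuse K) := by
  rw [bigFuse, Finset.fold_insert ho, ← bigFuse, id]

theorem bigFuse_eq_none {K : Finset (Option Span)} (h : bigFuse K = none) (r : Span) :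
    some r ∉ K := by
  induction K using Finset.induction_on with
  | empty => simp
  | insert o K ho ih =>
    rw [bigFuse_insert _ _ ho] at h
    cases o with
    | none => simpa using ih h
    | some a => cases hb : bigFuse K <;> simp [hb, optFuse] at h

theorem bigFuse_eq_some {K : Finset (Option Span)} {s : Span} (h : bigFuse K = some s) :
    (∃ r, some r ∈ K ∧ r.left = s.left) ∧ (∃ r, some r ∈ K ∧ r.right = s.right) ∧
      ∀ r, some r ∈ K → s.left ≤ r.left ∧ r.right ≤ s.right := by
  induction K using Finset.induction_on generalizing s with
  | empty => simp [bigFuse] at h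
  | insert o K ho ih =>
    rw [bigFuse_insert _ _ ho] at h
    cases o with
    | none =>
      obtain ⟨⟨r, hr, hl⟩, ⟨r', hr', hl'⟩, h'⟩ := ih h
      exact ⟨⟨r, Finset.mem_insert_of_mem hr, hl⟩, ⟨r', Finset.mem_insert_of_mem hr', hl'⟩,
        fun r hr => h' r (by simpa using hr)⟩
    | some a =>
      cases hb : bigFuse K with
      | none =>
        obtain rfl : a = s := by simpa [hb, optFuse] using h
        refine ⟨⟨a, by simp, rfl⟩, ⟨a, by simp, rfl⟩, fun r hr => ?_⟩
        have : r = a := by simpa [bigFuse_eq_none hb r] using hr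
        simp [this]
      | some b =>
        obtain rfl : a.fuse b = s := by simpa [hb, optFuse] using h
        obtain ⟨⟨r, hr, hl⟩, ⟨r', hr', hl'⟩, h'⟩ := ih hb
        refine ⟨?_, ?_, fun p hp => ?_⟩
        · rcases le_total a.left b.left with hab | hab
          · exact ⟨a, by simp, by simp [Span.fuse, hab]⟩
          · exact ⟨r, Finset.mem_insert_of_mem hr, by simp [Span.fuse, hab, hl]⟩
        · rcases le_total a.right b.right with hab | hab
          · exact ⟨r', Finset.mem_insert_of_mem hr', by simp [Span.fuse, hab, hl']⟩
          · exact ⟨a, by simp, by simp [Span.fuse, hab]⟩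
        · rcases Finset.mem_insert.1 hp with hp | hp
          · obtain rfl := Option.some.inj hp
            exact ⟨min_le_left _ _, le_max_left _ _⟩
          · exact ⟨(min_le_right _ _).trans (h' p hp).1, (h' p hp).2.trans (le_max_right _ _)⟩

/-- The fused span opens where the first of the spans in `lam` opens. -/
theorem opn_mem_tupleMarks_fuseTuple {lam : Finset V} {x : V} {t : SpanTuple V} {i : ℕ} :
    .opn x ∈ tupleMarks A (fuseTuple lam x t) i ↔ (∃ y ∈ lam, .opn y ∈ tupleMarks A t i) ∧
      ¬ ∃ j < i, ∃ y ∈ lam, .opn y ∈ tupleMarks A t j := by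
  simp only [opn_mem_tupleMarks, fuseTuple, if_true]
  constructor
  · rintro ⟨s, hs, hi⟩
    obtain ⟨⟨r, hr, hl⟩, -, h⟩ := bigFuse_eq_some hs
    obtain ⟨y, hy, hyr⟩ := some_mem_image_iff.1 hr
    refine ⟨⟨y, hy, r, hyr, hl.trans hi⟩, ?_⟩
    rintro ⟨j, hj, z, hz, r', hr', hj'⟩
    have := (h r' (some_mem_image_iff.2 ⟨z, hz, hr'⟩)).1
    omega
  · rintro ⟨⟨y, hy, r, hr, hi⟩, hno⟩
    have hmem := some_mem_image_iff.2 ⟨y, hy, hr⟩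
    cases hs : bigFuse (lam.image t) with
    | none => exact (bigFuse_eq_none hs r hmem).elim
    | some s =>
      obtain ⟨⟨r', hr', hl⟩, -, h⟩ := bigFuse_eq_some hs
      obtain ⟨z, hz, hzr⟩ := some_mem_image_iff.1 hr'
      refine ⟨s, rfl, ?_⟩
      have h₁ := (h r hmem).1
      have h₂ := s.one_le_left
      by_contra hne
      exact hno ⟨s.left - 1, by omega, z, hz, r', hzr, by omega⟩

/-- The fused span closes where the last of the spans in `lam` closes. -/
theorem cls_mem_tupleMarks_fuseTuple {lam : Finset V} {x : V} {w : List A} {t : SpanTuple V}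
    (ht : Fits w t) {i : ℕ} :
    .cls x ∈ tupleMarks A (fuseTuple lam x t) i ↔ (∃ y ∈ lam, .cls y ∈ tupleMarks A t i) ∧
      ¬ ∃ j, i < j ∧ j ≤ w.length ∧ ∃ y ∈ lam, .cls y ∈ tupleMarks A t j := by
  simp only [cls_mem_tupleMarks, fuseTuple, if_true]
  constructor
  · rintro ⟨s, hs, hi⟩
    obtain ⟨-, ⟨r, hr, hl⟩, h⟩ := bigFuse_eq_some hs
    obtain ⟨y, hy, hyr⟩ := some_mem_image_iff.1 hr
    refine ⟨⟨y, hy, r, hyr, hl.trans hi⟩, ?_⟩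
    rintro ⟨j, hj, -, z, hz, r', hr', hj'⟩
    have := (h r' (some_mem_image_iff.2 ⟨z, hz, hr'⟩)).2
    omega
  · rintro ⟨⟨y, hy, r, hr, hi⟩, hno⟩
    have hmem := some_mem_image_iff.2 ⟨y, hy, hr⟩
    cases hs : bigFuse (lam.image t) with
    | none => exact (bigFuse_eq_none hs r hmem).elim
    | some s =>
      obtain ⟨-, ⟨r', hr', hl⟩, h⟩ := bigFuse_eq_some hs
      obtain ⟨z, hz, hzr⟩ := some_mem_image_iff.1 hr'
      refine ⟨s, rfl, ?_⟩
      have h₁ := (h r hmem).2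
      have h₂ := ht z r' hzr
      by_contra hne
      exact hno ⟨s.right - 1, by omega, by omega, z, hz, r', hzr, by omega⟩

end Fuse

section Closure

variable {A V : Type*}

/-- A spanner is recognizable if its tuples are the images of arbitrary tuples `t` under a
recognizable relation: an automaton can guess `t`. -/
theorem IsRec.of_exists_tuple {S : Spanner A V} (X : Finset V)
    {R : List A → (ℕ → Set (MarkedSym A V) × Set (MarkedSym A V)) → Prop} (hR : Recog R)
    (h : ∀ w t', t' ∈ S.rel w ↔ Fits w t' ∧ ∃ t, IsTuple X w t ∧
      R w fun i => (tupleMarks A t' i, tupleMarks A t i)) : IsRec S := by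
  refine ⟨_, (((recog_isTuple (A := A) X).comap Prod.snd).and hR).exists_seq, fun w t' => ?_⟩
  rw [h]
  refine and_congr_right fun _ => ⟨?_, ?_⟩
  · rintro ⟨t, ht, hR⟩
    exact ⟨tupleMarks A t, ⟨t, ht, fun i _ => rfl⟩, hR⟩
  · rintro ⟨ν, ⟨t, ht, hν⟩, hR'⟩
    exact ⟨t, ht, (hR.congr fun i hi => by rw [← hν i hi]).1 hR'⟩

/-- The subspanner of the tuples with domain `D`. -/
def Spanner.withDomain (S : Spanner A V) (D : Finset V) : Spanner A V where
  rel w := {t | t ∈ S.rel w ∧ ∀ x, x ∈ D ↔ t x ≠ none}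
  exists_vars := S.exists_vars.imp fun _ h w t ht => h w t ht.1

theorem IsRec.withDomain {S : Spanner A V} (hS : IsRec S) (D : Finset V) :
    IsRec (S.withDomain D) := by
  obtain ⟨P, hP, hS⟩ := hS
  refine ⟨_, hP.and ((Recog.forall_le fun m => m ⊆ markersOf A (D : Set V)).and
    (Recog.forall_mem D fun x _ => Recog.exists_le fun m : Set (MarkedSym A V) => .opn x ∈ m)),
    fun w t => ?_⟩
  change t ∈ S.rel w ∧ _ ↔ _
  rw [hS, and_assoc]
  refine and_congr_right fun ht => and_congr_right fun _ => ?_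
  rw [tupleMarks_subset_iff_of_fits ht, forall_congr' fun x => iff_iff_implies_and_implies,
    forall_and, and_comm]
  refine and_congr ?_ (forall_congr' fun x => forall_congr' fun hx => ?_)
  · simp [Option.ne_none_iff_exists', forall_exists_index]
  · constructor
    · intro h
      obtain ⟨s, hs⟩ := Option.ne_none_iff_exists'.1 h
      have h₁ := s.one_le_left
      have h₂ := s.left_le_right
      have h₃ := ht x s hs
      exact ⟨s.left - 1, by omega, s, hs, by omega⟩
    · rintro ⟨i, -, s, hs, -⟩
      simp [hs]

variable [DecidableEq V]

theorem IsRec.union {S₁ S₂ : Spanner A V} (h₁ : IsRec S₁) (h₂ : IsRec S₂) :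
    IsRec (S₁.union S₂) := by
  obtain ⟨P₁, hP₁, h₁⟩ := h₁
  obtain ⟨P₂, hP₂, h₂⟩ := h₂
  refine ⟨_, hP₁.or hP₂, fun w t => ?_⟩
  rw [and_or_left, ← h₁, ← h₂]
  rfl

/-- An automaton for the join guesses the domains `D₁` and `D₂` of the two joined tuples: then the
tuples are the restrictions of `t` to `D₁` and to `D₂`, and compatibility is automatic. -/
theorem IsRec.join {S₁ S₂ : Spanner A V} (h₁ : IsRec S₁) (h₂ : IsRec S₂) :
    IsRec (S₁.join S₂) := by
  obtain ⟨P₁, hP₁, h₁⟩ := h₁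
  obtain ⟨P₂, hP₂, h₂⟩ := h₂
  obtain ⟨X₁, hX₁⟩ := S₁.exists_vars
  obtain ⟨X₂, hX₂⟩ := S₂.exists_vars
  refine ⟨_, Recog.exists_mem X₁.powerset fun D₁ _ => Recog.exists_mem X₂.powerset fun D₂ _ =>
    ((hP₁.comap fun m : Set (MarkedSym A V) => m ∩ markersOf A (D₁ : Set V)).and
      (hP₂.comap fun m => m ∩ markersOf A (D₂ : Set V))).and
    (Recog.forall_le fun m => m ⊆ markersOf A ((D₁ ∪ D₂ : Finset V) : Set V)), fun w t => ?_⟩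
  have key : ∀ D₁ D₂ : Finset V, Fits w t →
      (((P₁ w fun i => tupleMarks A t i ∩ markersOf A (D₁ : Set V)) ∧
        P₂ w fun i => tupleMarks A t i ∩ markersOf A (D₂ : Set V)) ∧
        (∀ i ≤ w.length, tupleMarks A t i ⊆ markersOf A ((D₁ ∪ D₂ : Finset V) : Set V)) ↔
      (restrictTuple D₁ t ∈ S₁.rel w ∧ restrictTuple D₂ t ∈ S₂.rel w) ∧
        ∀ x s, t x = some s → x ∈ D₁ ∨ x ∈ D₂) := by
    intro D₁ D₂ ht
    rw [h₁, h₂, tupleMarks_subset_iff_of_fits ht]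
    simp only [ht.restrictTuple, true_and, Finset.coe_union, Set.mem_union, SetLike.mem_coe]
    have e : ∀ D, tupleMarks A (restrictTuple D t) =
        fun i => tupleMarks A t i ∩ markersOf A (D : Set V) := fun D =>
      funext fun i => tupleMarks_restrictTuple D t i
    rw [e, e]
  constructor
  · intro h
    have ht := Spanner.fits h
    refine ⟨ht, ?_⟩
    obtain ⟨t₁, ht₁, t₂, ht₂, hc, rfl⟩ := h
    refine ⟨X₁.filter fun x => t₁ x ≠ none, by simp, X₂.filter fun x => t₂ x ≠ none, by simp,
      (key _ _ ht).2 ⟨⟨?_, ?_⟩, ?_⟩⟩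
    · convert ht₁ using 1
      funext x
      cases hx : t₁ x with
      | none => simp [restrictTuple, hx]
      | some s => simp [restrictTuple, hx, (hX₁ w t₁ ht₁ x s hx).1, joinTuple]
    · convert ht₂ using 1
      funext x
      cases hx : t₂ x with
      | none => simp [restrictTuple, hx]
      | some s =>
        cases hx₁ : t₁ x with
        | none => simp [restrictTuple, hx, hx₁, (hX₂ w t₂ ht₂ x s hx).1, joinTuple]
        | some s' =>
          simp [restrictTuple, hx, hx₁, (hX₂ w t₂ ht₂ x s hx).1, joinTuple, hc x _ _ hx₁ hx]
    · intro x s hs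
      rcases Option.or_eq_some_iff.1 hs with hs | ⟨-, hs⟩
      · exact Or.inl (by simp [hs, (hX₁ w t₁ ht₁ x s hs).1])
      · exact Or.inr (by simp [hs, (hX₂ w t₂ ht₂ x s hs).1])
  · rintro ⟨ht, D₁, -, D₂, -, h⟩
    obtain ⟨⟨h₁, h₂⟩, h⟩ := (key _ _ ht).1 h
    refine ⟨_, h₁, _, h₂, ?_, ?_⟩
    · intro x s₁ s₂ hs₁ hs₂
      by_cases hx₁ : x ∈ D₁ <;> by_cases hx₂ : x ∈ D₂ <;> simp_all [restrictTuple]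
    · funext x
      cases hx : t x with
      | none => simp [joinTuple, restrictTuple, hx]
      | some s =>
        by_cases hx₁ : x ∈ D₁
        · simp [joinTuple, restrictTuple, hx, hx₁]
        · simp [joinTuple, restrictTuple, hx, hx₁, (h x s hx).resolve_left hx₁]

/-- An automaton for the projection guesses the markers of the variables outside `Y`. -/
theorem IsRec.proj {S : Spanner A V} (hS : IsRec S) (Y : Finset V) : IsRec (S.proj Y) := by
  obtain ⟨P, hP, hS⟩ := hS
  obtain ⟨X, hX⟩ := S.exists_vars
  refine IsRec.of_exists_tuple X ((hP.comap Prod.snd).and (Recog.forall_le fun p :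
    Set (MarkedSym A V) × Set (MarkedSym A V) => p.1 = p.2 ∩ markersOf A (Y : Set V))) ?_
  intro w t'
  constructor
  · intro h
    refine ⟨Spanner.fits h, ?_⟩
    obtain ⟨t, ht, rfl⟩ := h
    exact ⟨t, hX w t ht, ((hS w t).1 ht).2, fun i _ => tupleMarks_restrictTuple Y t i⟩
  · rintro ⟨ht', t, ht, h₁, h₂⟩
    refine ⟨t, (hS w t).2 ⟨ht.fits, h₁⟩, (eq_of_tupleMarks_eq ht' (ht.fits.restrictTuple Y)
      fun i hi => ?_).symm⟩
    rw [tupleMarks_restrictTuple]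
    exact h₂ i hi

/-- An automaton for the fusion guesses the tuple `t` that is fused. It checks that the new variable
opens at the first opening marker, and closes at the last closing marker, of the variables in `lam`.
-/
theorem IsRec.fusion {S : Spanner A V} (hS : IsRec S) (lam : Finset V) (x : V) :
    IsRec (S.fusion lam x) := by
  obtain ⟨P, hP, hS⟩ := hS
  obtain ⟨X, hX⟩ := S.exists_vars
  let M := Set (MarkedSym A V)
  refine IsRec.of_exists_tuple X (((hP.comap Prod.snd).and (Recog.forall_le fun p : M × M =>
    ∀ z, z ≠ x → (.opn z ∈ p.1 ↔ z ∉ lam ∧ .opn z ∈ p.2) ∧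
      (.cls z ∈ p.1 ↔ z ∉ lam ∧ .cls z ∈ p.2))).and
    ((Recog.history (fun p : M × M => ∃ y ∈ lam, .opn y ∈ p.2) fun p before =>
      .opn x ∈ p.1 ↔ (∃ y ∈ lam, .opn y ∈ p.2) ∧ ¬ before).and
    (Recog.future (fun p : M × M => ∃ y ∈ lam, .cls y ∈ p.2) fun p later =>
      .cls x ∈ p.1 ↔ (∃ y ∈ lam, .cls y ∈ p.2) ∧ ¬ later))) ?_
  have hother : ∀ (t : SpanTuple V) i z, z ≠ x →
      (.opn z ∈ tupleMarks A (fuseTuple lam x t) i ↔ z ∉ lam ∧ .opn z ∈ tupleMarks A t i) ∧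
      (.cls z ∈ tupleMarks A (fuseTuple lam x t) i ↔ z ∉ lam ∧ .cls z ∈ tupleMarks A t i) := by
    intro t i z hz
    by_cases hl : z ∈ lam <;> simp [fuseTuple, hz, hl]
  intro w t'
  constructor
  · intro h
    refine ⟨Spanner.fits h, ?_⟩
    obtain ⟨t, ht, rfl⟩ := h
    exact ⟨t, hX w t ht, ⟨((hS w t).1 ht).2, fun i _ => hother t i⟩,
      fun i _ => opn_mem_tupleMarks_fuseTuple,
      fun i _ => cls_mem_tupleMarks_fuseTuple (S.fits ht)⟩
  · rintro ⟨ht', t, ht, ⟨h₁, h₂⟩, h₃, h₄⟩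
    have htS := (hS w t).2 ⟨ht.fits, h₁⟩
    have hmem : fuseTuple lam x t ∈ (S.fusion lam x).rel w := ⟨t, htS, rfl⟩
    convert hmem
    refine funext fun z => eq_of_marks ht' (Spanner.fits hmem) fun i hi => ?_
    by_cases hz : z = x
    · subst hz
      rw [opn_mem_tupleMarks_fuseTuple, cls_mem_tupleMarks_fuseTuple ht.fits]
      exact ⟨h₃ i hi, h₄ i hi⟩
    · rw [(hother t i z hz).1, (hother t i z hz).2]
      exact h₂ i hi z hz

/-- The spanner that extends every tuple of `S` by copies `c y` of the variables `y ∈ Y`, where `S`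
is a spanner over `X`, and the variables `c y` do not belong to `X`. -/
def Spanner.copyVars (S : Spanner A V) (X Y : Finset V) (c : V → V) : Spanner A V where
  rel w := {t | IsTuple (X ∪ Y.image c) w t ∧ restrictTuple X t ∈ S.rel w ∧
    ∀ y ∈ Y, t (c y) = t y}
  exists_vars := ⟨X ∪ Y.image c, fun _ _ ht => ht.1⟩

theorem IsRec.copyVars {S : Spanner A V} (hS : IsRec S) (X Y : Finset V) (c : V → V) :
    IsRec (S.copyVars X Y c) := by
  obtain ⟨P, hP, hS⟩ := hS
  refine ⟨_, (Recog.forall_le fun m => m ⊆ markersOf A ((X ∪ Y.image c : Finset V) : Set V)).and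
    ((hP.comap fun m => m ∩ markersOf A (X : Set V)).and (Recog.forall_le fun m => ∀ y ∈ Y,
      (.opn (c y) ∈ m ↔ .opn y ∈ m) ∧ (.cls (c y) ∈ m ↔ .cls y ∈ m))), fun w t => ?_⟩
  have e : tupleMarks A (restrictTuple X t) =
      fun i => tupleMarks A t i ∩ markersOf A (X : Set V) :=
    funext fun i => tupleMarks_restrictTuple X t i
  constructor
  · rintro ⟨h₁, h₂, h₃⟩
    refine ⟨h₁.fits, (tupleMarks_subset_iff_of_fits h₁.fits).2 fun x s hs => (h₁ x s hs).1, ?_,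
      fun i _ y hy => by simp [h₃ y hy]⟩
    rw [← e]
    exact ((hS _ _).1 h₂).2
  · rintro ⟨ht, h₁, h₂, h₃⟩
    rw [tupleMarks_subset_iff_of_fits ht] at h₁
    refine ⟨fun x s hs => ⟨h₁ x s hs, ht x s hs⟩, (hS _ _).2 ⟨ht.restrictTuple X, ?_⟩,
      fun y hy => eq_of_marks ht ht fun i hi => h₃ i hi y hy⟩
    rw [e]
    exact h₂

end Closure

/-! ### Splitting spans into their two end points -/

section Split

variable {A V : Type*}

/-- The empty span at the left end of `s`. -/
def Span.start (s : Span) : Span := ⟨s.left, s.left, s.one_le_left, le_rfl⟩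

/-- The empty span at the right end of `s`. -/
def Span.finish (s : Span) : Span := ⟨s.right, s.right, s.one_le_left.trans s.left_le_right, le_rfl⟩

theorem Span.eq_of_start_of_finish {s r : Span} (h₁ : s.start = r.start)
    (h₂ : s.finish = r.finish) : s = r :=
  Span.ext (Span.ext_iff.1 h₁).1 (Span.ext_iff.1 h₂).1

theorem Span.fuse_start_finish (s : Span) : s.start.fuse s.finish = s :=
  Span.ext (min_eq_left s.left_le_right) (max_eq_right s.left_le_right)

/-- The variables `f x` and `g x`, for `x ∈ X`, do not belong to `X`, and they are all distinct. -/
structure IsFresh (X : Finset V) (f g : V → V) : Prop where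
  inj_left : Set.InjOn f X
  inj_right : Set.InjOn g X
  left_notMem : ∀ x ∈ X, f x ∉ X
  right_notMem : ∀ x ∈ X, g x ∉ X
  ne : ∀ x ∈ X, ∀ y ∈ X, f x ≠ g y

theorem exists_injOn_notMem [Infinite V] [DecidableEq V] (X F : Finset V) :
    ∃ f : V → V, Set.InjOn f X ∧ ∀ x ∈ X, f x ∉ F := by
  induction X using Finset.induction_on with
  | empty => exact ⟨id, by simp, by simp⟩
  | insert x X hx ih =>
    obtain ⟨f, hf, hF⟩ := ih
    obtain ⟨y, hy⟩ := Infinite.exists_notMem_finset (F ∪ X.image f)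
    rw [Finset.mem_union, not_or] at hy
    have hne : ∀ z ∈ X, z ≠ x := fun z hz h => hx (h ▸ hz)
    have heq : Set.EqOn (Function.update f x y) f X := fun z hz =>
      Function.update_of_ne (hne z hz) _ _
    refine ⟨Function.update f x y, ?_, ?_⟩
    · rw [Finset.coe_insert, Set.injOn_insert (by simpa using hx), heq.injOn_iff, heq.image_eq]
      exact ⟨hf, by simpa using hy.2⟩
    · intro z hz
      rcases Finset.mem_insert.1 hz with rfl | hz
      · simpa using hy.1
      · simpa [heq hz] using hF z hz

theorem exists_isFresh [Infinite V] [DecidableEq V] (X : Finset V) :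
    ∃ f g : V → V, IsFresh X f g := by
  obtain ⟨f, hf, hf'⟩ := exists_injOn_notMem X X
  obtain ⟨g, hg, hg'⟩ := exists_injOn_notMem X (X ∪ X.image f)
  refine ⟨f, g, hf, hg, hf', fun x hx h => hg' x hx (Finset.mem_union_left _ h),
    fun x hx y hy h => hg' y hy (Finset.mem_union_right _ (h ▸ Finset.mem_image_of_mem f hx))⟩

/-- `t'` is obtained from `t` by replacing, for every `x ∈ X \ Z`, the span of `x` by the two empty
spans of `f x` and `g x` at its left and right end. The variables in `Z` are left as they are. -/
structure IsSplit (X : Finset V) (f g : V → V) (Z : Finset V) (t t' : SpanTuple V) : Prop where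
  eq_self : ∀ x ∈ Z, t' x = t x
  eq_none : ∀ x ∈ Z, t' (f x) = none ∧ t' (g x) = none
  eq_start : ∀ x ∈ X, x ∉ Z → t' (f x) = (t x).map Span.start
  eq_finish : ∀ x ∈ X, x ∉ Z → t' (g x) = (t x).map Span.finish
  eq_none_of_notMem : ∀ y, y ∉ Z → (∀ x ∈ X, y ≠ f x ∧ y ≠ g x) → t' y = none

/-- The tuples of `T` are the tuples of `S` with all variables outside `Z` split. -/
def IsSplitOf (X : Finset V) (f g : V → V) (Z : Finset V) (S T : Spanner A V) : Prop :=
  ∀ w, (∀ t ∈ S.rel w, ∃ t' ∈ T.rel w, IsSplit X f g Z t t') ∧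
    ∀ t' ∈ T.rel w, ∃ t ∈ S.rel w, IsSplit X f g Z t t'

theorem IsSplit.eq {X : Finset V} {f g : V → V} {t t' : SpanTuple V} {w : List A}
    (h : IsSplit X f g X t t') (hX : IsTuple X w t) : t' = t := by
  funext y
  by_cases hy : y ∈ X
  · exact h.eq_self y hy
  · rw [hX.eq_none hy]
    by_cases hfg : ∀ x ∈ X, y ≠ f x ∧ y ≠ g x
    · exact h.eq_none_of_notMem y hy hfg
    · push Not at hfg
      obtain ⟨x, hx, hxy⟩ := hfg
      by_cases hf : y = f x
      · exact hf ▸ (h.eq_none x hx).1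
      · exact hxy hf ▸ (h.eq_none x hx).2

theorem IsSplit.isTuple [DecidableEq V] {X Z : Finset V} {f g : V → V} {t t' : SpanTuple V}
    {w : List A} (h : IsSplit X f g Z t t') (hX : IsTuple X w t) :
    IsTuple (Z ∪ (X.image f ∪ X.image g)) w t' := by
  intro y s hs
  simp only [Finset.mem_union, Finset.mem_image]
  by_cases hy : y ∈ Z
  · rw [h.eq_self y hy] at hs
    exact ⟨Or.inl hy, (hX y s hs).2⟩
  · by_cases hfg : ∀ x ∈ X, y ≠ f x ∧ y ≠ g x
    · simp [h.eq_none_of_notMem y hy hfg] at hs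
    · push Not at hfg
      obtain ⟨x, hx, hxy⟩ := hfg
      by_cases hxZ : x ∈ Z
      · obtain ⟨h₁, h₂⟩ := h.eq_none x hxZ
        by_cases hf : y = f x
        · rw [hf, h₁] at hs
          simp at hs
        · rw [hxy hf, h₂] at hs
          simp at hs
      · have h₁ := h.eq_start x hx hxZ
        have h₂ := h.eq_finish x hx hxZ
        by_cases hf : y = f x
        · subst hf
          rw [h₁] at hs
          obtain ⟨r, hr, rfl⟩ := Option.map_eq_some_iff.1 hs
          exact ⟨Or.inr (Or.inl ⟨x, hx, rfl⟩), r.left_le_right.trans (hX x r hr).2⟩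
        · obtain rfl := hxy hf
          rw [h₂] at hs
          obtain ⟨r, hr, rfl⟩ := Option.map_eq_some_iff.1 hs
          exact ⟨Or.inr (Or.inr ⟨x, hx, rfl⟩), (hX x r hr).2⟩

end Split

section SplitWord

variable {A V : Type*}

/-- The substitution of marked words for symbols that replaces the opening marker of `x` by an empty
capture of `f x`, and its closing marker by an empty capture of `g x`. -/
def splitSym (f g : V → V) : MarkedSym A V → List (MarkedSym A V)
  | .letter a => [.letter a]
  | .opn x => [.opn (f x), .cls (f x)]
  | .cls x => [.opn (g x), .cls (g x)]

theorem plainWord_flatMap_splitSym (f g : V → V) (v : List (MarkedSym A V)) :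
    plainWord (v.flatMap (splitSym f g)) = plainWord v := by
  induction v with
  | nil => rfl
  | cons s v ih => cases s <;> simp [splitSym, ih]

theorem mem_marksAt_flatMap_splitSym (f g : V → V) (v : List (MarkedSym A V)) (i : ℕ) (y : V) :
    (.opn y ∈ marksAt (v.flatMap (splitSym f g)) i ↔
      (∃ x, .opn x ∈ marksAt v i ∧ y = f x) ∨ ∃ x, .cls x ∈ marksAt v i ∧ y = g x) ∧
    (.cls y ∈ marksAt (v.flatMap (splitSym f g)) i ↔
      (∃ x, .opn x ∈ marksAt v i ∧ y = f x) ∨ ∃ x, .cls x ∈ marksAt v i ∧ y = g x) := by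
  induction v generalizing i with
  | nil => simp [marksAt]
  | cons s v ih =>
    cases s <;> cases i <;>
      simp [splitSym, marksAt, ih, or_and_right, exists_or, or_assoc, or_left_comm]

theorem flatMap_filter {α β : Type*} (p : α → Bool) (k : α → List β) (v : List α)
    (h : ∀ s ∈ v, p s = false → k s = []) : (v.filter p).flatMap k = v.flatMap k := by
  induction v with
  | nil => rfl
  | cons s v ih =>
    have ih := ih fun s hs => h s (List.mem_cons_of_mem _ hs)
    cases hp : p s with
    | true => simp [hp, ih]
    | false => simp [hp, ih, h s List.mem_cons_self hp]

variable [DecidableEq V]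

theorem IsFresh.isSubwordMarked_flatMap {X : Finset V} {f g : V → V} (hfg : IsFresh X f g)
    {v : List (MarkedSym A V)} (hv : IsSubwordMarked v)
    (hX : ∀ x, .opn x ∈ v ∨ .cls x ∈ v → x ∈ X) :
    IsSubwordMarked (v.flatMap (splitSym f g)) := by
  intro y
  rw [List.filter_flatMap]
  by_cases hy : ∃ x ∈ X, y = f x ∨ y = g x
  · obtain ⟨x, hx, hxy⟩ := hy
    have hne := hfg.ne x hx x hx
    rw [← flatMap_filter (MarkedSym.isMarkerOf x)]
    · rcases hv x with h | h
      · simp [h]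
      · right
        rcases hxy with rfl | rfl
        · simp [h, splitSym, hne.symm]
        · simp [h, splitSym, hne]
    · intro s hs hsx
      cases s with
      | letter a => simp [splitSym]
      | opn z =>
        have hz := hX z (Or.inl hs)
        have hzx : z ≠ x := by simpa using hsx
        rcases hxy with rfl | rfl
        · simp [splitSym, hfg.inj_left.ne hz hx hzx]
        · simp [splitSym, hfg.ne z hz x hx]
      | cls z =>
        have hz := hX z (Or.inr hs)
        have hzx : z ≠ x := by simpa using hsx
        rcases hxy with rfl | rfl
        · simp [splitSym, (hfg.ne x hx z hz).symm]
        · simp [splitSym, hfg.inj_right.ne hz hx hzx]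
  · push Not at hy
    left
    rw [List.flatMap_eq_nil_iff]
    intro s hs
    cases s with
    | letter a => simp [splitSym]
    | opn z => simp [splitSym, (hy z (hX z (Or.inl hs))).1.symm]
    | cls z => simp [splitSym, (hy z (hX z (Or.inr hs))).2.symm]

theorem IsFresh.isSplit {X : Finset V} {f g : V → V} (hfg : IsFresh X f g)
    {v : List (MarkedSym A V)} (hv : IsSubwordMarked v)
    (hX : ∀ x, .opn x ∈ v ∨ .cls x ∈ v → x ∈ X) {t t' : SpanTuple V} (ht : IsSpanTupleOf v t)
    (ht' : IsSpanTupleOf (v.flatMap (splitSym f g)) t') : IsSplit X f g ∅ t t' := by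
  have h := hv.isSpanTupleOf_iff.1 ht
  have h' := (hfg.isSubwordMarked_flatMap hv hX).isSpanTupleOf_iff.1 ht'
  have hmem := mem_marksAt_flatMap_splitSym f g v
  rw [h, h'] at hmem
  have hopn : ∀ i x, .opn x ∈ tupleMarks A t i → x ∈ X := fun i x hx =>
    hX x (Or.inl (mem_of_mem_marksAt (i := i) (by rwa [h])))
  have hcls : ∀ i x, .cls x ∈ tupleMarks A t i → x ∈ X := fun i x hx =>
    hX x (Or.inr (mem_of_mem_marksAt (i := i) (by rwa [h])))
  have hleft : ∀ x ∈ X, ∀ i, ((∃ z, .opn z ∈ tupleMarks A t i ∧ f x = f z) ∨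
      ∃ z, .cls z ∈ tupleMarks A t i ∧ f x = g z) ↔ .opn x ∈ tupleMarks A t i := by
    intro x hx i
    constructor
    · rintro (⟨z, hz, hxz⟩ | ⟨z, hz, hxz⟩)
      · rwa [hfg.inj_left hx (hopn i z hz) hxz]
      · exact (hfg.ne x hx z (hcls i z hz) hxz).elim
    · exact fun h => Or.inl ⟨x, h, rfl⟩
  have hright : ∀ x ∈ X, ∀ i, ((∃ z, .opn z ∈ tupleMarks A t i ∧ g x = f z) ∨
      ∃ z, .cls z ∈ tupleMarks A t i ∧ g x = g z) ↔ .cls x ∈ tupleMarks A t i := by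
    intro x hx i
    constructor
    · rintro (⟨z, hz, hxz⟩ | ⟨z, hz, hxz⟩)
      · exact (hfg.ne z (hopn i z hz) x hx hxz.symm).elim
      · rwa [hfg.inj_right hx (hcls i z hz) hxz]
    · exact fun h => Or.inr ⟨x, h, rfl⟩
  refine ⟨by simp, by simp, fun x hx _ => ?_, fun x hx _ => ?_, fun y _ hy => ?_⟩
  · refine eq_of_forall_marks (A := A) (t' := fun z => (t z).map Span.start) fun i => ?_
    rw [(hmem i (f x)).1, (hmem i (f x)).2, hleft x hx i]
    simp [Span.start]
  · refine eq_of_forall_marks (A := A) (t' := fun z => (t z).map Span.finish) fun i => ?_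
    rw [(hmem i (g x)).1, (hmem i (g x)).2, hright x hx i]
    simp [Span.finish]
  · refine eq_of_forall_marks (A := A) (x' := y) (t' := fun _ => none) fun i => ?_
    have hno : ¬ ((∃ z, .opn z ∈ tupleMarks A t i ∧ y = f z) ∨
        ∃ z, .cls z ∈ tupleMarks A t i ∧ y = g z) := by
      rintro (⟨z, hz, hyz⟩ | ⟨z, hz, hyz⟩)
      · exact (hy z (hopn i z hz)).1 hyz
      · exact (hy z (hcls i z hz)).2 hyz
    rw [(hmem i y).1, (hmem i y).2]
    simp only [hno, false_iff]
    simp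

/-- A regular spanner over `X` is described by a regular language that consists of subword-marked
words only. -/
theorem exists_isRegular_isSubwordMarked {S : Spanner A V} (hS : S ∈ regularSpanners A V)
    {X : Finset V} (hX : S.IsOver X) : ∃ L : Language (MarkedSym A V), L.IsRegular ∧
      (∀ v ∈ L, IsSubwordMarked v ∧ ∀ x, .opn x ∈ v ∨ .cls x ∈ v → x ∈ X) ∧
      ∀ w t, t ∈ S.rel w ↔ ∃ v ∈ L, plainWord v = w ∧ IsSpanTupleOf v t := by
  classical
  obtain ⟨L, hL, hreg, rfl⟩ := mem_regularSpanners_iff.1 hS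
  have hinter : ∀ Y : Finset V, ∃ K : Language (MarkedSym A V), K.IsRegular ∧
      ∀ v, v ∈ K ↔ v ∈ L ∧ ∀ x ∈ Y, v.filter (MarkedSym.isMarkerOf x) ∈
        ({[], [.opn x, .cls x]} : Set (List (MarkedSym A V))) := by
    intro Y
    induction Y using Finset.induction_on with
    | empty => exact ⟨L, hreg, by simp⟩
    | insert x Y _ ih =>
      obtain ⟨K, hK, hmem⟩ := ih
      refine ⟨K ⊓ filterLanguage (MarkedSym.isMarkerOf x) {[], [.opn x, .cls x]},
        hK.inf (isRegular_filterLanguage _ (Set.toFinite _)), fun v => ?_⟩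
      rw [Language.mem_inf, hmem, mem_filterLanguage, Finset.forall_mem_insert]
      tauto
  obtain ⟨K, hK, hmem⟩ := hinter X
  let p : MarkedSym A V → Bool := fun s => decide (s.letter? = none ∧ s ∉ markersOf A (X : Set V))
  have hp : ∀ v, v ∈ filterLanguage p {[]} ↔ ∀ x, .opn x ∈ v ∨ .cls x ∈ v → x ∈ X := by
    intro v
    rw [mem_filterLanguage, Set.mem_singleton_iff, List.filter_eq_nil_iff]
    constructor
    · rintro h x (hx | hx)
      · simpa [p, MarkedSym.letter?] using h _ hx
      · simpa [p, MarkedSym.letter?] using h _ hx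
    · rintro h (a | x | x) hx
      · simp [p, MarkedSym.letter?]
      · simpa [p, MarkedSym.letter?] using h x (Or.inl hx)
      · simpa [p, MarkedSym.letter?] using h x (Or.inr hx)
  have hsub : ∀ v ∈ K ⊓ filterLanguage p {[]}, IsSubwordMarked v ∧
      ∀ x, .opn x ∈ v ∨ .cls x ∈ v → x ∈ X := by
    intro v hv
    rw [Language.mem_inf, hp] at hv
    refine ⟨fun x => ?_, hv.2⟩
    by_cases hx : x ∈ X
    · simpa using ((hmem v).1 hv.1).2 x hx
    · left
      rw [List.filter_eq_nil_iff]
      rintro (a | y | y) hy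
      · simp
      · have := hv.2 y (Or.inl hy)
        rintro h
        obtain rfl : y = x := by simpa using h
        exact hx this
      · have := hv.2 y (Or.inr hy)
        rintro h
        obtain rfl : y = x := by simpa using h
        exact hx this
  refine ⟨K ⊓ filterLanguage p {[]}, hK.inf (isRegular_filterLanguage _ (Set.finite_singleton _)),
    hsub, fun w t => ⟨?_, ?_⟩⟩
  · intro ht
    obtain ⟨v, hv, h₁, h₂, h₃⟩ := id ht
    refine ⟨v, ?_, h₂, h₃⟩
    rw [Language.mem_inf, hp, hmem]
    refine ⟨⟨hv, fun x _ => by simpa using h₁ x⟩, fun x hx => ?_⟩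
    have hmarks := h₁.isSpanTupleOf_iff.1 h₃
    rcases hx with hx | hx
    · obtain ⟨v₁, v₂, rfl⟩ := List.append_of_mem hx
      have : .opn x ∈ tupleMarks A t (plainWord v₁).length :=
        hmarks ▸ (mem_marksAt_iff rfl).2 ⟨v₁, v₂, rfl, rfl⟩
      obtain ⟨s, hs, -⟩ := this
      exact (hX w t ht x s hs).1
    · obtain ⟨v₁, v₂, rfl⟩ := List.append_of_mem hx
      have : .cls x ∈ tupleMarks A t (plainWord v₁).length :=
        hmarks ▸ (mem_marksAt_iff rfl).2 ⟨v₁, v₂, rfl, rfl⟩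
      obtain ⟨s, hs, -⟩ := this
      exact (hX w t ht x s hs).1
  · rintro ⟨v, hv, h₂, h₃⟩
    have hv' := Language.mem_inf.1 hv
    exact ⟨v, ((hmem v).1 hv'.1).1, (hsub v hv).1, h₂, h₃⟩

/-- Splitting all spans turns a regular spanner into the spanner of a regex-formula: by Kleene's
theorem, since an empty capture, unlike a single marker, is the language of a regex-formula. -/
theorem exists_regex_isSplitOf [Finite A] {S : Spanner A V} (hS : S ∈ regularSpanners A V)
    {X : Finset V} (hX : S.IsOver X) {f g : V → V} (hfg : IsFresh X f g) :
    ∃ γ : RegexFormula A V, IsSplitOf X f g ∅ S γ.spanner := by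
  obtain ⟨L, hL, hsub, hmem⟩ := exists_isRegular_isSubwordMarked hS hX
  have hΓ : (Set.range MarkedSym.letter ∪ markersOf A (X : Set V)).Finite :=
    (Set.finite_range _).union (finite_markersOf X)
  obtain ⟨γ, hγ⟩ := exists_lang_eq_flatMap hL hΓ.toFinset (fun v hv s hs => by
      rw [Set.Finite.mem_toFinset]
      cases s with
      | letter a => exact Or.inl ⟨a, rfl⟩
      | opn x => exact Or.inr (opn_mem_markersOf.2 ((hsub v hv).2 x (Or.inl hs)))
      | cls x => exact Or.inr (cls_mem_markersOf.2 ((hsub v hv).2 x (Or.inr hs))))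
    (splitSym f g) (fun s _ => by
      have hcap : ∀ (x : V) (u : List (MarkedSym A V)),
          u ∈ (RegexFormula.capture x .epsilon : RegexFormula A V).lang ↔ u = [.opn x, .cls x] := by
        intro x u
        rw [RegexFormula.lang, RegexFormula.lang, mul_one, Language.mem_mul]
        constructor
        · rintro ⟨_, rfl, _, rfl, rfl⟩
          rfl
        · rintro rfl
          exact ⟨_, rfl, _, rfl, rfl⟩
      cases s with
      | letter a => exact ⟨.char a, fun u => Iff.rfl⟩
      | opn x => exact ⟨_, hcap (f x)⟩
      | cls x => exact ⟨_, hcap (g x)⟩)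
  refine ⟨γ, fun w => ⟨fun t ht => ?_, ?_⟩⟩
  · obtain ⟨v, hv, hw, htv⟩ := (hmem w t).1 ht
    obtain ⟨h₁, h₂⟩ := hsub v hv
    have h₁' := hfg.isSubwordMarked_flatMap h₁ h₂
    obtain ⟨t', ht'⟩ := h₁'.exists_isSpanTupleOf
    exact ⟨t', ⟨_, (hγ _).2 ⟨v, hv, rfl⟩, h₁', (plainWord_flatMap_splitSym f g v).trans hw, ht'⟩,
      hfg.isSplit h₁ h₂ htv ht'⟩
  · rintro t' ⟨u, hu, -, hw, ht'⟩
    obtain ⟨v, hv, rfl⟩ := (hγ u).1 hu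
    obtain ⟨h₁, h₂⟩ := hsub v hv
    obtain ⟨t, ht⟩ := h₁.exists_isSpanTupleOf
    exact ⟨t, (hmem w t).2 ⟨v, hv, (plainWord_flatMap_splitSym f g v).symm.trans hw, ht⟩,
      hfg.isSplit h₁ h₂ ht ht'⟩

end SplitWord

/-! ### Recovering spans from their end points -/

section Recover

variable {A V : Type*} [DecidableEq V]

/-- A class of spanners contains a regular spanner `S` if it contains all spanners of regex-formulas
and if the variables of `S`, all split in the beginning, can be recovered one at a time. -/
theorem mem_of_recover_step [Finite A] {C : Set (Spanner A V)} (hC : regexSpanners A V ⊆ C)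
    {S : Spanner A V} (hS : S ∈ regularSpanners A V) {X : Finset V} (hX : S.IsOver X)
    {f g : V → V} (hfg : IsFresh X f g)
    (hstep : ∀ Z ⊆ X, ∀ x ∈ X, x ∉ Z → ∀ T ∈ C, IsSplitOf X f g Z S T →
      ∃ T' ∈ C, IsSplitOf X f g (insert x Z) S T') : S ∈ C := by
  have key : ∀ Z ⊆ X, ∃ T ∈ C, IsSplitOf X f g Z S T := by
    intro Z
    induction Z using Finset.induction_on with
    | empty =>
      intro _
      obtain ⟨γ, hγ⟩ := exists_regex_isSplitOf hS hX hfg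
      exact ⟨γ.spanner, hC ⟨γ, rfl⟩, hγ⟩
    | insert x Z hx ih =>
      intro hZ
      rw [Finset.insert_subset_iff] at hZ
      obtain ⟨T, hT, hST⟩ := ih hZ.2
      exact hstep Z hZ.2 x hZ.1 hx T hT hST
  obtain ⟨T, hT, hST⟩ := key X subset_rfl
  convert hT
  ext w t
  constructor
  · intro ht
    obtain ⟨t', ht', h⟩ := (hST w).1 t ht
    rwa [h.eq (hX w t ht)] at ht'
  · intro ht'
    obtain ⟨t₀, ht₀, h⟩ := (hST w).2 t ht'
    rwa [h.eq (hX w t₀ ht₀)]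

theorem bigFuse_pair (a b : Option Span) : bigFuse {a, b} = optFuse a b := by
  have hone : ∀ o : Option Span, bigFuse {o} = o := fun o => by cases o <;> simp [bigFuse, optFuse]
  by_cases hab : a = b
  · subst hab
    rw [Finset.pair_eq_singleton, hone]
    cases a <;> simp [optFuse, Span.fuse]
  · rw [bigFuse_insert _ _ (by simpa using hab), hone]

/-- The span of `x` is recovered by the fusion of its two end points. -/
theorem IsSplit.fuse {X : Finset V} {f g : V → V} (hfg : IsFresh X f g) {Z : Finset V}
    (hZ : Z ⊆ X) {x : V} (hx : x ∈ X) (hxZ : x ∉ Z) {t t' : SpanTuple V}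
    (h : IsSplit X f g Z t t') : IsSplit X f g (insert x Z) t (fuseTuple {f x, g x} x t') := by
  have hne : ∀ z ∈ X, z ≠ f x ∧ z ≠ g x := fun z hz =>
    ⟨fun e => hfg.left_notMem x hx (e ▸ hz), fun e => hfg.right_notMem x hx (e ▸ hz)⟩
  have hxx : bigFuse (({f x, g x} : Finset V).image t') = t x := by
    rw [Finset.image_insert, Finset.image_singleton, bigFuse_pair, h.eq_start x hx hxZ,
      h.eq_finish x hx hxZ]
    cases t x with
    | none => rfl
    | some s => simp [optFuse, Span.fuse_start_finish]
  refine ⟨?_, ?_, ?_, ?_, ?_⟩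
  · intro z hz
    by_cases hzx : z = x
    · subst hzx
      simpa [fuseTuple] using hxx
    · have hz := (Finset.mem_insert.1 hz).resolve_left hzx
      simp [fuseTuple, hzx, hne z (hZ hz), h.eq_self z hz]
  · intro z hz
    have hzX : z ∈ X := by
      rcases Finset.mem_insert.1 hz with rfl | hz
      · exact hx
      · exact hZ hz
    have h₁ : f z ≠ x := fun e => hfg.left_notMem z hzX (e ▸ hx)
    have h₂ : g z ≠ x := fun e => hfg.right_notMem z hzX (e ▸ hx)
    by_cases hzx : z = x
    · subst hzx
      simp [fuseTuple, h₁, h₂]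
    · have hz := (Finset.mem_insert.1 hz).resolve_left hzx
      simp [fuseTuple, h₁, h₂, h.eq_none z hz]
  · intro z hz hzZ
    rw [Finset.mem_insert, not_or] at hzZ
    have h₁ : f z ≠ x := fun e => hfg.left_notMem z hz (e ▸ hx)
    have h₂ : f z ≠ f x := hfg.inj_left.ne hz hx hzZ.1
    have h₃ : f z ≠ g x := hfg.ne z hz x hx
    simp [fuseTuple, h₁, h₂, h₃, h.eq_start z hz hzZ.2]
  · intro z hz hzZ
    rw [Finset.mem_insert, not_or] at hzZ
    have h₁ : g z ≠ x := fun e => hfg.right_notMem z hz (e ▸ hx)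
    have h₂ : g z ≠ g x := hfg.inj_right.ne hz hx hzZ.1
    have h₃ : g z ≠ f x := (hfg.ne x hx z hz).symm
    simp [fuseTuple, h₁, h₂, h₃, h.eq_finish z hz hzZ.2]
  · intro y hy hy'
    rw [Finset.mem_insert, not_or] at hy
    simp [fuseTuple, hy.1, hy' x hx, h.eq_none_of_notMem y hy.2 hy']

/-- Every regular spanner is obtained from a regex-formula by span-fusions. -/
theorem regularSpanners_subset_closureUnder_fusion [Finite A] [Infinite V] {P : Set SpannerOp}
    (hP : SpannerOp.fusion ∈ P) :
    regularSpanners A V ⊆ closureUnder (regexSpanners A V) P := by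
  intro S hS
  obtain ⟨X, hX⟩ := S.exists_vars
  obtain ⟨f, g, hfg⟩ := exists_isFresh X
  refine mem_of_recover_step (fun T hT => InClosure.base hT) hS hX hfg ?_
  intro Z hZ x hx hxZ T hT hST
  refine ⟨T.fusion {f x, g x} x, ?_, fun w => ⟨fun t ht => ?_, ?_⟩⟩
  · refine InClosure.fusion (Z ∪ (X.image f ∪ X.image g)) {f x, g x} x hP ?_ ?_ ?_ hT
    · intro w t' ht'
      obtain ⟨t, ht, h⟩ := (hST w).2 t' ht'
      exact h.isTuple (hX w t ht)
    · rw [Finset.insert_subset_iff, Finset.singleton_subset_iff]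
      constructor
      · exact Finset.mem_union_right _ (Finset.mem_union_left _ (Finset.mem_image_of_mem f hx))
      · exact Finset.mem_union_right _ (Finset.mem_union_right _ (Finset.mem_image_of_mem g hx))
    · simp only [Finset.mem_sdiff, Finset.mem_union, Finset.mem_image, not_and, not_not]
      rintro (h | ⟨z, hz, rfl⟩ | ⟨z, hz, rfl⟩)
      · exact (hxZ h).elim
      · exact (hfg.left_notMem z hz hx).elim
      · exact (hfg.right_notMem z hz hx).elim
  · obtain ⟨t', ht', h⟩ := (hST w).1 t ht
    exact ⟨_, ⟨t', ht', rfl⟩, h.fuse hfg hZ hx hxZ⟩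
  · rintro _ ⟨t', ht', rfl⟩
    obtain ⟨t, ht, h⟩ := (hST w).2 t' ht'
    exact ⟨t, ht, h.fuse hfg hZ hx hxZ⟩

/-- The tuple that maps `x` to `s`, and `y` and `z` to the end points of `s`. -/
def endsTuple (x y z : V) (s : Span) : SpanTuple V := fun v =>
  if v = x then some s else if v = y then some s.start else if v = z then some s.finish else none

theorem filter_map_letter (x : V) (w : List A) :
    (w.map (.letter : A → MarkedSym A V)).filter (MarkedSym.isMarkerOf x) = [] := by
  induction w <;> simp [*]

/-- The tuples `endsTuple x y z s` are described by the regex-formula `Σ* x{y{ε} Σ* z{ε}} Σ*`. -/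
theorem exists_regex_endsTuple [Finite A] {x y z : V} (hxy : x ≠ y) (hxz : x ≠ z) (hyz : y ≠ z) :
    ∃ γ : RegexFormula A V, ∀ w t, t ∈ γ.spanner.rel w ↔
      ∃ s : Span, s.right ≤ w.length + 1 ∧ t = endsTuple x y z s := by
  obtain ⟨γ₀, hγ₀⟩ := exists_lang_letters (A := A) (V := V)
  let γ : RegexFormula A V := .concat (.concat γ₀ (.capture x (.concat (.concat
    (.capture y .epsilon) γ₀) (.capture z .epsilon)))) γ₀
  let word : List A → List A → List A → List (MarkedSym A V) := fun w₁ w₂ w₃ =>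
    w₁.map .letter ++ (.opn x :: .opn y :: .cls y :: (w₂.map .letter ++
      (.opn z :: .cls z :: .cls x :: (w₃.map .letter ++ []))))
  have hlang : ∀ v, v ∈ γ.lang ↔ ∃ w₁ w₂ w₃, v = word w₁ w₂ w₃ := by
    intro v
    simp only [γ, RegexFormula.lang, Language.mem_mul, mul_one, hγ₀]
    constructor
    · rintro ⟨_, ⟨_, ⟨w₁, rfl⟩, _, ⟨_, ⟨_, rfl, _, ⟨_, ⟨_, ⟨_, rfl, _, rfl, rfl⟩, _, ⟨w₂, rfl⟩,
        rfl⟩, _, ⟨_, rfl, _, rfl, rfl⟩, rfl⟩, rfl⟩, _, rfl, rfl⟩, rfl⟩, _, ⟨w₃, rfl⟩, rfl⟩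
      exact ⟨w₁, w₂, w₃, by simp [word]⟩
    · rintro ⟨w₁, w₂, w₃, rfl⟩
      exact ⟨_, ⟨_, ⟨w₁, rfl⟩, _, ⟨_, ⟨_, rfl, _, ⟨_, ⟨_, ⟨_, rfl, _, rfl, rfl⟩, _, ⟨w₂, rfl⟩, rfl⟩,
        _, ⟨_, rfl, _, rfl, rfl⟩, rfl⟩, rfl⟩, _, rfl, rfl⟩, rfl⟩, _, ⟨w₃, rfl⟩, by simp [word]⟩
  have hsub : ∀ w₁ w₂ w₃, IsSubwordMarked (word w₁ w₂ w₃) := by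
    intro w₁ w₂ w₃ v
    simp only [word, List.filter_append, filter_map_letter, List.nil_append, List.append_nil]
    by_cases h₁ : v = x
    · subst h₁
      simp [hxy.symm, hxz.symm, filter_map_letter]
    · by_cases h₂ : v = y
      · subst h₂
        simp [hxy, hyz.symm, filter_map_letter]
      · by_cases h₃ : v = z
        · subst h₃
          simp [hxz, hyz, filter_map_letter]
        · simp [Ne.symm h₁, Ne.symm h₂, Ne.symm h₃, filter_map_letter]
  have hplain : ∀ w₁ w₂ w₃, plainWord (word w₁ w₂ w₃) = w₁ ++ (w₂ ++ w₃) := by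
    intro w₁ w₂ w₃
    simp [word, plainWord_map_letter]
  have hmarks : ∀ w₁ w₂ w₃, marksAt (word w₁ w₂ w₃) = tupleMarks A (endsTuple x y z
      ⟨w₁.length + 1, w₁.length + w₂.length + 1, by omega, by omega⟩) := by
    intro w₁ w₂ w₃
    have hl : ∀ (w : List A) (v : List (MarkedSym A V)) i s,
        s ∈ marksAt (w.map .letter ++ v) i ↔ w.length ≤ i ∧ s ∈ marksAt v (i - w.length) := by
      intro w v i s
      rw [marksAt_letters_append]
      split_ifs with h <;> simp <;> omega
    have ho : ∀ (y : V) (v : List (MarkedSym A V)) i s,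
        s ∈ marksAt (.opn y :: v) i ↔ (s = .opn y ∧ i = 0) ∨ s ∈ marksAt v i := by
      intro y v i s
      cases i <;> simp [marksAt]
    have hc : ∀ (y : V) (v : List (MarkedSym A V)) i s,
        s ∈ marksAt (.cls y :: v) i ↔ (s = .cls y ∧ i = 0) ∨ s ∈ marksAt v i := by
      intro y v i s
      cases i <;> simp [marksAt]
    funext i
    ext s
    simp only [word, hl, ho, hc, marksAt, Set.mem_empty_iff_false, and_false, or_false]
    cases s with
    | letter a => simp
    | opn v =>
      simp only [opn_mem_tupleMarks, endsTuple, MarkedSym.opn.injEq, reduceCtorEq, false_and,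
        or_false]
      by_cases h₁ : v = x
      · subst h₁
        simp [hxy, hxz]
        omega
      · by_cases h₂ : v = y
        · subst h₂
          simp [h₁, hyz, Span.start]
          omega
        · by_cases h₃ : v = z
          · subst h₃
            simp [h₁, h₂, Span.finish]
            omega
          · simp [h₁, h₂, h₃]
    | cls v =>
      simp only [cls_mem_tupleMarks, endsTuple, MarkedSym.cls.injEq, reduceCtorEq, false_and,
        false_or]
      by_cases h₁ : v = x
      · subst h₁
        simp [hxy, hxz]
        omega
      · by_cases h₂ : v = y
        · subst h₂
          simp [h₁, hyz, Span.start]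
          omega
        · by_cases h₃ : v = z
          · subst h₃
            simp [h₁, h₂, Span.finish]
            omega
          · simp [h₁, h₂, h₃]
  refine ⟨γ, fun w t => ⟨?_, ?_⟩⟩
  · rintro ⟨v, hv, h, hw, ht⟩
    obtain ⟨w₁, w₂, w₃, rfl⟩ := (hlang v).1 hv
    rw [hplain] at hw
    subst hw
    refine ⟨⟨w₁.length + 1, w₁.length + w₂.length + 1, by omega, by omega⟩, by simp, ?_⟩
    rw [h.isSpanTupleOf_iff, hmarks] at ht
    exact (tupleMarks_injective ht).symm
  · rintro ⟨s, hs, rfl⟩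
    have h₁ := s.one_le_left
    have h₂ := s.left_le_right
    refine ⟨word (w.take (s.left - 1)) ((w.drop (s.left - 1)).take (s.right - s.left))
      ((w.drop (s.left - 1)).drop (s.right - s.left)), (hlang _).2 ⟨_, _, _, rfl⟩, hsub _ _ _,
      by rw [hplain]; simp, ?_⟩
    rw [(hsub _ _ _).isSpanTupleOf_iff, hmarks]
    congr 2
    apply Span.ext
    · simp only [List.length_take]
      omega
    · simp only [List.length_take, List.length_drop]
      omega

end Recover

/-! ### Regular spanners by unions, joins and projections -/

section Join

variable {A V : Type*} [DecidableEq V]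

theorem endsTuple_eq_none {x y z v : V} {s : Span} (h₁ : v ≠ x) (h₂ : v ≠ y) (h₃ : v ≠ z) :
    endsTuple x y z s v = none := by
  simp [endsTuple, h₁, h₂, h₃]

/-- The span of `x` is recovered by a join with its two end points. The projection forgets the end
points of `x`, and keeps those of the other variables. -/
theorem IsSplit.join {X : Finset V} {f g : V → V} (hfg : IsFresh X f g) {Z : Finset V}
    (hZ : Z ⊆ X) {x : V} (hx : x ∈ X) (hxZ : x ∉ Z) {t t' : SpanTuple V}
    (h : IsSplit X f g Z t t') {s : Span} (hs : t x = some s) :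
    IsSplit X f g (insert x Z) t (restrictTuple ((X ∪ (X.image f ∪ X.image g)) \ {f x, g x})
      (joinTuple t' (endsTuple x (f x) (g x) s))) := by
  have hne : ∀ z ∈ X, z ≠ f x ∧ z ≠ g x := fun z hz =>
    ⟨fun e => hfg.left_notMem x hx (e ▸ hz), fun e => hfg.right_notMem x hx (e ▸ hz)⟩
  have hfx : ∀ z ∈ X, f z ≠ x := fun z hz e => hfg.left_notMem z hz (e ▸ hx)
  have hgx : ∀ z ∈ X, g z ≠ x := fun z hz e => hfg.right_notMem z hz (e ▸ hx)
  have hx' : t' x = none :=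
    h.eq_none_of_notMem x hxZ fun z hz => ⟨(hfx z hz).symm, (hgx z hz).symm⟩
  refine ⟨?_, ?_, ?_, ?_, ?_⟩
  · intro z hz
    by_cases hzx : z = x
    · subst hzx
      simp [restrictTuple, joinTuple, hx, hne z hx, hx', hs, endsTuple]
    · have hz := (Finset.mem_insert.1 hz).resolve_left hzx
      simp [restrictTuple, joinTuple, hZ hz, hne z (hZ hz), h.eq_self z hz,
        endsTuple_eq_none hzx (hne z (hZ hz)).1 (hne z (hZ hz)).2]
  · intro z hz
    by_cases hzx : z = x
    · subst hzx
      simp [restrictTuple]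
    · have hz := (Finset.mem_insert.1 hz).resolve_left hzx
      have h₁ : f z ≠ f x := hfg.inj_left.ne (hZ hz) hx hzx
      have h₂ : g z ≠ g x := hfg.inj_right.ne (hZ hz) hx hzx
      simp [restrictTuple, joinTuple, h.eq_none z hz,
        endsTuple_eq_none (hfx z (hZ hz)) h₁ (hfg.ne z (hZ hz) x hx),
        endsTuple_eq_none (hgx z (hZ hz)) (hfg.ne x hx z (hZ hz)).symm h₂]
  · intro z hz hzZ
    rw [Finset.mem_insert, not_or] at hzZ
    have h₁ : f z ≠ f x := hfg.inj_left.ne hz hx hzZ.1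
    have h₂ := hfg.ne z hz x hx
    have hmem : f z ∈ (X ∪ (X.image f ∪ X.image g)) \ {f x, g x} := by
      simp only [Finset.mem_sdiff, Finset.mem_union, Finset.mem_insert, Finset.mem_singleton,
        not_or]
      exact ⟨Or.inr (Or.inl (Finset.mem_image_of_mem f hz)), h₁, h₂⟩
    rw [restrictTuple, if_pos hmem, joinTuple, endsTuple_eq_none (hfx z hz) h₁ h₂, Option.or_none,
      h.eq_start z hz hzZ.2]
  · intro z hz hzZ
    rw [Finset.mem_insert, not_or] at hzZ
    have h₁ : g z ≠ g x := hfg.inj_right.ne hz hx hzZ.1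
    have h₂ := (hfg.ne x hx z hz).symm
    have hmem : g z ∈ (X ∪ (X.image f ∪ X.image g)) \ {f x, g x} := by
      simp only [Finset.mem_sdiff, Finset.mem_union, Finset.mem_insert, Finset.mem_singleton,
        not_or]
      exact ⟨Or.inr (Or.inr (Finset.mem_image_of_mem g hz)), h₂, h₁⟩
    rw [restrictTuple, if_pos hmem, joinTuple, endsTuple_eq_none (hgx z hz) h₂ h₁, Option.or_none,
      h.eq_finish z hz hzZ.2]
  · intro y hy hy'
    rw [Finset.mem_insert, not_or] at hy
    simp [restrictTuple, joinTuple, h.eq_none_of_notMem y hy.2 hy',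
      endsTuple_eq_none hy.1 (hy' x hx).1 (hy' x hx).2]

/-- A regular spanner all of whose tuples have the same domain is obtained from regex-formulas by
joins and projections: the span of `x` is recovered from its end points by a join with the spanner
of `Σ* x{f x{ε} Σ* g x{ε}} Σ*`. Without the hypothesis on the domain, the join would also give a
value to `x` in tuples that are undefined on `x`. -/
theorem mem_closureUnder_join_of_domain [Finite A] [Infinite V] {P : Set SpannerOp}
    (hjoin : SpannerOp.join ∈ P) (hproj : SpannerOp.proj ∈ P) {S : Spanner A V}
    (hS : S ∈ regularSpanners A V) {X : Finset V}
    (hX : ∀ w, ∀ t ∈ S.rel w, ∀ x, x ∈ X ↔ t x ≠ none) :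
    S ∈ closureUnder (regexSpanners A V) P := by
  have hover : S.IsOver X := fun w t ht x s hs =>
    ⟨(hX w t ht x).2 (by simp [hs]), S.fits ht x s hs⟩
  obtain ⟨f, g, hfg⟩ := exists_isFresh X
  refine mem_of_recover_step (fun T hT => InClosure.base hT) hS hover hfg ?_
  intro Z hZ x hx hxZ T hT hST
  have hxf : x ≠ f x := fun e => hfg.left_notMem x hx (e ▸ hx)
  have hxg : x ≠ g x := fun e => hfg.right_notMem x hx (e ▸ hx)
  have hfgx := hfg.ne x hx x hx
  obtain ⟨γ, hγ⟩ := exists_regex_endsTuple (A := A) hxf hxg hfgx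
  have hends : ∀ s, endsTuple x (f x) (g x) s x = some s ∧
      endsTuple x (f x) (g x) s (f x) = some s.start ∧
      endsTuple x (f x) (g x) s (g x) = some s.finish := fun s => by
    simp [endsTuple, hxf.symm, hxg.symm, hfgx.symm]
  refine ⟨(T.join γ.spanner).proj ((X ∪ (X.image f ∪ X.image g)) \ {f x, g x}),
    InClosure.proj _ hproj (InClosure.join hjoin hT (InClosure.base ⟨γ, rfl⟩)),
    fun w => ⟨fun t ht => ?_, ?_⟩⟩
  · obtain ⟨t', ht', h⟩ := (hST w).1 t ht
    obtain ⟨s, hs⟩ := Option.ne_none_iff_exists'.1 ((hX w t ht x).1 hx)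
    refine ⟨_, ⟨_, ⟨t', ht', _, (hγ w _).2 ⟨s, S.fits ht x s hs, rfl⟩, ?_, rfl⟩, rfl⟩,
      h.join hfg hZ hx hxZ hs⟩
    intro y s₁ s₂ h₁ h₂
    have hx' : t' x = none := h.eq_none_of_notMem x hxZ fun z hz =>
      ⟨fun e => hfg.left_notMem z hz (e ▸ hx), fun e => hfg.right_notMem z hz (e ▸ hx)⟩
    by_cases hyx : y = x
    · rw [hyx, hx'] at h₁
      simp at h₁
    · by_cases hyf : y = f x
      · rw [hyf, h.eq_start x hx hxZ, hs] at h₁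
        rw [hyf, (hends s).2.1] at h₂
        exact Option.some.inj (h₁.symm.trans h₂)
      · by_cases hyg : y = g x
        · rw [hyg, h.eq_finish x hx hxZ, hs] at h₁
          rw [hyg, (hends s).2.2] at h₂
          exact Option.some.inj (h₁.symm.trans h₂)
        · simp [endsTuple_eq_none hyx hyf hyg] at h₂
  · rintro _ ⟨_, ⟨t', ht', d, hd, hc, rfl⟩, rfl⟩
    obtain ⟨s, -, rfl⟩ := (hγ w d).1 hd
    obtain ⟨t, ht, h⟩ := (hST w).2 t' ht'
    obtain ⟨r, hr⟩ := Option.ne_none_iff_exists'.1 ((hX w t ht x).1 hx)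
    have h₁ := hc (f x) r.start s.start (by rw [h.eq_start x hx hxZ, hr]; rfl) (hends s).2.1
    have h₂ := hc (g x) r.finish s.finish (by rw [h.eq_finish x hx hxZ, hr]; rfl) (hends s).2.2
    obtain rfl := Span.eq_of_start_of_finish h₁ h₂
    exact ⟨t, ht, h.join hfg hZ hx hxZ hr⟩

/-- The empty union is the spanner of the regex-formula `∅`. -/
theorem exists_mem_closureUnder_biUnion {P : Set SpannerOp} (hunion : SpannerOp.union ∈ P)
    {ι : Type*} (s : Finset ι) (T : ι → Spanner A V)
    (hT : ∀ i ∈ s, T i ∈ closureUnder (regexSpanners A V) P) :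
    ∃ U ∈ closureUnder (regexSpanners A V) P, ∀ w t, t ∈ U.rel w ↔ ∃ i ∈ s, t ∈ (T i).rel w := by
  classical
  induction s using Finset.induction_on with
  | empty =>
    refine ⟨_, InClosure.base ⟨.empty, rfl⟩, fun w t => ?_⟩
    simp only [Finset.notMem_empty, false_and, exists_false, iff_false]
    rintro ⟨v, hv, -⟩
    exact Language.notMem_zero v hv
  | insert i s _ ih =>
    obtain ⟨U, hU, hmem⟩ := ih fun j hj => hT j (Finset.mem_insert_of_mem hj)
    refine ⟨(T i).union U, InClosure.union hunion (hT i (Finset.mem_insert_self i s)) hU,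
      fun w t => ?_⟩
    rw [Finset.exists_mem_insert, ← hmem]
    rfl

/-- Every regular spanner is obtained from regex-formulas by unions, joins and projections: it is
the union of the regular spanners of its tuples with a given domain. -/
theorem regularSpanners_subset_closureUnder_join [Finite A] [Infinite V] {P : Set SpannerOp}
    (hunion : SpannerOp.union ∈ P) (hjoin : SpannerOp.join ∈ P) (hproj : SpannerOp.proj ∈ P) :
    regularSpanners A V ⊆ closureUnder (regexSpanners A V) P := by
  intro S hS
  obtain ⟨X, hX⟩ := S.exists_vars
  obtain ⟨U, hU, hmem⟩ := exists_mem_closureUnder_biUnion hunion X.powerset S.withDomain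
    fun D _ => mem_closureUnder_join_of_domain hjoin hproj
      ((isRec_of_mem_regularSpanners hS).withDomain D).mem_regularSpanners fun _ _ ht => ht.2
  convert hU
  ext w t
  rw [hmem]
  constructor
  · intro ht
    refine ⟨X.filter fun x => t x ≠ none, by simp, ht, fun x => ?_⟩
    rw [Finset.mem_filter, and_iff_right_iff_imp]
    intro hx
    obtain ⟨s, hs⟩ := Option.ne_none_iff_exists'.1 hx
    exact (hX w t ht x s hs).1
  · rintro ⟨D, -, ht, -⟩
    exact ht

/-- The regular spanners are closed under all operations except string-equality selection. -/
theorem closureUnder_subset_regularSpanners {P : Set SpannerOp} (hP : SpannerOp.strEq ∉ P) :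
    closureUnder (regexSpanners A V) P ⊆ regularSpanners A V := by
  intro S hS
  refine IsRec.mem_regularSpanners ?_
  induction hS with
  | base h => exact isRec_of_mem_regularSpanners (regexSpanners_subset_regularSpanners h)
  | union _ _ _ ih₁ ih₂ => exact ih₁.union ih₂
  | join _ _ _ ih₁ ih₂ => exact ih₁.join ih₂
  | proj Y _ _ ih => exact ih.proj Y
  | strEq _ h => exact (hP h).elim
  | fusion X lam x _ _ _ _ _ ih => exact ih.fusion lam x

end Join

/-! ### The normal form of core spanners -/

section NormalForm

variable {A V : Type*}

/-- All variables from `Y` on which `t` is defined have the same value. -/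
def StrEqOn (w : List A) (Y : Finset V) (t : SpanTuple V) : Prop :=
  ∀ x ∈ Y, ∀ y ∈ Y, ∀ s s', t x = some s → t y = some s' → s.value w = s'.value w

theorem StrEqOn.congr {w : List A} {Y : Finset V} {t t' : SpanTuple V} (h : StrEqOn w Y t)
    (heq : ∀ x ∈ Y, t' x = t x) : StrEqOn w Y t' := fun x hx y hy s s' hs hs' =>
  h x hx y hy s s' (heq x hx ▸ hs) (heq y hy ▸ hs')

theorem strEqOn_of_eq_none {w : List A} {Y : Finset V} {t : SpanTuple V}
    (h : ∀ x ∈ Y, t x = none) : StrEqOn w Y t := fun x hx _ _ _ _ hs =>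
  absurd ((h x hx).symm.trans hs) (by simp)

theorem IsTuple.mono {X Y : Finset V} {w : List A} {t : SpanTuple V} (ht : IsTuple X w t)
    (h : X ⊆ Y) : IsTuple Y w t := fun x s hs => ⟨h (ht x s hs).1, (ht x s hs).2⟩

variable [DecidableEq V]

/-- `S` is the projection to `F` of a sequence of string-equality selections of a regular spanner,
where the selections use hidden variables only: a set `H` disjoint from `F`. The set `F` may be any
sufficiently large finite set of variables, and any finite set `G` can be avoided by `H`; this is
what makes the hidden variables of two spanners independent of each other. -/
def HasNormalForm (S : Spanner A V) : Prop :=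
  ∃ X : Finset V, ∀ F, X ⊆ F → ∀ G : Finset V, ∃ (H : Finset V) (Ys : List (Finset V))
    (R : Spanner A V), (∀ x ∈ H, x ∉ F ∧ x ∉ G) ∧ (∀ Y ∈ Ys, Y ⊆ H) ∧ IsRec R ∧
    R.IsOver (F ∪ H) ∧ ∀ w t, t ∈ S.rel w ↔
      ∃ r ∈ R.rel w, (∀ Y ∈ Ys, StrEqOn w Y r) ∧ t = restrictTuple F r

theorem restrictTuple_eq_self {X : Finset V} {w : List A} {t : SpanTuple V} (ht : IsTuple X w t) :
    restrictTuple X t = t := by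
  funext x
  by_cases hx : x ∈ X
  · simp [restrictTuple, hx]
  · simp [restrictTuple, hx, ht.eq_none hx]

theorem IsRec.hasNormalForm {S : Spanner A V} (hS : IsRec S) : HasNormalForm S := by
  obtain ⟨X, hX⟩ := S.exists_vars
  refine ⟨X, fun F hF G => ⟨∅, [], S, by simp, by simp, hS,
    fun w t ht => (hX w t ht).mono (hF.trans (Finset.subset_union_left)), fun w t => ?_⟩⟩
  constructor
  · exact fun ht => ⟨t, ht, by simp, (restrictTuple_eq_self ((hX w t ht).mono hF)).symm⟩
  · rintro ⟨r, hr, -, rfl⟩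
    rwa [restrictTuple_eq_self ((hX w r hr).mono hF)]

/-- If the hidden variables of the two spanners are disjoint, then the selections of the one spanner
do not affect the tuples of the other: these are undefined on the variables of the selection. -/
theorem HasNormalForm.union {S₁ S₂ : Spanner A V} (h₁ : HasNormalForm S₁)
    (h₂ : HasNormalForm S₂) : HasNormalForm (S₁.union S₂) := by
  obtain ⟨X₁, h₁⟩ := h₁
  obtain ⟨X₂, h₂⟩ := h₂
  refine ⟨X₁ ∪ X₂, fun F hF G => ?_⟩
  obtain ⟨H₁, Ys₁, R₁, hH₁, hY₁, hR₁, hX₁, h₁⟩ := h₁ F (Finset.union_subset_left hF) G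
  obtain ⟨H₂, Ys₂, R₂, hH₂, hY₂, hR₂, hX₂, h₂⟩ := h₂ F (Finset.union_subset_right hF) (G ∪ H₁)
  simp only [Finset.mem_union, not_or] at hH₂
  have hnone₁ : ∀ w, ∀ r ∈ R₁.rel w, ∀ x ∈ H₂, r x = none := fun w r hr x hx =>
    (hX₁ w r hr).eq_none (by simpa using ⟨(hH₂ x hx).1, (hH₂ x hx).2.2⟩)
  have hnone₂ : ∀ w, ∀ r ∈ R₂.rel w, ∀ x ∈ H₁, r x = none := fun w r hr x hx =>
    (hX₂ w r hr).eq_none (by simpa using ⟨(hH₁ x hx).1, fun h => (hH₂ x h).2.2 hx⟩)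
  refine ⟨H₁ ∪ H₂, Ys₁ ++ Ys₂, R₁.union R₂, ?_, ?_, hR₁.union hR₂, ?_, fun w t => ?_⟩
  · intro x hx
    rcases Finset.mem_union.1 hx with hx | hx
    · exact hH₁ x hx
    · exact ⟨(hH₂ x hx).1, (hH₂ x hx).2.1⟩
  · intro Y hY
    rcases List.mem_append.1 hY with hY | hY
    · exact (hY₁ Y hY).trans Finset.subset_union_left
    · exact (hY₂ Y hY).trans Finset.subset_union_right
  · rintro w t (ht | ht)
    · exact (hX₁ w t ht).mono (Finset.union_subset_union_right Finset.subset_union_left)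
    · exact (hX₂ w t ht).mono (Finset.union_subset_union_right Finset.subset_union_right)
  · refine (or_congr (h₁ w t) (h₂ w t)).trans ⟨?_, ?_⟩
    · rintro (⟨r, hr, hY, rfl⟩ | ⟨r, hr, hY, rfl⟩)
      · refine ⟨r, Or.inl hr, fun Y hY' => ?_, rfl⟩
        rcases List.mem_append.1 hY' with hY' | hY'
        · exact hY Y hY'
        · exact strEqOn_of_eq_none fun x hx => hnone₁ w r hr x (hY₂ Y hY' hx)
      · refine ⟨r, Or.inr hr, fun Y hY' => ?_, rfl⟩
        rcases List.mem_append.1 hY' with hY' | hY'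
        · exact strEqOn_of_eq_none fun x hx => hnone₂ w r hr x (hY₁ Y hY' hx)
        · exact hY Y hY'
    · rintro ⟨r, hr | hr, hY, rfl⟩
      · exact Or.inl ⟨r, hr, fun Y h => hY Y (List.mem_append_left _ h), rfl⟩
      · exact Or.inr ⟨r, hr, fun Y h => hY Y (List.mem_append_right _ h), rfl⟩

theorem restrictTuple_joinTuple (F : Finset V) (t₁ t₂ : SpanTuple V) :
    restrictTuple F (joinTuple t₁ t₂) = joinTuple (restrictTuple F t₁) (restrictTuple F t₂) := by
  funext x
  by_cases hx : x ∈ F <;> simp [restrictTuple, joinTuple, hx]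

/-- If the hidden variables of the two spanners are disjoint, then joining before or after they are
projected away makes no difference. -/
theorem HasNormalForm.join {S₁ S₂ : Spanner A V} (h₁ : HasNormalForm S₁)
    (h₂ : HasNormalForm S₂) : HasNormalForm (S₁.join S₂) := by
  obtain ⟨X₁, h₁⟩ := h₁
  obtain ⟨X₂, h₂⟩ := h₂
  refine ⟨X₁ ∪ X₂, fun F hF G => ?_⟩
  obtain ⟨H₁, Ys₁, R₁, hH₁, hY₁, hR₁, hX₁, h₁⟩ := h₁ F (Finset.union_subset_left hF) G
  obtain ⟨H₂, Ys₂, R₂, hH₂, hY₂, hR₂, hX₂, h₂⟩ := h₂ F (Finset.union_subset_right hF) (G ∪ H₁)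
  simp only [Finset.mem_union, not_or] at hH₂
  have hnone₁ : ∀ w, ∀ r ∈ R₁.rel w, ∀ x ∈ H₂, r x = none := fun w r hr x hx =>
    (hX₁ w r hr).eq_none (by simpa using ⟨(hH₂ x hx).1, (hH₂ x hx).2.2⟩)
  have hnone₂ : ∀ w, ∀ r ∈ R₂.rel w, ∀ x ∈ H₁, r x = none := fun w r hr x hx =>
    (hX₂ w r hr).eq_none (by simpa using ⟨(hH₁ x hx).1, fun h => (hH₂ x h).2.2 hx⟩)
  have hcompat : ∀ w, ∀ r₁ ∈ R₁.rel w, ∀ r₂ ∈ R₂.rel w,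
      (Compatible (restrictTuple F r₁) (restrictTuple F r₂) ↔ Compatible r₁ r₂) := by
    intro w r₁ hr₁ r₂ hr₂
    constructor
    · intro h x s₁ s₂ hs₁ hs₂
      by_cases hx : x ∈ F
      · exact h x s₁ s₂ (by simpa [restrictTuple, hx] using hs₁)
          (by simpa [restrictTuple, hx] using hs₂)
      · have hx₁ := (Finset.mem_union.1 (hX₁ w r₁ hr₁ x s₁ hs₁).1).resolve_left hx
        rw [hnone₂ w r₂ hr₂ x hx₁] at hs₂
        simp at hs₂
    · intro h x s₁ s₂ hs₁ hs₂
      by_cases hx : x ∈ F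
      · exact h x s₁ s₂ (by simpa [restrictTuple, hx] using hs₁)
          (by simpa [restrictTuple, hx] using hs₂)
      · simp [restrictTuple, hx] at hs₁
  refine ⟨H₁ ∪ H₂, Ys₁ ++ Ys₂, R₁.join R₂, ?_, ?_, hR₁.join hR₂, ?_, fun w t => ?_⟩
  · intro x hx
    rcases Finset.mem_union.1 hx with hx | hx
    · exact hH₁ x hx
    · exact ⟨(hH₂ x hx).1, (hH₂ x hx).2.1⟩
  · intro Y hY
    rcases List.mem_append.1 hY with hY | hY
    · exact (hY₁ Y hY).trans Finset.subset_union_left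
    · exact (hY₂ Y hY).trans Finset.subset_union_right
  · rintro w _ ⟨r₁, hr₁, r₂, hr₂, -, rfl⟩ x s hs
    rcases Option.or_eq_some_iff.1 hs with hs | ⟨-, hs⟩
    · exact (hX₁ w r₁ hr₁).mono (Finset.union_subset_union_right Finset.subset_union_left) x s hs
    · exact (hX₂ w r₂ hr₂).mono (Finset.union_subset_union_right Finset.subset_union_right) x s hs
  · have heq₁ : ∀ r₁ ∈ R₁.rel w, ∀ r₂ ∈ R₂.rel w, ∀ x ∈ H₁, joinTuple r₁ r₂ x = r₁ x :=
      fun r₁ _ r₂ hr₂ x hx => by simp [joinTuple, hnone₂ w r₂ hr₂ x hx]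
    have heq₂ : ∀ r₁ ∈ R₁.rel w, ∀ r₂ ∈ R₂.rel w, ∀ x ∈ H₂, joinTuple r₁ r₂ x = r₂ x :=
      fun r₁ hr₁ r₂ _ x hx => by simp [joinTuple, hnone₁ w r₁ hr₁ x hx]
    constructor
    · rintro ⟨t₁, ht₁, t₂, ht₂, hc, rfl⟩
      obtain ⟨r₁, hr₁, hs₁, rfl⟩ := (h₁ w t₁).1 ht₁
      obtain ⟨r₂, hr₂, hs₂, rfl⟩ := (h₂ w t₂).1 ht₂
      refine ⟨joinTuple r₁ r₂, ⟨r₁, hr₁, r₂, hr₂, (hcompat w r₁ hr₁ r₂ hr₂).1 hc, rfl⟩,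
        fun Y hY => ?_, (restrictTuple_joinTuple F r₁ r₂).symm⟩
      rcases List.mem_append.1 hY with hY | hY
      · exact (hs₁ Y hY).congr fun x hx => heq₁ r₁ hr₁ r₂ hr₂ x (hY₁ Y hY hx)
      · exact (hs₂ Y hY).congr fun x hx => heq₂ r₁ hr₁ r₂ hr₂ x (hY₂ Y hY hx)
    · rintro ⟨_, ⟨r₁, hr₁, r₂, hr₂, hc, rfl⟩, hs, rfl⟩
      refine ⟨_, (h₁ w _).2 ⟨r₁, hr₁, fun Y hY => ?_, rfl⟩, _,
        (h₂ w _).2 ⟨r₂, hr₂, fun Y hY => ?_, rfl⟩, (hcompat w r₁ hr₁ r₂ hr₂).2 hc,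
        restrictTuple_joinTuple F r₁ r₂⟩
      · exact (hs Y (List.mem_append_left _ hY)).congr fun x hx =>
          (heq₁ r₁ hr₁ r₂ hr₂ x (hY₁ Y hY hx)).symm
      · exact (hs Y (List.mem_append_right _ hY)).congr fun x hx =>
          (heq₂ r₁ hr₁ r₂ hr₂ x (hY₂ Y hY hx)).symm

theorem HasNormalForm.proj {S : Spanner A V} (h : HasNormalForm S) (Y : Finset V) :
    HasNormalForm (S.proj Y) := by
  obtain ⟨X, h⟩ := h
  refine ⟨X ∪ Y, fun F hF G => ?_⟩
  obtain ⟨H, Ys, R, hH, hYs, hR, hX, h⟩ := h F (Finset.union_subset_left hF) G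
  have hself : ∀ (r : SpanTuple V), ∀ x ∈ H, restrictTuple (Y ∪ H) r x = r x := fun r x hx => by
    simp [restrictTuple, hx]
  have hrestrict : ∀ r : SpanTuple V,
      restrictTuple F (restrictTuple (Y ∪ H) r) = restrictTuple Y (restrictTuple F r) := by
    intro r
    funext x
    by_cases hx : x ∈ F
    · have hxH : x ∉ H := fun hxH => (hH x hxH).1 hx
      by_cases hxY : x ∈ Y <;> simp [restrictTuple, hx, hxH, hxY]
    · simp [restrictTuple, hx]
  refine ⟨H, Ys, R.proj (Y ∪ H), hH, hYs, hR.proj _, ?_, fun w t => ⟨?_, ?_⟩⟩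
  · rintro w _ ⟨r, hr, rfl⟩ x s hs
    by_cases hx : x ∈ Y ∪ H
    · exact hX w r hr x s (by simpa [restrictTuple, hx] using hs)
    · simp [restrictTuple, hx] at hs
  · rintro ⟨t, ht, rfl⟩
    obtain ⟨r, hr, hs, rfl⟩ := (h w t).1 ht
    exact ⟨_, ⟨r, hr, rfl⟩, fun Y hY => (hs Y hY).congr fun x hx => hself r x (hYs Y hY hx),
      (hrestrict r).symm⟩
  · rintro ⟨_, ⟨r, hr, rfl⟩, hs, rfl⟩
    exact ⟨_, (h w _).2 ⟨r, hr, fun Y hY => (hs Y hY).congr fun x hx =>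
      (hself r x (hYs Y hY hx)).symm, rfl⟩, (hrestrict r).symm⟩

theorem HasNormalForm.fusion {S : Spanner A V} (h : HasNormalForm S) (lam : Finset V) (x : V) :
    HasNormalForm (S.fusion lam x) := by
  obtain ⟨X, h⟩ := h
  refine ⟨X ∪ insert x lam, fun F hF G => ?_⟩
  obtain ⟨H, Ys, R, hH, hYs, hR, hX, h⟩ := h F (Finset.union_subset_left hF) G
  have hF' := Finset.union_subset_right hF
  rw [Finset.insert_subset_iff] at hF'
  obtain ⟨hxF, hlam⟩ := hF'
  have hself : ∀ (r : SpanTuple V), ∀ z ∈ H, fuseTuple lam x r z = r z := fun r z hz => by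
    have h₁ : z ≠ x := fun e => (hH z hz).1 (e ▸ hxF)
    have h₂ : z ∉ lam := fun hl => (hH z hz).1 (hlam hl)
    simp [fuseTuple, h₁, h₂]
  have hrestrict : ∀ r : SpanTuple V,
      restrictTuple F (fuseTuple lam x r) = fuseTuple lam x (restrictTuple F r) := by
    intro r
    have himage : lam.image (restrictTuple F r) = lam.image r :=
      Finset.image_congr fun z hz => by simp [restrictTuple, hlam hz]
    funext z
    by_cases hz : z = x
    · simp [restrictTuple, fuseTuple, hz, hxF, himage]
    · by_cases hl : z ∈ lam <;> by_cases hzF : z ∈ F <;>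
        simp [restrictTuple, fuseTuple, hz, hl, hzF]
  refine ⟨H, Ys, R.fusion lam x, hH, hYs, hR.fusion _ _, ?_, fun w t => ⟨?_, ?_⟩⟩
  · intro w t ht z s hs
    refine ⟨?_, Spanner.fits ht z s hs⟩
    obtain ⟨r, hr, rfl⟩ := ht
    by_cases hz : z = x
    · exact Finset.mem_union_left _ (hz ▸ hxF)
    · by_cases hl : z ∈ lam
      · exact Finset.mem_union_left _ (hlam hl)
      · exact (hX w r hr z s (by simpa [fuseTuple, hz, hl] using hs)).1
  · rintro ⟨t, ht, rfl⟩
    obtain ⟨r, hr, hs, rfl⟩ := (h w t).1 ht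
    exact ⟨_, ⟨r, hr, rfl⟩, fun Y hY => (hs Y hY).congr fun x hx => hself r x (hYs Y hY hx),
      (hrestrict r).symm⟩
  · rintro ⟨_, ⟨r, hr, rfl⟩, hs, rfl⟩
    exact ⟨_, (h w _).2 ⟨r, hr, fun Y hY => (hs Y hY).congr fun x hx =>
      (hself r x (hYs Y hY hx)).symm, rfl⟩, (hrestrict r).symm⟩

/-- A string-equality selection on visible variables is replaced by one on hidden copies of them. -/
theorem HasNormalForm.strEq [Infinite V] {S : Spanner A V} (h : HasNormalForm S) (Y : Finset V) :
    HasNormalForm (S.strEq Y) := by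
  obtain ⟨X, h⟩ := h
  refine ⟨X ∪ Y, fun F hF G => ?_⟩
  obtain ⟨H, Ys, R, hH, hYs, hR, hX, h⟩ := h F (Finset.union_subset_left hF) G
  have hYF : Y ⊆ F := Finset.union_subset_right hF
  obtain ⟨c, hc, hcF⟩ := exists_injOn_notMem Y (F ∪ G ∪ H)
  simp only [Finset.mem_union, not_or] at hcF
  -- Every tuple of `R` extends to the copies `c y` of the variables `y ∈ Y`.
  have hcopy : ∀ w, ∀ r ∈ R.rel w, ∃ r' ∈ (R.copyVars (F ∪ H) Y c).rel w,
      restrictTuple (F ∪ H) r' = r := by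
    classical
    intro w r hr
    let r' : SpanTuple V := fun z =>
      if z ∈ F ∪ H then r z else if hz : ∃ y ∈ Y, c y = z then r hz.choose else none
    have hr₁ : ∀ z ∈ F ∪ H, r' z = r z := fun z hz => if_pos hz
    have hr₂ : ∀ y ∈ Y, r' (c y) = r y := by
      intro y hy
      have hex : ∃ y' ∈ Y, c y' = c y := ⟨y, hy, rfl⟩
      have hmem : c y ∉ F ∪ H := by simpa using ⟨(hcF y hy).1.1, (hcF y hy).2⟩
      have := hc hex.choose_spec.1 hy hex.choose_spec.2
      simp only [r', hmem, if_false, hex, dif_pos, this]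
    have hr₃ : restrictTuple (F ∪ H) r' = r := by
      funext z
      by_cases hz : z ∈ F ∪ H
      · rw [restrictTuple, if_pos hz, hr₁ z hz]
      · rw [restrictTuple, if_neg hz, (hX w r hr).eq_none hz]
    refine ⟨r', ⟨fun z s hs => ?_, hr₃ ▸ hr, fun y hy => ?_⟩, hr₃⟩
    · by_cases hz : z ∈ F ∪ H
      · rw [hr₁ z hz] at hs
        exact ⟨Finset.mem_union_left _ hz, (hX w r hr z s hs).2⟩
      · by_cases hex : ∃ y ∈ Y, c y = z
        · obtain ⟨y, hy, rfl⟩ := hex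
          rw [hr₂ y hy] at hs
          exact ⟨Finset.mem_union_right _ (Finset.mem_image_of_mem c hy), (hX w r hr y s hs).2⟩
        · have hr' : r' z = none := (if_neg hz).trans (dif_neg hex)
          rw [hr'] at hs
          exact absurd hs (by simp)
    · rw [hr₂ y hy, hr₁ y (Finset.mem_union_left _ (hYF hy))]
  -- The selections on the copies and on the original variables are equivalent.
  have hsel : ∀ w, ∀ r' ∈ (R.copyVars (F ∪ H) Y c).rel w,
      (StrEqOn w (Y.image c) r' ↔ StrEqOn w Y (restrictTuple F r')) := by
    intro w r' hr'
    have hval : ∀ y ∈ Y, r' (c y) = restrictTuple F r' y := fun y hy => by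
      rw [hr'.2.2 y hy, restrictTuple, if_pos (hYF hy)]
    constructor
    · intro hs y hy z hz s s' hys hzs
      rw [← hval y hy] at hys
      rw [← hval z hz] at hzs
      exact hs _ (Finset.mem_image_of_mem c hy) _ (Finset.mem_image_of_mem c hz) s s' hys hzs
    · intro hs y' hy' z' hz' s s' hys hzs
      obtain ⟨y, hy, rfl⟩ := Finset.mem_image.1 hy'
      obtain ⟨z, hz, rfl⟩ := Finset.mem_image.1 hz'
      rw [hval y hy] at hys
      rw [hval z hz] at hzs
      exact hs y hy z hz s s' hys hzs
  have hrestrict : ∀ r' : SpanTuple V,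
      restrictTuple F (restrictTuple (F ∪ H) r') = restrictTuple F r' := by
    intro r'
    funext z
    by_cases hz : z ∈ F <;> simp [restrictTuple, hz]
  have hhidden : ∀ (r' : SpanTuple V), ∀ z ∈ H, restrictTuple (F ∪ H) r' z = r' z :=
    fun r' z hz => by simp [restrictTuple, hz]
  refine ⟨H ∪ Y.image c, Y.image c :: Ys, R.copyVars (F ∪ H) Y c, ?_, ?_, hR.copyVars _ _ _, ?_,
    fun w t => ⟨?_, ?_⟩⟩
  · intro x hx
    rcases Finset.mem_union.1 hx with hx | hx
    · exact hH x hx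
    · obtain ⟨y, hy, rfl⟩ := Finset.mem_image.1 hx
      exact (hcF y hy).1
  · intro Z hZ
    rcases List.mem_cons.1 hZ with rfl | hZ
    · exact Finset.subset_union_right
    · exact (hYs Z hZ).trans Finset.subset_union_left
  · intro w r' hr'
    rw [← Finset.union_assoc]
    exact hr'.1
  · rintro ⟨ht, hsY⟩
    obtain ⟨r, hr, hs, rfl⟩ := (h w t).1 ht
    obtain ⟨r', hr', rfl⟩ := hcopy w r hr
    rw [hrestrict] at hsY ⊢
    refine ⟨r', hr', fun Z hZ => ?_, rfl⟩
    rcases List.mem_cons.1 hZ with rfl | hZ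
    · exact (hsel w r' hr').2 hsY
    · exact (hs Z hZ).congr fun z hz => (hhidden r' z (hYs Z hZ hz)).symm
  · rintro ⟨r', hr', hs, rfl⟩
    refine ⟨(h w _).2 ⟨_, hr'.2.1, fun Z hZ => ?_, (hrestrict r').symm⟩,
      (hsel w r' hr').1 (hs _ List.mem_cons_self)⟩
    exact (hs Z (List.mem_cons_of_mem _ hZ)).congr fun z hz => hhidden r' z (hYs Z hZ hz)

theorem hasNormalForm_of_mem_closureUnder [Infinite V] {P : Set SpannerOp} {S : Spanner A V}
    (hS : S ∈ closureUnder (regexSpanners A V) P) : HasNormalForm S := by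
  induction hS with
  | base h =>
    exact (isRec_of_mem_regularSpanners (regexSpanners_subset_regularSpanners h)).hasNormalForm
  | union _ _ _ ih₁ ih₂ => exact ih₁.union ih₂
  | join _ _ _ ih₁ ih₂ => exact ih₁.join ih₂
  | proj Y _ _ ih => exact ih.proj Y
  | strEq Y _ _ ih => exact ih.strEq Y
  | fusion X lam x _ _ _ _ _ ih => exact ih.fusion lam x

/-- The normal form is built from a regular spanner with string-equality selections and one
projection. -/
theorem HasNormalForm.mem_closureUnder {P : Set SpannerOp} (hproj : SpannerOp.proj ∈ P)
    (hstrEq : SpannerOp.strEq ∈ P)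
    (hP : regularSpanners A V ⊆ closureUnder (regexSpanners A V) P) {S : Spanner A V}
    (hS : HasNormalForm S) : S ∈ closureUnder (regexSpanners A V) P := by
  obtain ⟨X, h⟩ := hS
  obtain ⟨-, Ys, R, -, -, hR, -, h⟩ := h X subset_rfl ∅
  have hfold : Ys.foldr Spanner.strEq R ∈ closureUnder (regexSpanners A V) P ∧
      ∀ w t, t ∈ (Ys.foldr Spanner.strEq R).rel w ↔ t ∈ R.rel w ∧ ∀ Y ∈ Ys, StrEqOn w Y t := by
    clear h
    induction Ys with
    | nil => exact ⟨hP hR.mem_regularSpanners, by simp⟩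
    | cons Y Ys ih =>
      refine ⟨InClosure.strEq Y hstrEq ih.1, fun w t => ?_⟩
      rw [List.forall_mem_cons, and_comm (a := StrEqOn w Y t), ← and_assoc, ← ih.2]
      rfl
  have heq : S = (Ys.foldr Spanner.strEq R).proj X := by
    ext w t
    rw [h]
    constructor
    · rintro ⟨r, hr, hs, rfl⟩
      exact ⟨r, (hfold.2 w r).2 ⟨hr, hs⟩, rfl⟩
    · rintro ⟨r, hr, rfl⟩
      exact ⟨r, ((hfold.2 w r).1 hr).1, ((hfold.2 w r).1 hr).2, rfl⟩
  rw [heq]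
  exact InClosure.proj X hproj hfold.1

end NormalForm

end DocSpanner

theorem mainTheorem9 (A V : Type*) [Finite A] [Infinite V] [DecidableEq V] :
    (DocSpanner.regularSpanners A V =
        DocSpanner.closureUnder (DocSpanner.regexSpanners A V)
          {DocSpanner.SpannerOp.union, DocSpanner.SpannerOp.join, DocSpanner.SpannerOp.proj} ∧
      DocSpanner.closureUnder (DocSpanner.regexSpanners A V)
          {DocSpanner.SpannerOp.union, DocSpanner.SpannerOp.join, DocSpanner.SpannerOp.proj} =
        DocSpanner.closureUnder (DocSpanner.regexSpanners A V)
          {DocSpanner.SpannerOp.fusion, DocSpanner.SpannerOp.proj}) ∧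
    (DocSpanner.coreSpanners A V =
        DocSpanner.closureUnder (DocSpanner.regexSpanners A V)
          {DocSpanner.SpannerOp.union, DocSpanner.SpannerOp.join, DocSpanner.SpannerOp.proj,
            DocSpanner.SpannerOp.strEq} ∧
      DocSpanner.closureUnder (DocSpanner.regexSpanners A V)
          {DocSpanner.SpannerOp.union, DocSpanner.SpannerOp.join, DocSpanner.SpannerOp.proj,
            DocSpanner.SpannerOp.strEq} =
        DocSpanner.closureUnder (DocSpanner.regexSpanners A V)
          {DocSpanner.SpannerOp.fusion, DocSpanner.SpannerOp.proj,
            DocSpanner.SpannerOp.strEq}) := by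
  have hjoin : DocSpanner.regularSpanners A V =
      DocSpanner.closureUnder (DocSpanner.regexSpanners A V)
        {DocSpanner.SpannerOp.union, DocSpanner.SpannerOp.join, DocSpanner.SpannerOp.proj} :=
    (DocSpanner.regularSpanners_subset_closureUnder_join (by simp) (by simp) (by simp)).antisymm
      (DocSpanner.closureUnder_subset_regularSpanners (by simp))
  have hfusion : DocSpanner.regularSpanners A V =
      DocSpanner.closureUnder (DocSpanner.regexSpanners A V)
        {DocSpanner.SpannerOp.fusion, DocSpanner.SpannerOp.proj} :=
    (DocSpanner.regularSpanners_subset_closureUnder_fusion (by simp)).antisymm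
      (DocSpanner.closureUnder_subset_regularSpanners (by simp))
  refine ⟨⟨hjoin, hjoin.symm.trans hfusion⟩, ?_, Set.Subset.antisymm ?_ ?_⟩
  · rw [DocSpanner.coreSpanners, Set.insert_comm DocSpanner.SpannerOp.proj]
  · exact fun S hS => (DocSpanner.hasNormalForm_of_mem_closureUnder hS).mem_closureUnder
      (by simp) (by simp) (DocSpanner.regularSpanners_subset_closureUnder_fusion (by simp))
  · exact fun S hS => (DocSpanner.hasNormalForm_of_mem_closureUnder hS).mem_closureUnder
      (by simp) (by simp)
      (DocSpanner.regularSpanners_subset_closureUnder_join (by simp) (by simp) (by simp))
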